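/- Let $\mathcal G$ be a compact connected metric graph (finitely many vertices and edges, at least one edge, every edge identified with a bounded interval of positive length; loops and multiple edges allowed) with total length $\ell$, and let $p>6$. Let $H^1(\mathcal G)$ be the space of continuous functions on $\mathcal G$ whose restriction to every edge is in $H^1$, with $\|u\|^2=\int_{\mathcal G}(|u'|^2+|u|^2)\,dx$. Put $$E(u)=\frac12\int_{\mathcal G}|u'|^2dx-\frac1p\int_{\mathcal G}|u|^pdx,\qquad H^1_\mu(\mathcal G)=\Bigl\{u\in H^1(\mathcal G):\int_{\mathcal G}|u|^2dx=\mu\Bigr\}.$$ For $u\in H^1_\mu(\mathcal G)$ let $\nabla E(u)$ be the constrained gradient: the element of $T_u=\{\varphi\in H^1(\mathcal G):\int_{\mathcal G}u\varphi\,dx=0\}$ with $\langle\nabla E(u),\varphi\rangle_{H^1}=E'(u)\varphi$ for all $\varphi\in T_u$. There are constants $K>0$ such that $$\int_{\mathcal G}|u|^pdx\le pK\Bigl(\int_{\mathcal G}|u|^2dx\Bigr)^{\frac{p+2}4}\Bigl(\int_{\mathcal G}|u'|^2dx\Bigr)^{\frac{p-2}4}+p\,\ell^{\frac{2-p}2}\Bigl(\int_{\mathcal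 G}|u|^2dx\Bigr)^{\frac p2}\quad\text{for all }u\in H^1(\mathcal G).$$ Fix any such $K$, let $b=\bigl(\frac{2}{(p-2)K}\bigr)^{\frac4{p-6}}$, and for $\mu>0$ let $$\rho^*=\min\{b,\,b\mu^{-\frac{p+2}{p-6}}\},\qquad M_2=\tfrac12\rho^*-K\mu^{\frac{p+2}4}(\rho^*)^{\frac{p-2}4}-\ell^{\frac{2-p}2}\mu^{\frac p2},$$ $$B^{M_2}=\Bigl\{u\in H^1_\mu(\mathcal G):\int_{\mathcal G}|u'|^2dx<\rho^*,\ E(u)<M_2\Bigr\}.$$ For $\nu>0$ let $D^*(\nu)$ be the set of $u\in H^1(\mathcal G)$ whose $H^1$-distance to $\{w\in H^1(\mathcal G):w\ge0\}$ or to $\{w\in H^1(\mathcal G):w\le0\}$ is at most $\nu$. Given $c\in\mathbb R$ (for instance a minimax level of $E$), $\varepsilon_1>0$, $\bar\varepsilon\ge3\varepsilon_1$ and $\delta_1>0$, let $\mathcal K$ be the set of critical points of $E$ constrained on $H^1_\mu(\mathcal G)$ with $c-\bar\varepsilon\le E\le c+\bar\varepsilon$; let $y:H^1_\mu(\mathcal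 G)\to[0,1]$ be any locally Lipschitz function that is $1$ outside the open $\delta_1/2$-neighbourhood of $\mathcal K$ and $0$ on the open $\delta_1/3$-neighbourhood of $\mathcal K$ (a neighbourhood of the empty set being empty); and let $$h(u)=\frac{\operatorname{dist}(u,U_1)}{\operatorname{dist}(u,U_2)+\operatorname{dist}(u,U_1)},\quad U_1=\{u\in H^1_\mu(\mathcal G):|E(u)-c|\ge3\varepsilon_1\},\quad U_2=\{u\in H^1_\mu(\mathcal G):|E(u)-c|\le2\varepsilon_1\}.$$ The flow $\eta$ on $H^1_\mu(\mathcal G)$ is defined by $$\partial_t\eta(t,u)=-h(\eta(t,u))\,y(\eta(t,u))\,\|\nabla E(\eta(t,u))\|^{-2}\,\nabla E(\eta(t,u)),\qquad\eta(0,u)=u,$$ the right-hand side being $0$ where $\nabla E=0$. **Proposition.** The equation $$pK\Bigl(\frac2{(p-2)K}\Bigr)^{\frac{p-2}{p-6}}\mu^{\frac{p-2}4}+p\,\ell^{\frac{2-p}2}\mu^{\frac{p-2}2}=1$$ has a unique positive solution $\tilde\mu$. For every $0<\mu\le\tilde\mu$ there is $\nu^*>0$ (depending only on $\mathcal G,p,K,\mu$)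 such that for all $0<\nu<\nu^*$, for every choice of $c,\bar\varepsilon,\varepsilon_1,\delta_1,y$ as above and every $u\in D^*(\nu)\cap B^{M_2}$, the solution $\eta(t,u)$ exists for all $t\ge0$, every solution with initial value $u$ on an interval $[0,T)$ coincides with it there, and $\eta(t,u)\in D^*(\nu)\cap B^{M_2}$ for all $t\in(0,\infty)$. -/

import Mathlib

open MeasureTheory Set
open scoped ContDiff

noncomputable section

/-- A connected metric graph with vertex set `V` and edge set `ι`; it is compact when `ι` is finite,
because every edge has finite length. The edge `e` is identified with the interval `[0, len e]`, the
end `0` being glued to the vertex `src e` and the end `len e` to the vertex `tgt e`. Loops and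
multiple edges are allowed. -/
structure MetricGraph (V ι : Type*) where
  src : ι → V
  tgt : ι → V
  len : ι → ℝ
  len_pos : ∀ e, 0 < len e
  connected : ∀ v w : V, Relation.EqvGen (fun a b => ∃ e, src e = a ∧ tgt e = b) v w

namespace MetricGraph

variable {V ι : Type*} [Fintype ι] (G : MetricGraph V ι)

/-- The total length `ℓ` of the graph. -/
def totalLength : ℝ := ∑ e, G.len e

/-- Lebesgue measure on the (open) edge `e`. -/
def edgeMeasure (e : ι) : Measure ℝ := volume.restrict (Ioo 0 (G.len e))

/-- `L²(G)`: families of `L²` functions on the edges, with `‖u‖² = ∑ₑ ‖uₑ‖²`. -/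
abbrev L2 : Type _ := PiLp 2 (fun e : ι => Lp ℝ 2 (G.edgeMeasure e))

/-- `g` is the weak derivative of `f` on the interval `(0, L)`. -/
def IsWeakDeriv (L : ℝ) (f g : ℝ → ℝ) : Prop :=
  ∀ φ : ℝ → ℝ, ContDiff ℝ ∞ φ → HasCompactSupport φ → tsupport φ ⊆ Ioo 0 L →
    ∫ x in Ioo 0 L, f x * deriv φ x = - ∫ x in Ioo 0 L, g x * φ x

/-- The pair `w = (u, u')` of `L²` functions represents an `H¹` function on the graph: there is a
function `f` that is continuous on the graph (continuous on each closed edge, and with one value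
`a v` at each vertex `v`) such that `u = f` almost everywhere, and `u'` is the weak derivative of
`f` on each edge. -/
def MemH1 (w : WithLp 2 (G.L2 × G.L2)) : Prop :=
  ∃ (f : ι → ℝ → ℝ) (a : V → ℝ), ∀ e : ι,
    ContinuousOn (f e) (Icc 0 (G.len e)) ∧
    f e 0 = a (G.src e) ∧ f e (G.len e) = a (G.tgt e) ∧
    (w.fst e : ℝ → ℝ) =ᵐ[G.edgeMeasure e] f e ∧
    IsWeakDeriv (G.len e) (f e) (w.snd e)

theorem integrable_mul_deriv_test {L : ℝ} {f φ : ℝ → ℝ} (hf : ContinuousOn f (Icc 0 L))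
    (hφ : ContDiff ℝ ∞ φ) : IntegrableOn (fun x => f x * deriv φ x) (Ioo 0 L) := by
  have h : ContinuousOn (fun x => f x * deriv φ x) (Icc 0 L) :=
    hf.mul (hφ.continuous_deriv (by simp)).continuousOn
  exact (h.integrableOn_compact isCompact_Icc).mono_set Ioo_subset_Icc_self

theorem integrable_mul_test (e : ι) (g : Lp ℝ 2 (G.edgeMeasure e)) {φ : ℝ → ℝ}
    (hφ : ContDiff ℝ ∞ φ) : IntegrableOn (fun x => g x * φ x) (Ioo 0 (G.len e)) := by
  have h1 : MemLp φ 2 (volume.restrict (Ioo 0 (G.len e))) := by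
    obtain ⟨C, hC⟩ := isCompact_Icc.exists_bound_of_continuousOn (s := Icc 0 (G.len e))
      hφ.continuous.continuousOn
    refine MemLp.of_bound hφ.continuous.aestronglyMeasurable C ?_
    filter_upwards [ae_restrict_mem measurableSet_Ioo] with x hx
    exact hC x (Ioo_subset_Icc_self hx)
  exact MemLp.integrable_mul (Lp.memLp g) h1

theorem memH1_add {w z : WithLp 2 (G.L2 × G.L2)} (hw : G.MemH1 w) (hz : G.MemH1 z) :
    G.MemH1 (w + z) := by
  obtain ⟨f, a, hf⟩ := hw
  obtain ⟨f', a', hf'⟩ := hz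
  refine ⟨fun e x => f e x + f' e x, fun v => a v + a' v, fun e => ?_⟩
  obtain ⟨c1, s1, t1, e1, d1⟩ := hf e
  obtain ⟨c2, s2, t2, e2, d2⟩ := hf' e
  refine ⟨c1.add c2, by simp [s1, s2], by simp [t1, t2], ?_, ?_⟩
  · filter_upwards [Lp.coeFn_add (w.fst e) (z.fst e), e1, e2] with x h1 h2 h3
    have : (w + z).fst e = w.fst e + z.fst e := rfl
    rw [this, h1, Pi.add_apply, h2, h3]
  · intro φ h1 h2 h3
    have hs : (w + z).snd e = w.snd e + z.snd e := rfl
    have : ∫ x in Ioo 0 (G.len e), ((w + z).snd e : ℝ → ℝ) x * φ x =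
        ∫ x in Ioo 0 (G.len e), (w.snd e x * φ x + z.snd e x * φ x) := by
      refine integral_congr_ae ?_
      filter_upwards [Lp.coeFn_add (w.snd e) (z.snd e)] with x hx
      rw [hs, hx, Pi.add_apply, add_mul]
    rw [this, integral_add (G.integrable_mul_test e _ h1) (G.integrable_mul_test e _ h1), neg_add,
      ← d1 φ h1 h2 h3, ← d2 φ h1 h2 h3,
      ← integral_add (integrable_mul_deriv_test c1 h1) (integrable_mul_deriv_test c2 h1)]
    simp only [add_mul]

theorem memH1_smul (c : ℝ) {w : WithLp 2 (G.L2 × G.L2)} (hw : G.MemH1 w) :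
    G.MemH1 (c • w) := by
  obtain ⟨f, a, hf⟩ := hw
  refine ⟨fun e x => c * f e x, fun v => c * a v, fun e => ?_⟩
  obtain ⟨c1, s1, t1, e1, d1⟩ := hf e
  refine ⟨continuousOn_const.mul c1, by simp [s1], by simp [t1], ?_, ?_⟩
  · filter_upwards [Lp.coeFn_smul c (w.fst e), e1] with x h1 h2
    have : (c • w).fst e = c • w.fst e := rfl
    rw [this, h1, Pi.smul_apply, h2, smul_eq_mul]
  · intro φ h1 h2 h3
    have hs : (c • w).snd e = c • w.snd e := rfl
    have : ∫ x in Ioo 0 (G.len e), ((c • w).snd e : ℝ → ℝ) x * φ x =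
        ∫ x in Ioo 0 (G.len e), c * (w.snd e x * φ x) := by
      refine integral_congr_ae ?_
      filter_upwards [Lp.coeFn_smul c (w.snd e)] with x hx
      rw [hs, hx, Pi.smul_apply, smul_eq_mul, mul_assoc]
    rw [this, integral_const_mul, ← mul_neg, ← d1 φ h1 h2 h3, ← integral_const_mul]
    simp only [mul_assoc]

theorem memH1_zero : G.MemH1 (0 : WithLp 2 (G.L2 × G.L2)) := by
  refine ⟨fun _ _ => 0, fun _ => 0, fun e => ⟨continuousOn_const, rfl, rfl, ?_, ?_⟩⟩
  · exact Lp.coeFn_zero ℝ 2 (G.edgeMeasure e)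
  · intro φ _ _ _
    have : ∫ x in Ioo 0 (G.len e),
        ((0 : WithLp 2 (G.L2 × G.L2)).snd e : ℝ → ℝ) x * φ x =
        ∫ x in Ioo 0 (G.len e), (0 : ℝ) := by
      refine integral_congr_ae ?_
      filter_upwards [Lp.coeFn_zero ℝ 2 (G.edgeMeasure e)] with x hx
      have h0 : (0 : WithLp 2 (G.L2 × G.L2)).snd e = 0 := rfl
      rw [h0, hx]; simp
    rw [this]; simp

/-- The space `H¹(G)`, each function `u` being represented by the pair `(u, u')`. Its inner product
is the one of `L² × L²`, so that `‖u‖² = ∑ₑ (‖uₑ‖² + ‖uₑ'‖²)`. -/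
def H1 : Submodule ℝ (WithLp 2 (G.L2 × G.L2)) where
  carrier := {w | G.MemH1 w}
  add_mem' := G.memH1_add
  zero_mem' := G.memH1_zero
  smul_mem' c _ := G.memH1_smul c

variable {G}

/-- The restriction `uₑ` of `u` to the edge `e`. -/
def val (u : G.H1) (e : ι) : ℝ → ℝ := u.1.fst e

/-- The weak derivative `uₑ'` of `u` on the edge `e`. -/
def der (u : G.H1) (e : ι) : ℝ → ℝ := u.1.snd e

/-- `∫ u φ` over the graph. -/
def pairing (u φ : G.H1) : ℝ := ∑ e, ∫ x in Ioo 0 (G.len e), val u e x * val φ e x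

/-- The mass `∫ |u|²`. -/
def mass (u : G.H1) : ℝ := ∑ e, ∫ x in Ioo 0 (G.len e), |val u e x| ^ 2

/-- The kinetic term `∫ |u'|²`. -/
def kinetic (u : G.H1) : ℝ := ∑ e, ∫ x in Ioo 0 (G.len e), |der u e x| ^ 2

/-- `∫ |u|^p`. -/
def powInt (p : ℝ) (u : G.H1) : ℝ := ∑ e, ∫ x in Ioo 0 (G.len e), |val u e x| ^ p

/-- The energy `E(u) = (1/2) ∫ |u'|² - (1/p) ∫ |u|^p`. -/
def energy (p : ℝ) (u : G.H1) : ℝ := 1 / 2 * kinetic u - 1 / p * powInt p u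

variable (G)

/-- The mass constraint `H¹_μ(G)`. -/
def massSphere (μ : ℝ) : Set G.H1 := {u | mass u = μ}

/-- The positive cone. A function in `H¹(G)` is continuous, so being nonnegative almost everywhere
is the same as being nonnegative. -/
def posCone : Set G.H1 := {u | ∀ e, ∀ᵐ x ∂(G.edgeMeasure e), 0 ≤ val u e x}

/-- The negative cone. -/
def negCone : Set G.H1 := {u | ∀ e, ∀ᵐ x ∂(G.edgeMeasure e), val u e x ≤ 0}

/-- `D*(ν)`: the points at `H¹`-distance at most `ν` from the positive or the negative cone. -/
def dStar (ν : ℝ) : Set G.H1 :=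
  {u | Metric.infDist u G.posCone ≤ ν} ∪ {u | Metric.infDist u G.negCone ≤ ν}

/-- `K` is an admissible constant in the Gagliardo-Nirenberg type inequality. -/
def IsGNConst (p K : ℝ) : Prop :=
  0 < K ∧ ∀ u : G.H1, powInt p u ≤
    p * K * mass u ^ ((p + 2) / 4) * kinetic u ^ ((p - 2) / 4) +
      p * G.totalLength ^ ((2 - p) / 2) * mass u ^ (p / 2)

/-- The equation whose positive solution is the threshold mass. -/
def IsMuTilde (p K m : ℝ) : Prop :=
  0 < m ∧
    p * K * (2 / ((p - 2) * K)) ^ ((p - 2) / (p - 6)) * m ^ ((p - 2) / 4) +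
      p * G.totalLength ^ ((2 - p) / 2) * m ^ ((p - 2) / 2) = 1

/-- `ρ* = min {b, b μ^{-(p+2)/(p-6)}}` with `b = (2 / ((p-2)K))^{4/(p-6)}`. -/
def rhoStar (p K μ : ℝ) : ℝ :=
  min ((2 / ((p - 2) * K)) ^ (4 / (p - 6)))
    ((2 / ((p - 2) * K)) ^ (4 / (p - 6)) * μ ^ (-((p + 2) / (p - 6))))

/-- `M₂ = g(ρ*) - ℓ^{(2-p)/2} μ^{p/2}` with `g(ρ) = ρ/2 - K μ^{(p+2)/4} ρ^{(p-2)/4}`. -/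
def M2 (p K μ : ℝ) : ℝ :=
  1 / 2 * rhoStar p K μ - K * μ ^ ((p + 2) / 4) * rhoStar p K μ ^ ((p - 2) / 4) -
    G.totalLength ^ ((2 - p) / 2) * μ ^ (p / 2)

/-- `B^{M₂}`: the `u ∈ H¹_μ(G)` with `∫ |u'|² < ρ*` and `E(u) < M₂`. -/
def BM2 (p K μ : ℝ) : Set G.H1 :=
  {u | u ∈ G.massSphere μ ∧ kinetic u < rhoStar p K μ ∧ energy p u < G.M2 p K μ}

variable {G}

/-- The tangent space to the mass constraint at `u`. -/
def tangent (u : G.H1) : Set G.H1 := {φ | pairing u φ = 0}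

/-- `v` is the constrained gradient `∇E(u)`: it is tangent, and it represents in the `H¹` inner
product the restriction of the differential `dE(u)` to the tangent space. -/
def IsConstrGrad (p : ℝ) (u v : G.H1) : Prop :=
  v ∈ tangent u ∧ ∀ φ ∈ tangent u, inner ℝ v φ = fderiv ℝ (energy p) u φ

open Classical in
/-- The gradient `∇E(u)` of the energy as a functional on the mass constraint. (It exists and is
unique by the Riesz theorem in the tangent space.) -/
def constrGrad (p : ℝ) (u : G.H1) : G.H1 :=
  if h : ∃ v, IsConstrGrad p u v then h.choose else 0

variable (G)

/-- The constrained critical points of the energy with energy in `[α, β]`. -/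
def critSet (p μ α β : ℝ) : Set G.H1 :=
  {u | u ∈ G.massSphere μ ∧ (∀ φ ∈ tangent u, fderiv ℝ (energy p) u φ = 0) ∧
    α ≤ energy p u ∧ energy p u ≤ β}

/-- The cut-off `h`, equal to `0` where `|E - c| ≥ 3ε₁` and to `1` where `|E - c| ≤ 2ε₁`. -/
def cutoffH (p μ c ε₁ : ℝ) (u : G.H1) : ℝ :=
  Metric.infDist u {w | w ∈ G.massSphere μ ∧ 3 * ε₁ ≤ |energy p w - c|} /
    (Metric.infDist u {w | w ∈ G.massSphere μ ∧ |energy p w - c| ≤ 2 * ε₁} +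
      Metric.infDist u {w | w ∈ G.massSphere μ ∧ 3 * ε₁ ≤ |energy p w - c|})

/-- `y` is an admissible cut-off near the critical set: on `H¹_μ(G)` it is locally Lipschitz with
values in `[0,1]`, it is `1` off the `δ/2`-neighbourhood of the critical points with energy in
`[c - ε, c + ε]`, and `0` on their `δ/3`-neighbourhood. Its values off `H¹_μ(G)` play no role. -/
def IsCutoffY (p μ c ε δ : ℝ) (y : G.H1 → ℝ) : Prop :=
  LocallyLipschitzOn (G.massSphere μ) y ∧
  ∀ u ∈ G.massSphere μ, y u ∈ Icc (0 : ℝ) 1 ∧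
    (u ∉ Metric.thickening (δ / 2) (G.critSet p μ (c - ε) (c + ε)) → y u = 1) ∧
    (u ∈ Metric.thickening (δ / 3) (G.critSet p μ (c - ε) (c + ε)) → y u = 0)

/-- The vector field `-h y ‖∇E‖⁻² ∇E` (which is `0` at the points where `∇E = 0`). -/
def flowField (p μ c ε₁ : ℝ) (y : G.H1 → ℝ) (u : G.H1) : G.H1 :=
  -((G.cutoffH p μ c ε₁ u * y u * (‖constrGrad p u‖ ^ 2)⁻¹) • constrGrad p u)

/-- `σ` solves on the time interval `I` (with left end `0 ∈ I`) the initial value problem for the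
vector field above on `H¹_μ(G)`, starting from `u`. -/
def IsFlowLine (p μ c ε₁ : ℝ) (y : G.H1 → ℝ) (I : Set ℝ) (u : G.H1) (σ : ℝ → G.H1) : Prop :=
  σ 0 = u ∧ ∀ t ∈ I, σ t ∈ G.massSphere μ ∧
    HasDerivWithinAt σ (G.flowField p μ c ε₁ y (σ t)) I t

end MetricGraph

end

/-! Write R for (1 - Δ)⁻¹ with Kirchhoff conditions, that is, the adjoint of the embedding of H¹
into L², and g(u) = |u|^(p-2) u. In the H¹ product the energy has gradient u - R(u + g(u)), and half
the mass has gradient Ru. The constrained gradient is therefore the orthogonal projection ∇E(u) = u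
- (R g(u) + λ Ru), with λ ‖Ru‖² = ∫u² - ⟨R g(u), Ru⟩.

The heart of the matter is that b = R g(u) + λ Ru is nonnegative when u is close to the positive
cone. Firstly λ ≥ 0: since R is Markovian, ⟨R g(u), Ru⟩ = ∫ g(u) Ru ≤ ∫|u|^p
(`inner_nonlin_massGrad_le`), and on the set `BM2` with μ ≤ μ̃ the Gagliardo-Nirenberg inequality
gives ∫|u|^p ≤ μ (`powInt_le_mass_of_kinetic_lt`); the equation for μ̃ is made for this. Secondly Ru
and R g(u) are nonnegative although u may be slightly negative: by a Harnack inequality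
(`exists_harnack`) the values of Rf are comparable for f ≥ 0, so a large mean beats a small negative
part, and fixed mass with bounded kinetic energy keeps the mean of u away from zero
(`exists_resolvent_mem_posCone_of_near`).

Hence the flow field near the cone is θ(b - u) with θ ≥ 0 and b in the cone. It points towards a
convex set, so the distance to the cone cannot leave a sublevel (`IsSolutionOn.infDist_le`). The
negative cone follows because ∇E is odd. The set `BM2` is invariant because E does not increase
along the flow and E ≥ M₂ wherever the kinetic energy equals ρ*.

Global existence uses this invariance. The field is locally Lipschitz on the mass constraint,
because one of the two cut-offs vanishes near each zero of ∇E. A trajectory in `BM2` is bounded in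
H¹, and there Palais-Smale compactness bounds ‖∇E‖ from below wherever the cut-offs are not zero
(`exists_le_norm_constrGrad`). So the speed is bounded, and solutions extend to all times. -/

noncomputable section

/-! ### Absolute continuity and weak derivatives on an interval -/

theorem AbsolutelyContinuousOnInterval.lipschitzOn_comp {f g : ℝ → ℝ} {a b : ℝ} {K : NNReal}
    {s : Set ℝ} (hg : LipschitzOnWith K g s) (hf : AbsolutelyContinuousOnInterval f a b)
    (hs : MapsTo f (uIcc a b) s) : AbsolutelyContinuousOnInterval (fun x => g (f x)) a b := by
  rw [absolutelyContinuousOnInterval_iff] at hf ⊢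
  intro ε hε
  obtain ⟨δ, hδ, h⟩ := hf (ε / (K + 1)) (by positivity)
  refine ⟨δ, hδ, fun E hE hlen => ?_⟩
  have h1 := h E hE hlen
  calc ∑ i ∈ Finset.range E.1, dist (g (f (E.2 i).1)) (g (f (E.2 i).2))
      ≤ ∑ i ∈ Finset.range E.1, K * dist (f (E.2 i).1) (f (E.2 i).2) :=
        Finset.sum_le_sum fun i hi =>
          hg.dist_le_mul _ (hs (hE.1 i hi).1) _ (hs (hE.1 i hi).2)
    _ = K * ∑ i ∈ Finset.range E.1, dist (f (E.2 i).1) (f (E.2 i).2) := by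
        rw [Finset.mul_sum]
    _ ≤ K * (ε / (K + 1)) := by gcongr
    _ < (K + 1) * (ε / (K + 1)) := by gcongr; linarith
    _ = ε := by field

theorem AbsolutelyContinuousOnInterval.congr {f g : ℝ → ℝ} {a b : ℝ}
    (hf : AbsolutelyContinuousOnInterval f a b) (h : EqOn f g (uIcc a b)) :
    AbsolutelyContinuousOnInterval g a b := by
  rw [absolutelyContinuousOnInterval_iff] at hf ⊢
  intro ε hε
  obtain ⟨δ, hδ, hh⟩ := hf ε hε
  refine ⟨δ, hδ, fun E hE hlen => ?_⟩
  refine lt_of_eq_of_lt (Finset.sum_congr rfl fun i hi => ?_) (hh E hE hlen)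
  rw [h (hE.1 i hi).1, h (hE.1 i hi).2]

theorem AbsolutelyContinuousOnInterval.ae_hasDerivAt_Ioo {f : ℝ → ℝ} {L : ℝ}
    (hf : AbsolutelyContinuousOnInterval f 0 L) :
    ∀ᵐ x ∂(volume.restrict (Ioo 0 L)), HasDerivAt f (deriv f x) x := by
  rw [ae_restrict_iff' measurableSet_Ioo]
  filter_upwards [hf.ae_differentiableAt] with x hx hx'
  exact (hx (Ioo_subset_Icc_self.trans Icc_subset_uIcc hx')).hasDerivAt

theorem setIntegral_Ioo_eq_intervalIntegral {L : ℝ} (hL : 0 ≤ L) (f : ℝ → ℝ) :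
    ∫ x in Ioo 0 L, f x = ∫ x in (0 : ℝ)..L, f x := by
  rw [intervalIntegral.integral_of_le hL, integral_Ioc_eq_integral_Ioo]

theorem MetricGraph.isWeakDeriv_of_absolutelyContinuousOnInterval {L : ℝ} (hL : 0 < L)
    {f g : ℝ → ℝ} (hf : AbsolutelyContinuousOnInterval f 0 L)
    (hg : g =ᵐ[volume.restrict (Ioo 0 L)] deriv f) : MetricGraph.IsWeakDeriv L f g := by
  intro φ h1 h2 h3
  have hφ : AbsolutelyContinuousOnInterval φ 0 L :=
    (h1.of_le (by simp)).contDiffOn.absolutelyContinuousOnInterval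
  have z0 : φ 0 = 0 := image_eq_zero_of_notMem_tsupport fun h => (lt_irrefl _ (h3 h).1)
  have zL : φ L = 0 := image_eq_zero_of_notMem_tsupport fun h => (lt_irrefl _ (h3 h).2)
  have : ∫ x in Ioo 0 L, g x * φ x = ∫ x in Ioo 0 L, deriv f x * φ x := by
    refine integral_congr_ae ?_
    filter_upwards [hg] with x hx
    rw [hx]
  rw [this, setIntegral_Ioo_eq_intervalIntegral hL.le, setIntegral_Ioo_eq_intervalIntegral hL.le,
    hf.integral_mul_deriv_eq_deriv_mul hφ, z0, zL]
  ring

theorem IsCompact.exists_subset_Icc_of_subset_Ioo {K : Set ℝ} {a b : ℝ} (hab : a < b)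
    (hK : IsCompact K) (h : K ⊆ Ioo a b) : ∃ c d, a < c ∧ d < b ∧ K ⊆ Icc c d := by
  rcases K.eq_empty_or_nonempty with rfl | hne
  · exact ⟨b, a, hab, hab, empty_subset _⟩
  · obtain ⟨c, hc, hc'⟩ := hK.exists_isLeast hne
    obtain ⟨d, hd, hd'⟩ := hK.exists_isGreatest hne
    exact ⟨c, d, (h hc).1, (h hd).2, fun x hx => ⟨hc' hx, hd' hx⟩⟩

/-- The du Bois-Reymond lemma on `[0, L]` for continuous functions. -/
theorem exists_eq_const_of_forall_integral_mul_deriv_eq_zero {L : ℝ} (hL : 0 < L) {k : ℝ → ℝ}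
    (hk : ContinuousOn k (Icc 0 L))
    (h : ∀ φ : ℝ → ℝ, ContDiff ℝ ∞ φ → HasCompactSupport φ → tsupport φ ⊆ Ioo 0 L →
      ∫ x in Ioo 0 L, k x * deriv φ x = 0) :
    ∃ c, ∀ x ∈ Icc 0 L, k x = c := by
  obtain ⟨χ₀, s0, c0, d0, r0, o0⟩ := exists_contDiff_tsupport_subset (E := ℝ) (n := ⊤)
    (s := Ioo 0 L) (x := L / 2) (Ioo_mem_nhds (by linarith) (by linarith))
  have hpos : 0 < ∫ x, χ₀ x := by
    refine d0.continuous.integral_pos_of_hasCompactSupport_nonneg_nonzero c0 (x := L / 2)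
      (fun x => (r0 ⟨x, rfl⟩).1) (by simp [o0])
  set J := ∫ x, χ₀ x with hJ
  have hki : IntegrableOn k (Ioo 0 L) :=
    (hk.integrableOn_compact isCompact_Icc).mono_set Ioo_subset_Icc_self
  have hmul : ∀ ψ : ℝ → ℝ, Continuous ψ → IntegrableOn (fun x => k x * ψ x) (Ioo 0 L) :=
    fun ψ hψ => ((hk.mul hψ.continuousOn).integrableOn_compact isCompact_Icc).mono_set
      Ioo_subset_Icc_self
  set c := J⁻¹ * ∫ x in Ioo 0 L, k x * χ₀ x with hc
  have key : ∀ᵐ x ∂volume, x ∈ Ioo 0 L → k x - c = 0 := by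
    refine isOpen_Ioo.ae_eq_zero_of_integral_contDiff_smul_eq_zero
      ((hki.sub (integrableOn_const (by simp))).locallyIntegrableOn) ?_
    intro ψ d1 c1 s1
    -- Subtracting this multiple of the bump `χ₀` makes the integral zero, so that the primitive of
    -- `θ` has compact support and is an admissible test function.
    set A := (∫ x, ψ x) * J⁻¹ with hA
    set θ : ℝ → ℝ := fun x => ψ x - A * χ₀ x with hθ
    have dθ : ContDiff ℝ ∞ θ := d1.sub (contDiff_const.mul d0)
    have iψ : Integrable ψ := d1.continuous.integrable_of_hasCompactSupport c1
    have iχ : Integrable χ₀ := d0.continuous.integrable_of_hasCompactSupport c0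
    have iθ : Integrable θ := iψ.sub (iχ.const_mul A)
    have zθ : ∫ x, θ x = 0 := by
      rw [hθ, integral_sub iψ (iχ.const_mul A), integral_const_mul, ← hJ, hA, mul_assoc,
        inv_mul_cancel₀ hpos.ne']
      ring
    obtain ⟨a, b, ha, hb, hab⟩ := IsCompact.exists_subset_Icc_of_subset_Ioo hL
      (c0.isCompact.union c1.isCompact) (union_subset s0 s1)
    have θ0 : ∀ x, x ∉ Icc a b → θ x = 0 := by
      intro x hx
      have e1 : χ₀ x = 0 := image_eq_zero_of_notMem_tsupport fun h => hx (hab (Or.inl h))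
      have e2 : ψ x = 0 := image_eq_zero_of_notMem_tsupport fun h => hx (hab (Or.inr h))
      simp [hθ, e1, e2]
    set φ : ℝ → ℝ := fun x => ∫ t in Iic x, θ t with hφ
    have dφ : ∀ x, HasDerivAt φ (θ x) x := by
      intro x
      have e : φ = fun y => (∫ t in (0 : ℝ)..y, θ t) + ∫ t in Iic 0, θ t := by
        funext y
        rw [← intervalIntegral.integral_Iic_sub_Iic iθ.integrableOn iθ.integrableOn]
        simp [hφ]
      rw [e]
      exact (intervalIntegral.integral_hasDerivAt_right (iθ.intervalIntegrable)
        (dθ.continuous.stronglyMeasurableAtFilter _ _) dθ.continuous.continuousAt).add_const _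
    have dφ' : deriv φ = θ := funext fun x => (dφ x).deriv
    have φ0 : ∀ x, x ∉ Icc a b → φ x = 0 := by
      intro x hx
      rcases not_and_or.1 hx with hx | hx
      · refine setIntegral_eq_zero_of_forall_eq_zero fun t ht => θ0 t fun h => ?_
        exact hx (h.1.trans ht)
      · rw [← zθ]
        refine setIntegral_eq_integral_of_forall_compl_eq_zero fun t ht => θ0 t fun h => ?_
        simp only [mem_Iic, not_le] at ht hx
        linarith [h.2]
    have tφ : tsupport φ ⊆ Icc a b := by
      refine closure_minimal (fun x hx => ?_) isClosed_Icc
      by_contra h'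
      exact hx (φ0 x h')
    have := h φ (contDiff_infty_iff_deriv.2 ⟨fun x => (dφ x).differentiableAt, dφ' ▸ dθ⟩)
      (HasCompactSupport.of_support_subset_isCompact isCompact_Icc (subset_tsupport _ |>.trans tφ))
      (tφ.trans fun x hx => ⟨ha.trans_le hx.1, hx.2.trans_lt hb⟩)
    rw [dφ'] at this
    have e1 : ∫ x in Ioo 0 L, k x * θ x
        = (∫ x in Ioo 0 L, k x * ψ x) - A * ∫ x in Ioo 0 L, k x * χ₀ x := by
      rw [← integral_const_mul, ← integral_sub (hmul _ d1.continuous)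
        ((hmul _ d0.continuous).const_mul A)]
      refine integral_congr_ae (Filter.Eventually.of_forall fun x => ?_)
      simp only [hθ]; ring
    have e2 : ∫ x, ψ x • (k x - c) = (∫ x in Ioo 0 L, k x * ψ x) - c * ∫ x in Ioo 0 L, ψ x := by
      rw [← integral_const_mul, ← integral_sub (hmul _ d1.continuous)
        (iψ.integrableOn.const_mul c), ← setIntegral_eq_integral_of_forall_compl_eq_zero
          (s := Ioo 0 L)]
      · refine integral_congr_ae (Filter.Eventually.of_forall fun x => ?_)
        simp only [smul_eq_mul]; ring
      · intro x hx
        rw [image_eq_zero_of_notMem_tsupport fun h => hx (s1 h), zero_smul]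
    have e3 : ∫ x in Ioo 0 L, ψ x = ∫ x, ψ x :=
      setIntegral_eq_integral_of_forall_compl_eq_zero fun x hx =>
        image_eq_zero_of_notMem_tsupport fun h => hx (s1 h)
    rw [e2, e3, hc]
    rw [e1, hA] at this
    linarith
  refine ⟨c, ?_⟩
  have := Measure.eqOn_Icc_of_ae_eq (μ := volume) (f := k) (g := fun _ => c) hL.ne ?_ hk
    continuousOn_const
  · exact fun x hx => this hx
  · rw [Filter.EventuallyEq, ae_restrict_iff' measurableSet_Icc]
    have e1 : ∀ᵐ x ∂(volume : Measure ℝ), x ≠ 0 := by simp [ae_iff]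
    have e2 : ∀ᵐ x ∂(volume : Measure ℝ), x ≠ L := by simp [ae_iff]
    filter_upwards [key, e1, e2] with x hx n1 n2 hx'
    have := hx ⟨lt_of_le_of_ne hx'.1 (Ne.symm n1), lt_of_le_of_ne hx'.2 n2⟩
    linarith

/-- The difference of `f` and the primitive of `g` has weak derivative zero, hence is constant by
the du Bois-Reymond lemma; the primitive of an integrable function is absolutely continuous. -/
theorem MetricGraph.IsWeakDeriv.absolutelyContinuousOnInterval {L : ℝ} (hL : 0 < L)
    {f g : ℝ → ℝ} (hf : ContinuousOn f (Icc 0 L)) (hg : IntegrableOn g (Ioo 0 L))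
    (h : MetricGraph.IsWeakDeriv L f g) :
    AbsolutelyContinuousOnInterval f 0 L ∧ g =ᵐ[volume.restrict (Ioo 0 L)] deriv f := by
  have hgi : IntervalIntegrable g volume 0 L := by
    rw [intervalIntegrable_iff_integrableOn_Ioo_of_le hL.le]; exact hg
  set Γ : ℝ → ℝ := fun x => ∫ t in (0 : ℝ)..x, g t with hΓ
  have acΓ : AbsolutelyContinuousOnInterval Γ 0 L :=
    hgi.absolutelyContinuousOnInterval_intervalIntegral (by simp)
  have dΓ : ∀ᵐ x ∂(volume.restrict (Ioo 0 L)), HasDerivAt Γ (g x) x := by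
    rw [ae_restrict_iff' measurableSet_Ioo]
    filter_upwards [hgi.ae_hasDerivAt_integral] with x hx hx'
    exact hx (Ioo_subset_Icc_self.trans Icc_subset_uIcc hx') 0 (by simp)
  have wΓ : MetricGraph.IsWeakDeriv L Γ g :=
    MetricGraph.isWeakDeriv_of_absolutelyContinuousOnInterval hL acΓ (by
      filter_upwards [dΓ] with x hx using hx.deriv.symm)
  have cΓ : ContinuousOn Γ (Icc 0 L) := by simpa [uIcc_of_le hL.le] using acΓ.continuousOn
  obtain ⟨c, hc⟩ := exists_eq_const_of_forall_integral_mul_deriv_eq_zero hL (k := fun x => f x - Γ x)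
    (hf.sub cΓ) (by
      intro φ h1 h2 h3
      have i1 := MetricGraph.integrable_mul_deriv_test hf h1
      have i2 := MetricGraph.integrable_mul_deriv_test cΓ h1
      simp only [sub_mul]
      rw [integral_sub i1 i2, h φ h1 h2 h3, wΓ φ h1 h2 h3]
      ring)
  have e : EqOn (fun x => Γ x + c) f (uIcc 0 L) := by
    intro x hx
    rw [uIcc_of_le hL.le] at hx
    have := hc x hx
    simp only at this ⊢
    linarith
  refine ⟨AbsolutelyContinuousOnInterval.congr (acΓ.add
    (LipschitzWith.const c).lipschitzOnWith.absolutelyContinuousOnInterval) e, ?_⟩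
  filter_upwards [dΓ, ae_restrict_mem measurableSet_Ioo] with x hx hx'
  have : HasDerivAt f (g x) x := (hx.add_const c).congr_of_eventuallyEq <| by
    filter_upwards [Icc_mem_nhds hx'.1 hx'.2] with y hy
    exact (e (Icc_subset_uIcc hy)).symm
  exact this.deriv.symm

/-! ### Representatives of H¹ functions and the norms -/

namespace MetricGraph

variable {V ι : Type*} [Fintype ι] {G : MetricGraph V ι}

instance (e : ι) : IsFiniteMeasure (G.edgeMeasure e) := by
  unfold edgeMeasure; infer_instance

omit [Fintype ι] in
theorem edgeMeasure_real_univ (e : ι) : (G.edgeMeasure e).real univ = G.len e := by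
  simp [edgeMeasure, Measure.real, (G.len_pos e).le]

theorem exists_absolutelyContinuous_rep (u : G.H1) : ∃ (f : ι → ℝ → ℝ) (a : V → ℝ), ∀ e : ι,
    AbsolutelyContinuousOnInterval (f e) 0 (G.len e) ∧
    f e 0 = a (G.src e) ∧ f e (G.len e) = a (G.tgt e) ∧
    val u e =ᵐ[G.edgeMeasure e] f e ∧ der u e =ᵐ[G.edgeMeasure e] deriv (f e) := by
  obtain ⟨f, a, h⟩ := u.2
  refine ⟨f, a, fun e => ?_⟩
  obtain ⟨h1, h2, h3, h4, h5⟩ := h e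
  have hi : IntegrableOn (der u e) (Ioo 0 (G.len e)) :=
    (Lp.memLp (u.1.snd e)).integrable (by norm_num)
  obtain ⟨h6, h7⟩ := h5.absolutelyContinuousOnInterval (G.len_pos e) h1 hi
  exact ⟨h6, h2, h3, h4, h7⟩

/-- The absolutely continuous representative of `u` on the closed edges. -/
def rep (u : G.H1) : ι → ℝ → ℝ := (exists_absolutelyContinuous_rep u).choose

/-- The values of `u` at the vertices. -/
def vertexVal (u : G.H1) : V → ℝ := (exists_absolutelyContinuous_rep u).choose_spec.choose

theorem rep_ac (u : G.H1) (e : ι) : AbsolutelyContinuousOnInterval (rep u e) 0 (G.len e) :=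
  ((exists_absolutelyContinuous_rep u).choose_spec.choose_spec e).1

theorem rep_zero (u : G.H1) (e : ι) : rep u e 0 = vertexVal u (G.src e) :=
  ((exists_absolutelyContinuous_rep u).choose_spec.choose_spec e).2.1

theorem rep_len (u : G.H1) (e : ι) : rep u e (G.len e) = vertexVal u (G.tgt e) :=
  ((exists_absolutelyContinuous_rep u).choose_spec.choose_spec e).2.2.1

theorem val_ae_eq_rep (u : G.H1) (e : ι) : val u e =ᵐ[G.edgeMeasure e] rep u e :=
  ((exists_absolutelyContinuous_rep u).choose_spec.choose_spec e).2.2.2.1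

theorem der_ae_eq_deriv_rep (u : G.H1) (e : ι) : der u e =ᵐ[G.edgeMeasure e] deriv (rep u e) :=
  ((exists_absolutelyContinuous_rep u).choose_spec.choose_spec e).2.2.2.2

theorem rep_continuousOn (u : G.H1) (e : ι) : ContinuousOn (rep u e) (Icc 0 (G.len e)) := by
  simpa [uIcc_of_le (G.len_pos e).le] using (rep_ac u e).continuousOn

theorem rep_hasDerivAt (u : G.H1) (e : ι) :
    ∀ᵐ x ∂(G.edgeMeasure e), HasDerivAt (rep u e) (der u e x) x := by
  filter_upwards [der_ae_eq_deriv_rep u e, (rep_ac u e).ae_hasDerivAt_Ioo] with x h1 h2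
  rwa [h1]

theorem val_memLp (u : G.H1) (e : ι) : MemLp (val u e) 2 (G.edgeMeasure e) := Lp.memLp (u.1.fst e)

theorem der_memLp (u : G.H1) (e : ι) : MemLp (der u e) 2 (G.edgeMeasure e) := Lp.memLp (u.1.snd e)

omit [Fintype ι] in
theorem eqOn_Icc_of_ae_edge {e : ι} {f g : ℝ → ℝ} (hf : ContinuousOn f (Icc 0 (G.len e)))
    (hg : ContinuousOn g (Icc 0 (G.len e))) (h : f =ᵐ[G.edgeMeasure e] g) :
    EqOn f g (Icc 0 (G.len e)) := by
  refine Measure.eqOn_Icc_of_ae_eq (μ := volume) (G.len_pos e).ne ?_ hf hg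
  rwa [← Measure.restrict_congr_set Ioo_ae_eq_Icc]

omit [Fintype ι] in
theorem forall_Icc_of_ae_edge {e : ι} {f g : ℝ → ℝ} (hf : ContinuousOn f (Icc 0 (G.len e)))
    (hg : ContinuousOn g (Icc 0 (G.len e))) (h : ∀ᵐ x ∂(G.edgeMeasure e), f x ≤ g x) :
    ∀ x ∈ Icc 0 (G.len e), f x ≤ g x := by
  have : EqOn (fun x => max (f x) (g x)) g (Icc 0 (G.len e)) := by
    refine eqOn_Icc_of_ae_edge (hf.sup hg) hg ?_
    filter_upwards [h] with x hx using max_eq_right hx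
  intro x hx
  exact max_eq_right_iff.1 (this hx)

omit [Fintype ι] in
theorem ae_edge_of_forall {e : ι} {P : ℝ → Prop} (h : ∀ x ∈ Ioo 0 (G.len e), P x) :
    ∀ᵐ x ∂(G.edgeMeasure e), P x := by
  filter_upwards [ae_restrict_mem measurableSet_Ioo] with x hx using h x hx

variable (G) in
/-- An `H¹` function is given by absolutely continuous functions on the edges, with square
integrable derivatives, that match at the vertices. -/
theorem exists_of_rep (f : ι → ℝ → ℝ) (a : V → ℝ)
    (hf : ∀ e, AbsolutelyContinuousOnInterval (f e) 0 (G.len e))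
    (h0 : ∀ e, f e 0 = a (G.src e)) (hL : ∀ e, f e (G.len e) = a (G.tgt e))
    (hd : ∀ e, MemLp (deriv (f e)) 2 (G.edgeMeasure e)) :
    ∃ u : G.H1, ∀ e, val u e =ᵐ[G.edgeMeasure e] f e ∧
      der u e =ᵐ[G.edgeMeasure e] deriv (f e) ∧ EqOn (rep u e) (f e) (Icc 0 (G.len e)) := by
  have hc : ∀ e, ContinuousOn (f e) (Icc 0 (G.len e)) := fun e => by
    simpa [uIcc_of_le (G.len_pos e).le] using (hf e).continuousOn
  have hm : ∀ e, MemLp (f e) 2 (G.edgeMeasure e) := fun e => by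
    obtain ⟨C, hC⟩ := isCompact_Icc.exists_bound_of_continuousOn (hc e)
    refine MemLp.of_bound ?_ C ?_
    · exact ((hc e).mono Ioo_subset_Icc_self).aestronglyMeasurable measurableSet_Ioo
    · exact ae_edge_of_forall fun x hx => hC x (Ioo_subset_Icc_self hx)
  let w : WithLp 2 (G.L2 × G.L2) :=
    WithLp.toLp 2 (WithLp.toLp 2 fun e => (hm e).toLp, WithLp.toLp 2 fun e => (hd e).toLp)
  have e1 : ∀ e, (w.fst e : ℝ → ℝ) =ᵐ[G.edgeMeasure e] f e := fun e => (hm e).coeFn_toLp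
  have e2 : ∀ e, (w.snd e : ℝ → ℝ) =ᵐ[G.edgeMeasure e] deriv (f e) := fun e => (hd e).coeFn_toLp
  let u : G.H1 := ⟨w, f, a, fun e => ⟨hc e, h0 e, hL e, e1 e,
    isWeakDeriv_of_absolutelyContinuousOnInterval (G.len_pos e) (hf e) (e2 e)⟩⟩
  refine ⟨u, fun e => ⟨e1 e, e2 e, eqOn_Icc_of_ae_edge (rep_continuousOn u e) (hc e) ?_⟩⟩
  exact (val_ae_eq_rep u e).symm.trans (e1 e)

/-- An element of `H1` is a pair (u, u'), but its second component is redundant: the continuous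
representatives agree on the closed edges, so their derivatives agree inside. -/
theorem ext_of_val {u v : G.H1} (h : ∀ e, val u e =ᵐ[G.edgeMeasure e] val v e) : u = v := by
  have hr : ∀ e, EqOn (rep u e) (rep v e) (Icc 0 (G.len e)) := fun e =>
    eqOn_Icc_of_ae_edge (rep_continuousOn u e) (rep_continuousOn v e)
      (((val_ae_eq_rep u e).symm.trans (h e)).trans (val_ae_eq_rep v e))
  have h1 : u.1.fst = v.1.fst := PiLp.ext fun e => Lp.ext (h e)
  have h2 : u.1.snd = v.1.snd := PiLp.ext fun e => Lp.ext <| by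
    refine (der_ae_eq_deriv_rep u e).trans (Filter.EventuallyEq.trans ?_
      (der_ae_eq_deriv_rep v e).symm)
    refine ae_edge_of_forall fun x hx => Filter.EventuallyEq.deriv_eq ?_
    filter_upwards [Icc_mem_nhds hx.1 hx.2] with y hy using hr e hy
  exact Subtype.ext (WithLp.ofLp_injective 2 (Prod.ext h1 h2))

variable (G) in
/-- The embedding `u ↦ u` of `H¹` into `L²`. -/
def toL2 : G.H1 →L[ℝ] G.L2 := (WithLp.fstL 2 ℝ G.L2 G.L2).comp G.H1.subtypeL

variable (G) in
/-- The derivative `u ↦ u'` from `H¹` to `L²`. -/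
def derL2 : G.H1 →L[ℝ] G.L2 := (WithLp.sndL 2 ℝ G.L2 G.L2).comp G.H1.subtypeL

theorem toL2_apply (u : G.H1) (e : ι) : (G.toL2 u e : ℝ → ℝ) = val u e := rfl

theorem derL2_apply (u : G.H1) (e : ι) : (G.derL2 u e : ℝ → ℝ) = der u e := rfl

theorem L2_inner_eq (f g : G.L2) :
    inner ℝ f g = ∑ e, ∫ x in Ioo 0 (G.len e), (f e : ℝ → ℝ) x * (g e : ℝ → ℝ) x := by
  rw [PiLp.inner_apply]
  refine Finset.sum_congr rfl fun e _ => ?_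
  rw [L2.inner_def]
  refine integral_congr_ae (Filter.Eventually.of_forall fun x => ?_)
  simp [mul_comm]

theorem L2_norm_sq_eq (f : G.L2) :
    ‖f‖ ^ 2 = ∑ e, ∫ x in Ioo 0 (G.len e), |(f e : ℝ → ℝ) x| ^ 2 := by
  rw [← real_inner_self_eq_norm_sq, L2_inner_eq]
  simp [pow_two]

theorem pairing_eq (u φ : G.H1) : pairing u φ = inner ℝ (G.toL2 u) (G.toL2 φ) :=
  (L2_inner_eq _ _).symm

theorem mass_eq (u : G.H1) : mass u = ‖G.toL2 u‖ ^ 2 := (L2_norm_sq_eq _).symm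

theorem kinetic_eq (u : G.H1) : kinetic u = ‖G.derL2 u‖ ^ 2 := (L2_norm_sq_eq _).symm

theorem H1_inner_eq (u v : G.H1) :
    inner ℝ u v = inner ℝ (G.toL2 u) (G.toL2 v) + inner ℝ (G.derL2 u) (G.derL2 v) := by
  rw [Submodule.coe_inner, WithLp.prod_inner_apply]; rfl

theorem norm_sq_eq (u : G.H1) : ‖u‖ ^ 2 = mass u + kinetic u := by
  rw [← real_inner_self_eq_norm_sq, H1_inner_eq, mass_eq, kinetic_eq,
    real_inner_self_eq_norm_sq, real_inner_self_eq_norm_sq]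

theorem mass_nonneg (u : G.H1) : 0 ≤ mass u := by rw [mass_eq]; positivity

theorem kinetic_nonneg (u : G.H1) : 0 ≤ kinetic u := by rw [kinetic_eq]; positivity

theorem norm_toL2_le (u : G.H1) : ‖G.toL2 u‖ ≤ ‖u‖ := by
  refine le_of_sq_le_sq ?_ (norm_nonneg _)
  rw [norm_sq_eq, mass_eq]
  linarith [kinetic_nonneg u]

theorem mass_le_norm_sq (u : G.H1) : mass u ≤ ‖u‖ ^ 2 := by
  rw [norm_sq_eq]; linarith [kinetic_nonneg u]

theorem kinetic_le_norm_sq (u : G.H1) : kinetic u ≤ ‖u‖ ^ 2 := by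
  rw [norm_sq_eq]; linarith [mass_nonneg u]

theorem eq_zero_of_mass_eq_zero {u : G.H1} (h : mass u = 0) : u = 0 := by
  have h0 : G.toL2 u = 0 := by
    rw [mass_eq] at h
    simpa using h
  refine ext_of_val fun e => ?_
  have : G.toL2 u e = G.toL2 (0 : G.H1) e := by rw [h0, map_zero]
  rw [← toL2_apply, ← toL2_apply, this]

theorem val_add (u v : G.H1) (e : ι) :
    val (u + v) e =ᵐ[G.edgeMeasure e] fun x => val u e x + val v e x :=
  Lp.coeFn_add (u.1.fst e) (v.1.fst e)

theorem val_sub (u v : G.H1) (e : ι) :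
    val (u - v) e =ᵐ[G.edgeMeasure e] fun x => val u e x - val v e x :=
  Lp.coeFn_sub (u.1.fst e) (v.1.fst e)

theorem val_neg (u : G.H1) (e : ι) :
    val (-u) e =ᵐ[G.edgeMeasure e] fun x => -val u e x :=
  Lp.coeFn_neg (u.1.fst e)

theorem val_smul (c : ℝ) (u : G.H1) (e : ι) :
    val (c • u) e =ᵐ[G.edgeMeasure e] fun x => c * val u e x :=
  Lp.coeFn_smul c (u.1.fst e)

theorem rep_sub (u v : G.H1) (e : ι) :
    EqOn (rep (u - v) e) (fun x => rep u e x - rep v e x) (Icc 0 (G.len e)) := by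
  refine eqOn_Icc_of_ae_edge (rep_continuousOn _ e)
    ((rep_continuousOn u e).sub (rep_continuousOn v e)) ?_
  filter_upwards [val_ae_eq_rep (u - v) e, val_ae_eq_rep u e, val_ae_eq_rep v e, val_sub u v e]
    with x h1 h2 h3 h4
  rw [← h1, h4, h2, h3]

/-! ### Oscillation over a connected graph -/

theorem _root_.AbsolutelyContinuousOnInterval.abs_sub_le_integral_abs_deriv {f : ℝ → ℝ} {L : ℝ}
    (hL : 0 < L) (hf : AbsolutelyContinuousOnInterval f 0 L) {x y : ℝ} (hx : x ∈ Icc 0 L)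
    (hy : y ∈ Icc 0 L) : |f x - f y| ≤ ∫ t in Ioo 0 L, |deriv f t| := by
  wlog hxy : y ≤ x generalizing x y
  · rw [abs_sub_comm]
    exact this hy hx (not_le.1 hxy).le
  have hsub : uIcc y x ⊆ uIcc 0 L := by
    rw [uIcc_of_le hxy, uIcc_of_le hL.le]
    exact Icc_subset_Icc hy.1 hx.2
  rw [← (hf.mono hsub).integral_deriv_eq_sub]
  refine (intervalIntegral.abs_integral_le_integral_abs hxy).trans ?_
  rw [setIntegral_Ioo_eq_intervalIntegral hL.le]
  exact intervalIntegral.integral_mono_interval hy.1 hxy hx.2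
    (Filter.Eventually.of_forall fun _ => abs_nonneg _) hf.intervalIntegrable_deriv.abs

variable (G) in
/-- The oscillation over the graph of a function that is absolutely continuous on the edges and
continuous at the vertices is bounded by a multiple of its total variation. -/
theorem exists_oscillation_bound [Finite V] : ∃ C : ℝ, 0 ≤ C ∧ ∀ (F : ι → ℝ → ℝ) (A : V → ℝ),
    (∀ e, AbsolutelyContinuousOnInterval (F e) 0 (G.len e)) → (∀ e, F e 0 = A (G.src e)) →
    (∀ e, F e (G.len e) = A (G.tgt e)) → ∀ e, ∀ x ∈ Icc 0 (G.len e), ∀ e', ∀ x' ∈ Icc 0 (G.len e'),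
      |F e x - F e' x'| ≤ C * ∑ i, ∫ t in Ioo 0 (G.len i), |deriv (F i) t| := by
  let P : (ι → ℝ → ℝ) → (V → ℝ) → Prop := fun F A =>
    (∀ e, AbsolutelyContinuousOnInterval (F e) 0 (G.len e)) ∧ (∀ e, F e 0 = A (G.src e)) ∧
    (∀ e, F e (G.len e) = A (G.tgt e))
  let I : (ι → ℝ → ℝ) → ℝ := fun F => ∑ i, ∫ t in Ioo 0 (G.len i), |deriv (F i) t|
  have hI0 : ∀ F, 0 ≤ I F := fun F =>
    Finset.sum_nonneg fun i _ => integral_nonneg fun _ => abs_nonneg _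
  have hedge : ∀ F A, P F A → ∀ e, ∀ x ∈ Icc 0 (G.len e), ∀ y ∈ Icc 0 (G.len e),
      |F e x - F e y| ≤ I F := fun F A h e x hx y hy =>
    ((h.1 e).abs_sub_le_integral_abs_deriv (G.len_pos e) hx hy).trans
      (Finset.single_le_sum (f := fun i => ∫ t in Ioo 0 (G.len i), |deriv (F i) t|)
        (fun i _ => integral_nonneg fun _ => abs_nonneg _) (Finset.mem_univ e))
  -- Induction along a chain of edges from v to w. The constant counts the edges of the chain and is
  -- chosen before the function.
  have hv : ∀ v w, ∃ C : ℝ, 0 ≤ C ∧ ∀ F A, P F A → |A v - A w| ≤ C * I F := by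
    intro v w
    induction G.connected v w with
    | rel v w h =>
      obtain ⟨e, rfl, rfl⟩ := h
      refine ⟨1, zero_le_one, fun F A h => ?_⟩
      rw [← h.2.1, ← h.2.2, one_mul]
      exact hedge F A h e 0 (left_mem_Icc.2 (G.len_pos e).le) _ (right_mem_Icc.2 (G.len_pos e).le)
    | refl v => exact ⟨0, le_rfl, fun F A _ => by simp⟩
    | symm v w _ ih =>
      obtain ⟨C, hC, h⟩ := ih
      exact ⟨C, hC, fun F A hF => abs_sub_comm (A v) (A w) ▸ h F A hF⟩
    | trans v w z _ _ ih1 ih2 =>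
      obtain ⟨C, hC, h⟩ := ih1
      obtain ⟨C', hC', h'⟩ := ih2
      refine ⟨C + C', add_nonneg hC hC', fun F A hF => ?_⟩
      calc |A v - A z| ≤ |A v - A w| + |A w - A z| := abs_sub_le _ _ _
        _ ≤ C * I F + C' * I F := add_le_add (h F A hF) (h' F A hF)
        _ = (C + C') * I F := by ring
  choose C hC h using hv
  have := Fintype.ofFinite V
  -- The 2 pays for the way from each of the two points to an end of its edge; the sum bounds the
  -- constant of every pair of vertices.
  refine ⟨2 + ∑ v, ∑ w, C v w, ?_, fun F A h1 h2 h3 e x hx e' x' hx' => ?_⟩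
  · exact add_nonneg zero_le_two
      (Finset.sum_nonneg fun v _ => Finset.sum_nonneg fun w _ => hC v w)
  have hP : P F A := ⟨h1, h2, h3⟩
  have i1 := hedge F A hP e x hx 0 (left_mem_Icc.2 (G.len_pos e).le)
  have i2 := hedge F A hP e' 0 (left_mem_Icc.2 (G.len_pos e').le) x' hx'
  have i3 := h (G.src e) (G.src e') F A hP
  rw [h2] at i1 i2
  have i4 : C (G.src e) (G.src e') ≤ ∑ v, ∑ w, C v w :=
    (Finset.single_le_sum (f := fun w => C (G.src e) w) (fun w _ => hC _ w)
      (Finset.mem_univ _)).trans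
      (Finset.single_le_sum (f := fun v => ∑ w, C v w)
        (fun v _ => Finset.sum_nonneg fun w _ => hC v w) (Finset.mem_univ _))
  have i5 := mul_le_mul_of_nonneg_right i4 (hI0 F)
  calc |F e x - F e' x'| ≤ |F e x - A (G.src e)| + |A (G.src e) - A (G.src e')|
        + |A (G.src e') - F e' x'| := by
        have := abs_sub_le (F e x) (A (G.src e)) (F e' x')
        have := abs_sub_le (A (G.src e)) (A (G.src e')) (F e' x')
        linarith
    _ ≤ I F + C (G.src e) (G.src e') * I F + I F := add_le_add (add_le_add i1 i3) i2
    _ ≤ (2 + ∑ v, ∑ w, C v w) * I F := by linarith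

end MetricGraph

/-! ### Composition with Lipschitz and monotone functions -/

theorem abs_deriv_le_of_lipschitzOn_comp {f g : ℝ → ℝ} {K : NNReal} {s : Set ℝ} {x f' h' : ℝ}
    (hg : LipschitzOnWith K g s) (hs : ∀ᶠ y in nhds x, f y ∈ s) (hf : HasDerivAt f f' x)
    (hh : HasDerivAt (fun y => g (f y)) h' x) : |h'| ≤ K * |f'| := by
  have h1 := (hasDerivAt_iff_tendsto_slope.1 hf).abs.const_mul (K : ℝ)
  have h2 := (hasDerivAt_iff_tendsto_slope.1 hh).abs
  refine le_of_tendsto_of_tendsto h2 h1 ?_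
  filter_upwards [hs.filter_mono nhdsWithin_le_nhds] with y hy
  have := hg.dist_le_mul _ hy _ hs.self_of_nhds
  simp only [slope_def_field, abs_div, Real.dist_eq] at this ⊢
  rw [← mul_div_assoc]
  gcongr

/-- The difference quotients of f and g ∘ f have the same sign, and this passes to the limit without
differentiability of g. It gives ∫ w' (g(w))' ≥ 0 for the test functions g(w), including a
truncation. -/
theorem mul_nonneg_of_monotoneOn_comp {f g : ℝ → ℝ} {s : Set ℝ} {x f' h' : ℝ}
    (hg : MonotoneOn g s) (hs : ∀ᶠ y in nhds x, f y ∈ s) (hf : HasDerivAt f f' x)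
    (hh : HasDerivAt (fun y => g (f y)) h' x) : 0 ≤ f' * h' := by
  have h := (hasDerivAt_iff_tendsto_slope.1 hf).mul (hasDerivAt_iff_tendsto_slope.1 hh)
  refine ge_of_tendsto h ?_
  filter_upwards [hs.filter_mono nhdsWithin_le_nhds] with y hy
  simp only [slope_def_field, div_mul_div_comm]
  refine div_nonneg ?_ (mul_self_nonneg _)
  rcases le_total (f y) (f x) with h | h
  · exact mul_nonneg_of_nonpos_of_nonpos (sub_nonpos.2 h)
      (sub_nonpos.2 (hg hy hs.self_of_nhds h))
  · exact mul_nonneg (sub_nonneg.2 h) (sub_nonneg.2 (hg hs.self_of_nhds hy h))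

namespace MetricGraph

variable {V ι : Type*} [Fintype ι] {G : MetricGraph V ι}

theorem eventually_rep_mem {u : G.H1} {s : Set ℝ}
    (hs : ∀ e, ∀ x ∈ Icc 0 (G.len e), rep u e x ∈ s) (e : ι) :
    ∀ᵐ x ∂(G.edgeMeasure e), ∀ᶠ y in nhds x, rep u e y ∈ s :=
  ae_edge_of_forall fun x hx => by
    filter_upwards [Icc_mem_nhds hx.1 hx.2] with y hy using hs e y hy

/-- Composition of an `H¹` function with a function that is Lipschitz on its range. -/
theorem exists_lipschitzOn_comp (u : G.H1) {g : ℝ → ℝ} {K : NNReal} {s : Set ℝ}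
    (hg : LipschitzOnWith K g s) (hs : ∀ e, ∀ x ∈ Icc 0 (G.len e), rep u e x ∈ s) :
    ∃ w : G.H1, (∀ e, val w e =ᵐ[G.edgeMeasure e] fun x => g (val u e x)) ∧
      (∀ e, EqOn (rep w e) (fun x => g (rep u e x)) (Icc 0 (G.len e))) ∧
      (∀ e, ∀ᵐ x ∂(G.edgeMeasure e), HasDerivAt (fun x => g (rep u e x)) (der w e x) x) := by
  have hac : ∀ e, AbsolutelyContinuousOnInterval (fun x => g (rep u e x)) 0 (G.len e) := fun e =>
    (rep_ac u e).lipschitzOn_comp hg (by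
      rw [uIcc_of_le (G.len_pos e).le]; exact fun x hx => hs e x hx)
  obtain ⟨w, hw⟩ := G.exists_of_rep (fun e x => g (rep u e x)) (fun v => g (vertexVal u v)) hac
    (fun e => by rw [rep_zero]) (fun e => by rw [rep_len]) (fun e => by
      refine (der_memLp u e).of_le_mul (c := K) (measurable_deriv _).aestronglyMeasurable ?_
      filter_upwards [rep_hasDerivAt u e, (hac e).ae_hasDerivAt_Ioo, eventually_rep_mem hs e]
        with x h1 h2 h3
      exact abs_deriv_le_of_lipschitzOn_comp hg h3 h1 h2)
  refine ⟨w, fun e => ?_, fun e => (hw e).2.2, fun e => ?_⟩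
  · filter_upwards [(hw e).1, val_ae_eq_rep u e] with x h1 h2
    rw [h1, h2]
  · filter_upwards [(hw e).2.1, (hac e).ae_hasDerivAt_Ioo] with x h1 h2
    rwa [h1]

theorem rep_bounded (u : G.H1) : ∃ M, 0 < M ∧ ∀ e, ∀ x ∈ Icc 0 (G.len e), |rep u e x| ≤ M := by
  have : ∀ e, ∃ M, ∀ x ∈ Icc 0 (G.len e), |rep u e x| ≤ M := fun e =>
    isCompact_Icc.exists_bound_of_continuousOn (rep_continuousOn u e)
  choose M hM using this
  refine ⟨1 + ∑ e, |M e|, ?_, fun e x hx => (hM e x hx).trans ?_⟩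
  · have := Finset.sum_nonneg (s := Finset.univ) fun e _ => abs_nonneg (M e)
    linarith
  · have := Finset.single_le_sum (f := fun e => |M e|) (fun e _ => abs_nonneg _)
      (Finset.mem_univ e)
    linarith [le_abs_self (M e)]

/-! ### Sup bounds and the Gagliardo-Nirenberg inequality -/

variable (G) in
theorem totalLength_pos [Nonempty ι] : 0 < G.totalLength :=
  Finset.sum_pos (fun e _ => G.len_pos e) Finset.univ_nonempty

theorem totalLength_mul_le {F : ι → ℝ → ℝ} {c : ℝ} (hF : ∀ e, Integrable (F e) (G.edgeMeasure e))
    (h : ∀ e, ∀ᵐ x ∂(G.edgeMeasure e), c ≤ F e x) :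
    G.totalLength * c ≤ ∑ e, ∫ x in Ioo 0 (G.len e), F e x := by
  rw [totalLength, Finset.sum_mul]
  refine Finset.sum_le_sum fun e _ => ?_
  have := integral_mono_ae (integrable_const c) (hF e) (h e)
  rwa [integral_const, edgeMeasure_real_univ, smul_eq_mul] at this

theorem le_totalLength_mul {F : ι → ℝ → ℝ} {c : ℝ} (hF : ∀ e, Integrable (F e) (G.edgeMeasure e))
    (h : ∀ e, ∀ᵐ x ∂(G.edgeMeasure e), F e x ≤ c) :
    ∑ e, ∫ x in Ioo 0 (G.len e), F e x ≤ G.totalLength * c := by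
  rw [totalLength, Finset.sum_mul]
  refine Finset.sum_le_sum fun e _ => ?_
  have := integral_mono_ae (hF e) (integrable_const c) (h e)
  rwa [integral_const, edgeMeasure_real_univ, smul_eq_mul] at this

omit [Fintype ι] in
theorem integrable_of_bound {e : ι} {f : ℝ → ℝ} (hf : AEStronglyMeasurable f (G.edgeMeasure e))
    {C : ℝ} (h : ∀ᵐ x ∂(G.edgeMeasure e), |f x| ≤ C) : Integrable f (G.edgeMeasure e) :=
  Integrable.of_bound hf C h

omit [Fintype ι] in
theorem L2_integrable_mul (f g : G.L2) (e : ι) :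
    Integrable (fun x => (f e : ℝ → ℝ) x * (g e : ℝ → ℝ) x) (G.edgeMeasure e) :=
  MemLp.integrable_mul (Lp.memLp (f e)) (Lp.memLp (g e))

omit [Fintype ι] in
theorem L2_integrable_sq (f : G.L2) (e : ι) :
    Integrable (fun x => |(f e : ℝ → ℝ) x| ^ 2) (G.edgeMeasure e) := by
  simpa [pow_two] using L2_integrable_mul f f e

/-- The Cauchy-Schwarz inequality for the integral of the absolute value of a product. -/
theorem L2_sum_integral_abs_mul_le (f g : G.L2) :
    ∑ e, ∫ x in Ioo 0 (G.len e), |(f e : ℝ → ℝ) x * (g e : ℝ → ℝ) x| ≤ ‖f‖ * ‖g‖ := by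
  let a : G.L2 → G.L2 := fun f => WithLp.toLp 2 fun e => |f e|
  have ha : ∀ f e, (a f e : ℝ → ℝ) =ᵐ[G.edgeMeasure e] fun x => |(f e : ℝ → ℝ) x| := fun f e =>
    Lp.coeFn_abs (f e)
  have hn : ∀ f, ‖a f‖ = ‖f‖ := fun f => by
    rw [← sq_eq_sq₀ (norm_nonneg _) (norm_nonneg _), L2_norm_sq_eq, L2_norm_sq_eq]
    refine Finset.sum_congr rfl fun e _ => integral_congr_ae ?_
    filter_upwards [ha f e] with x hx
    rw [hx, abs_abs]
  rw [← hn f, ← hn g]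
  refine le_trans (le_of_eq ?_) (real_inner_le_norm (a f) (a g))
  rw [L2_inner_eq]
  refine Finset.sum_congr rfl fun e _ => integral_congr_ae ?_
  filter_upwards [ha f e, ha g e] with x h1 h2
  rw [h1, h2, abs_mul]

variable (G) in
/-- The pointwise bound behind the Gagliardo-Nirenberg inequality. -/
theorem exists_rep_sq_le [Finite V] [Nonempty ι] : ∃ C : ℝ, 0 ≤ C ∧ ∀ (u : G.H1) (e : ι),
    ∀ x ∈ Icc 0 (G.len e),
      rep u e x ^ 2 ≤ mass u / G.totalLength + C * (‖G.toL2 u‖ * ‖G.derL2 u‖) := by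
  obtain ⟨C, hC, h⟩ := G.exists_oscillation_bound
  refine ⟨2 * C, by positivity, fun u e x hx => ?_⟩
  have hac : ∀ e, AbsolutelyContinuousOnInterval (fun x => rep u e x * rep u e x) 0 (G.len e) :=
    fun e => (rep_ac u e).mul (rep_ac u e)
  -- The oscillation bound is applied to u², whose total variation ∫ 2|u u'| is at most 2 ‖u‖ ‖u'‖
  -- in L².
  have key := h (fun e x => rep u e x * rep u e x) (fun v => vertexVal u v * vertexVal u v) hac
    (fun e => by simp [rep_zero]) (fun e => by simp [rep_len]) e x hx
  have hI : ∑ i, ∫ t in Ioo 0 (G.len i), |deriv (fun x => rep u i x * rep u i x) t|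
      ≤ 2 * (‖G.toL2 u‖ * ‖G.derL2 u‖) := by
    refine le_trans (le_of_eq ?_) (mul_le_mul_of_nonneg_left
      (L2_sum_integral_abs_mul_le (G.toL2 u) (G.derL2 u)) zero_le_two)
    rw [Finset.mul_sum]
    refine Finset.sum_congr rfl fun i _ => ?_
    rw [← integral_const_mul]
    refine integral_congr_ae ?_
    filter_upwards [rep_hasDerivAt u i, val_ae_eq_rep u i] with t h1 h2
    rw [(h1.fun_mul h1).deriv, toL2_apply, derL2_apply, h2,
      show der u i t * rep u i t + rep u i t * der u i t = 2 * (rep u i t * der u i t) by ring,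
      abs_mul, abs_two]
  set I := ∑ i, ∫ t in Ioo 0 (G.len i), |deriv (fun x => rep u i x * rep u i x) t|
  -- The inequality u(x)² - C I ≤ u(x')² is averaged over x'.
  have h2 := totalLength_mul_le (G := G) (F := fun e x => |val u e x| ^ 2)
    (c := rep u e x ^ 2 - C * I) (fun e => L2_integrable_sq (G.toL2 u) e) (fun e' => by
      filter_upwards [val_ae_eq_rep u e', ae_restrict_mem measurableSet_Ioo] with x' h1 h2
      have := (le_abs_self _).trans (key e' x' (Ioo_subset_Icc_self h2))
      rw [h1, sq_abs]
      linarith [pow_two (rep u e x), pow_two (rep u e' x')])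
  change _ ≤ mass u at h2
  have hl := G.totalLength_pos
  have h3 : rep u e x ^ 2 - C * I ≤ mass u / G.totalLength := by
    rw [le_div_iff₀ hl]; linarith
  have h4 := mul_le_mul_of_nonneg_left hI hC
  linarith

variable (G) in
/-- The embedding of `H¹` into the bounded functions. -/
theorem exists_abs_rep_le [Finite V] [Nonempty ι] : ∃ C : ℝ, 0 < C ∧ ∀ (u : G.H1) (e : ι),
    ∀ x ∈ Icc 0 (G.len e), |rep u e x| ≤ C * ‖u‖ := by
  obtain ⟨C, hC, h⟩ := G.exists_rep_sq_le
  have hl := G.totalLength_pos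
  refine ⟨1 + (1 / G.totalLength + C), by positivity, fun u e x hx => ?_⟩
  refine abs_le_of_sq_le_sq ?_ (by positivity)
  have h1 : mass u / G.totalLength ≤ 1 / G.totalLength * ‖u‖ ^ 2 := by
    rw [div_mul_eq_mul_div, one_mul]
    gcongr
    exact mass_le_norm_sq u
  have h2 : ‖G.derL2 u‖ ≤ ‖u‖ := by
    refine le_of_sq_le_sq ?_ (norm_nonneg _)
    rw [← kinetic_eq]; exact kinetic_le_norm_sq u
  have h3 : ‖G.toL2 u‖ * ‖G.derL2 u‖ ≤ ‖u‖ ^ 2 := by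
    rw [pow_two]
    exact mul_le_mul (norm_toL2_le u) h2 (norm_nonneg _) (norm_nonneg _)
  have h4 := mul_le_mul_of_nonneg_left h3 hC
  calc rep u e x ^ 2 ≤ (1 / G.totalLength + C) * ‖u‖ ^ 2 := by linarith [h u e x hx]
    _ ≤ (1 + (1 / G.totalLength + C)) ^ 2 * ‖u‖ ^ 2 := by
        gcongr
        have : 0 ≤ 1 / G.totalLength + C := by positivity
        nlinarith
    _ = ((1 + (1 / G.totalLength + C)) * ‖u‖) ^ 2 := by ring

/-- A modulus of continuity for `H¹` functions on an edge. -/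
theorem abs_rep_sub_rep_le (u : G.H1) (e : ι) {x y δ : ℝ} (hx : x ∈ Icc 0 (G.len e))
    (hy : y ∈ Icc 0 (G.len e)) (hδ : 0 < δ) :
    |rep u e x - rep u e y| ≤ δ * ‖u‖ ^ 2 + |x - y| / δ := by
  wlog hxy : y ≤ x generalizing x y
  · rw [abs_sub_comm, abs_sub_comm x y]
    exact this hy hx (not_le.1 hxy).le
  have hsub : uIcc y x ⊆ uIcc 0 (G.len e) := by
    rw [uIcc_of_le hxy, uIcc_of_le (G.len_pos e).le]
    exact Icc_subset_Icc hy.1 hx.2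
  have hac := (rep_ac u e).mono hsub
  rw [← hac.integral_deriv_eq_sub]
  refine (intervalIntegral.abs_integral_le_integral_abs hxy).trans ?_
  have hdm : MemLp (deriv (rep u e)) 2 (G.edgeMeasure e) :=
    (der_memLp u e).ae_eq (der_ae_eq_deriv_rep u e)
  have hsq : Integrable (fun t => deriv (rep u e) t ^ 2) (G.edgeMeasure e) := hdm.integrable_sq
  have hsq' : IntervalIntegrable (fun t => deriv (rep u e) t ^ 2) volume 0 (G.len e) := by
    rw [intervalIntegrable_iff_integrableOn_Ioo_of_le (G.len_pos e).le]; exact hsq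
  have hsq'' := hsq'.mono_set hsub
  have e1 : ∫ t in (0 : ℝ)..(G.len e), deriv (rep u e) t ^ 2 ≤ ‖u‖ ^ 2 := by
    refine le_trans ?_ (kinetic_le_norm_sq u)
    rw [← setIntegral_Ioo_eq_intervalIntegral (G.len_pos e).le]
    refine le_trans (le_of_eq ?_) (Finset.single_le_sum
      (f := fun e => ∫ x in Ioo 0 (G.len e), |der u e x| ^ 2)
      (fun e _ => integral_nonneg fun _ => by positivity) (Finset.mem_univ e))
    refine integral_congr_ae ?_
    filter_upwards [der_ae_eq_deriv_rep u e] with t ht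
    rw [sq_abs, ht]
  calc ∫ t in y..x, |deriv (rep u e) t|
      ≤ ∫ t in y..x, (δ * deriv (rep u e) t ^ 2 + 1 / δ) := by
        refine intervalIntegral.integral_mono_on hxy hac.intervalIntegrable_deriv.abs
          ((hsq''.const_mul δ).add intervalIntegrable_const) fun t _ => ?_
        -- Young's inequality |d| ≤ δ d² + 1/(4δ), which replaces Cauchy-Schwarz.
        have : 0 ≤ (δ * |deriv (rep u e) t| - 1 / 2) ^ 2 / δ := by positivity
        have e2 : (δ * |deriv (rep u e) t| - 1 / 2) ^ 2 / δ
            = δ * deriv (rep u e) t ^ 2 - |deriv (rep u e) t| + 1 / (4 * δ) := by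
          rw [← sq_abs (deriv (rep u e) t)]
          field_simp
          ring
        have e3 : 1 / (4 * δ) ≤ 1 / δ := by
          apply one_div_le_one_div_of_le hδ; linarith
        linarith
    _ = δ * (∫ t in y..x, deriv (rep u e) t ^ 2) + |x - y| / δ := by
        rw [intervalIntegral.integral_add (hsq''.const_mul δ) intervalIntegrable_const,
          intervalIntegral.integral_const_mul, intervalIntegral.integral_const,
          abs_of_nonneg (sub_nonneg.2 hxy), smul_eq_mul, mul_one_div]
    _ ≤ δ * ‖u‖ ^ 2 + |x - y| / δ := by
        gcongr
        exact (intervalIntegral.integral_mono_interval hy.1 hxy hx.2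
          (Filter.Eventually.of_forall fun _ => sq_nonneg _) hsq').trans e1

theorem powInt_integrable {p : ℝ} (hp : 0 ≤ p) (u : G.H1) (e : ι) :
    Integrable (fun x => |val u e x| ^ p) (G.edgeMeasure e) := by
  obtain ⟨M, hM, h⟩ := rep_bounded u
  refine integrable_of_bound (C := M ^ p) ?_ ?_
  · exact ((val_memLp u e).1.aemeasurable.abs.pow_const p).aestronglyMeasurable
  · filter_upwards [val_ae_eq_rep u e, ae_restrict_mem measurableSet_Ioo] with x h1 h2
    rw [abs_of_nonneg (by positivity), h1]
    exact Real.rpow_le_rpow (abs_nonneg _) (h e x (Ioo_subset_Icc_self h2)) hp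

theorem powInt_le {p R : ℝ} (hp : 2 ≤ p) (u : G.H1)
    (h : ∀ e, ∀ x ∈ Icc 0 (G.len e), rep u e x ^ 2 ≤ R) :
    powInt p u ≤ R ^ ((p - 2) / 2) * mass u := by
  rw [powInt, mass, Finset.mul_sum]
  refine Finset.sum_le_sum fun e _ => ?_
  rw [← integral_const_mul]
  refine integral_mono_ae (powInt_integrable (by linarith) u e)
    ((L2_integrable_sq (G.toL2 u) e).const_mul _) ?_
  filter_upwards [val_ae_eq_rep u e, ae_restrict_mem measurableSet_Ioo] with x h1 h2
  have h3 := h e x (Ioo_subset_Icc_self h2)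
  rw [← h1, ← sq_abs] at h3
  have h0 := abs_nonneg (val u e x)
  have e1 : |val u e x| ^ p = (|val u e x| ^ 2) ^ ((p - 2) / 2) * |val u e x| ^ 2 := by
    rw [← Real.rpow_natCast, ← Real.rpow_mul h0, ← Real.rpow_add_of_nonneg h0]
    · congr 1; push_cast; ring
    · push_cast; linarith
    · positivity
  rw [e1]
  gcongr

/-- Convexity of t^q at the points a/s and b/(1-s) with weights s and 1-s. The weight s is fixed by
s^(1-q) = A. -/
theorem _root_.Real.exists_add_rpow_le {q A : ℝ} (hq : 1 < q) (hA : 1 < A) :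
    ∃ B : ℝ, 0 < B ∧ ∀ a b : ℝ, 0 ≤ a → 0 ≤ b → (a + b) ^ q ≤ A * a ^ q + B * b ^ q := by
  set s := A ^ (1 / (1 - q)) with hs
  have hs0 : 0 < s := by positivity
  have hs1 : s < 1 := Real.rpow_lt_one_of_one_lt_of_neg hA
    (by apply div_neg_of_pos_of_neg one_pos; linarith)
  refine ⟨(1 - s) ^ (1 - q), Real.rpow_pos_of_pos (by linarith) _, fun a b ha hb => ?_⟩
  have h1 : (0 : ℝ) < 1 - s := by linarith
  have := (convexOn_rpow hq.le).2 (x := a / s) (y := b / (1 - s)) (div_nonneg ha hs0.le)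
    (div_nonneg hb h1.le) hs0.le h1.le (by ring)
  simp only [smul_eq_mul] at this
  rw [mul_div_cancel₀ _ hs0.ne', mul_div_cancel₀ _ h1.ne', Real.div_rpow ha hs0.le,
    Real.div_rpow hb h1.le] at this
  have e1 : s * (a ^ q / s ^ q) = A * a ^ q := by
    have : s ^ (1 - q) = A := by
      rw [hs, ← Real.rpow_mul (by linarith), one_div_mul_cancel (by linarith), Real.rpow_one]
    rw [← this, Real.rpow_sub hs0, Real.rpow_one]; ring
  have e2 : (1 - s) * (b ^ q / (1 - s) ^ q) = (1 - s) ^ (1 - q) * b ^ q := by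
    rw [Real.rpow_sub h1, Real.rpow_one]; ring
  rwa [e1, e2] at this

variable (G) in
-- The pointwise bound of u² is a mean term plus a gradient term; ∫|u|^p ≤ (sup u²)^((p-2)/2) ∫u².
-- The prefactor p > 1 of the mean term in the claim leaves room to split the power of the sum with
-- `A = p`.
theorem exists_isGNConst [Finite V] [Nonempty ι] {p : ℝ} (hp : 6 < p) :
    ∃ K : ℝ, G.IsGNConst p K := by
  obtain ⟨C, hC, h⟩ := G.exists_rep_sq_le
  obtain ⟨B, hB, hAB⟩ := Real.exists_add_rpow_le (q := (p - 2) / 2) (A := p) (by linarith)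
    (by linarith)
  have hl := G.totalLength_pos
  -- The summand 1 keeps the constant positive when C = 0.
  refine ⟨B * C ^ ((p - 2) / 2) / p + 1, by positivity, fun u => ?_⟩
  have hm := mass_nonneg u
  have hk := kinetic_nonneg u
  have h1 := powInt_le (p := p) (by linarith) u (h u)
  have h2 := hAB (mass u / G.totalLength) (C * (‖G.toL2 u‖ * ‖G.derL2 u‖)) (by positivity)
    (by positivity)
  have e1 : (mass u / G.totalLength) ^ ((p - 2) / 2) * mass u
      = G.totalLength ^ ((2 - p) / 2) * mass u ^ (p / 2) := by
    rw [Real.div_rpow hm hl.le, show (2 - p) / 2 = -((p - 2) / 2) by ring,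
      Real.rpow_neg hl.le, show p / 2 = (p - 2) / 2 + 1 by ring,
      Real.rpow_add_of_nonneg hm (by linarith) zero_le_one, Real.rpow_one]
    ring
  have e2 : (C * (‖G.toL2 u‖ * ‖G.derL2 u‖)) ^ ((p - 2) / 2) * mass u
      = C ^ ((p - 2) / 2) * (mass u ^ ((p + 2) / 4) * kinetic u ^ ((p - 2) / 4)) := by
    rw [Real.mul_rpow hC (by positivity), Real.mul_rpow (norm_nonneg _) (norm_nonneg _),
      show (p + 2) / 4 = (p - 2) / 4 + 1 by ring,
      Real.rpow_add_of_nonneg hm (by linarith) zero_le_one, Real.rpow_one,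
      show (p - 2) / 2 = 2 * ((p - 2) / 4) by ring, Real.rpow_mul (norm_nonneg (G.toL2 u)),
      Real.rpow_mul (norm_nonneg (G.derL2 u)), Real.rpow_two, Real.rpow_two, ← mass_eq,
      ← kinetic_eq]
    ring
  have h3 := mul_le_mul_of_nonneg_right h2 hm
  have h4 : 0 ≤ p * (mass u ^ ((p + 2) / 4) * kinetic u ^ ((p - 2) / 4)) := by positivity
  calc powInt p u ≤ p * ((mass u / G.totalLength) ^ ((p - 2) / 2) * mass u)
        + B * ((C * (‖G.toL2 u‖ * ‖G.derL2 u‖)) ^ ((p - 2) / 2) * mass u) := by linarith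
    _ ≤ _ := by
        rw [e1, e2]
        have : p * (B * C ^ ((p - 2) / 2) / p + 1) = B * C ^ ((p - 2) / 2) + p := by
          field_simp
        rw [this]
        linarith

end MetricGraph

/-! ### Completeness of H¹ and compactness of the embedding into L² -/

namespace MetricGraph

variable {V ι : Type*} [Fintype ι] {G : MetricGraph V ι}

/-- The representative of `u` on a closed edge, as a bounded continuous function. -/
def repBCF (u : G.H1) (e : ι) : BoundedContinuousFunction (Icc 0 (G.len e)) ℝ :=
  BoundedContinuousFunction.mkOfCompact
    ⟨fun x => rep u e x, (rep_continuousOn u e).domRestrict⟩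

theorem exists_tendsto_toL2_apply {u : ℕ → G.H1} {e : ι}
    {f : BoundedContinuousFunction (Icc 0 (G.len e)) ℝ}
    (h : Filter.Tendsto (fun n => repBCF (u n) e) Filter.atTop (nhds f)) :
    ∃ z : Lp ℝ 2 (G.edgeMeasure e),
      (z : ℝ → ℝ) =ᵐ[G.edgeMeasure e] (fun x => f (projIcc 0 (G.len e) (G.len_pos e).le x)) ∧
      Filter.Tendsto (fun n => G.toL2 (u n) e) Filter.atTop (nhds z) := by
  have hc : Continuous (fun x => f (projIcc 0 (G.len e) (G.len_pos e).le x)) :=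
    f.continuous.comp continuous_projIcc
  have hm : MemLp (fun x => f (projIcc 0 (G.len e) (G.len_pos e).le x)) 2 (G.edgeMeasure e) :=
    MemLp.of_bound hc.aestronglyMeasurable ‖f‖ (Filter.Eventually.of_forall fun x => f.norm_coe_le_norm _)
  refine ⟨hm.toLp, hm.coeFn_toLp, ?_⟩
  rw [tendsto_iff_dist_tendsto_zero] at h ⊢
  refine squeeze_zero (fun _ => dist_nonneg) (fun n => ?_) (g := fun n =>
    measureUnivNNReal (G.edgeMeasure e) ^ (2 : ENNReal).toReal⁻¹ * dist (repBCF (u n) e) f)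
    (by simpa using h.const_mul _)
  rw [dist_eq_norm]
  refine Lp.norm_le_of_ae_bound dist_nonneg ?_
  filter_upwards [Lp.coeFn_sub (G.toL2 (u n) e) (hm.toLp), hm.coeFn_toLp, val_ae_eq_rep (u n) e,
    ae_restrict_mem measurableSet_Ioo] with x h1 h2 h3 h4
  have h5 := Ioo_subset_Icc_self h4
  rw [h1, Pi.sub_apply, h2, toL2_apply, h3, projIcc_of_mem _ h5]
  exact BoundedContinuousFunction.dist_coe_le_dist (f := repBCF (u n) e) (g := f) ⟨x, h5⟩

variable (G) in
theorem exists_dist_repBCF_le [Finite V] [Nonempty ι] : ∃ C : ℝ, 0 < C ∧ ∀ (u v : G.H1) (e : ι),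
    dist (repBCF u e) (repBCF v e) ≤ C * ‖u - v‖ := by
  obtain ⟨C, hC, h⟩ := G.exists_abs_rep_le
  refine ⟨C, hC, fun u v e => ?_⟩
  rw [BoundedContinuousFunction.dist_le (by positivity)]
  intro x
  have := h (u - v) e x x.2
  rwa [rep_sub u v e x.2] at this

omit [Fintype ι] in
theorem isWeakDeriv_of_tendsto {e : ι} {f g : ℕ → Lp ℝ 2 (G.edgeMeasure e)}
    {f₀ g₀ : Lp ℝ 2 (G.edgeMeasure e)} (hf : Filter.Tendsto f Filter.atTop (nhds f₀))
    (hg : Filter.Tendsto g Filter.atTop (nhds g₀)) (h : ∀ n, IsWeakDeriv (G.len e) (f n) (g n)) :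
    IsWeakDeriv (G.len e) f₀ g₀ := by
  intro φ h1 h2 h3
  have hm : ∀ ψ : ℝ → ℝ, Continuous ψ → MemLp ψ 2 (G.edgeMeasure e) := fun ψ hψ => by
    obtain ⟨C, hC⟩ := isCompact_Icc.exists_bound_of_continuousOn (s := Icc 0 (G.len e))
      hψ.continuousOn
    exact MemLp.of_bound hψ.aestronglyMeasurable C
      (ae_edge_of_forall fun x hx => hC x (Ioo_subset_Icc_self hx))
  have hi : ∀ (ψ : ℝ → ℝ) (hψ : Continuous ψ) (k : Lp ℝ 2 (G.edgeMeasure e)),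
      ∫ x in Ioo 0 (G.len e), k x * ψ x = inner ℝ ((hm ψ hψ).toLp) k := fun ψ hψ k => by
    rw [L2.inner_def]
    refine integral_congr_ae ?_
    filter_upwards [(hm ψ hψ).coeFn_toLp] with x hx
    rw [hx]; simp
  have h4 := h1.continuous_deriv (by simp)
  have e1 := (tendsto_const_nhds (x := (hm _ h4).toLp)).inner (𝕜 := ℝ) hf
  have e2 := ((tendsto_const_nhds (x := (hm _ h1.continuous).toLp)).inner (𝕜 := ℝ) hg).neg
  rw [hi _ h4, hi _ h1.continuous]
  refine tendsto_nhds_unique e1 (e2.congr fun n => ?_)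
  rw [← hi _ h4, ← hi _ h1.continuous]
  exact (h n φ h1 h2 h3).symm

variable (G) in
-- The sup bound turns convergence of the pairs into uniform convergence of the representatives, so
-- continuity at the vertices survives. Weak derivatives pass to the limit because a test function
-- acts continuously on L².
theorem isClosed_H1 [Finite V] [Nonempty ι] : IsClosed (G.H1 : Set (WithLp 2 (G.L2 × G.L2))) := by
  refine IsSeqClosed.isClosed fun w w₀ hw hlim => ?_
  obtain ⟨C, hC, hCu⟩ := G.exists_dist_repBCF_le
  let u : ℕ → G.H1 := fun n => ⟨w n, hw n⟩
  have hcau : CauchySeq u := by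
    have := hlim.cauchySeq
    rw [Metric.cauchySeq_iff] at this ⊢
    exact this
  have hcB : ∀ e, ∃ f, Filter.Tendsto (fun n => repBCF (u n) e) Filter.atTop (nhds f) := by
    intro e
    refine cauchySeq_tendsto_of_complete ?_
    rw [Metric.cauchySeq_iff] at hcau ⊢
    intro ε hε
    obtain ⟨N, hN⟩ := hcau (ε / C) (by positivity)
    refine ⟨N, fun m hm n hn => (hCu _ _ e).trans_lt ?_⟩
    have := hN m hm n hn
    rw [dist_eq_norm, lt_div_iff₀ hC] at this
    linarith
  choose f hf using hcB
  have hev : ∀ e (x : Icc 0 (G.len e)),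
      Filter.Tendsto (fun n => rep (u n) e x) Filter.atTop (nhds (f e x)) := fun e x =>
    (BoundedContinuousFunction.tendsto_iff_tendstoUniformly.1 (hf e)).tendsto_at x
  -- The limit exists at every end of an edge; a default value at any other vertex is never
  -- consulted.
  let a : V → ℝ := fun v => Filter.limUnder Filter.atTop fun n => vertexVal (u n) v
  refine ⟨fun e x => f e (projIcc 0 (G.len e) (G.len_pos e).le x), a, fun e => ?_⟩
  have hfst : Filter.Tendsto (fun n => G.toL2 (u n) e) Filter.atTop (nhds (w₀.fst e)) :=
    ((PiLp.continuous_apply 2 _ e).tendsto _).comp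
      (((WithLp.fstL 2 ℝ G.L2 G.L2).continuous.tendsto _).comp hlim)
  have hsnd : Filter.Tendsto (fun n => G.derL2 (u n) e) Filter.atTop (nhds (w₀.snd e)) :=
    ((PiLp.continuous_apply 2 _ e).tendsto _).comp
      (((WithLp.sndL 2 ℝ G.L2 G.L2).continuous.tendsto _).comp hlim)
  obtain ⟨z, hz, hz'⟩ := exists_tendsto_toL2_apply (hf e)
  have hzw : z = w₀.fst e := tendsto_nhds_unique hz' hfst
  subst hzw
  refine ⟨((f e).continuous.comp continuous_projIcc).continuousOn, ?_, ?_, hz, ?_⟩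
  · beta_reduce
    rw [projIcc_left]
    refine (Filter.Tendsto.limUnder_eq ?_).symm
    exact (hev e _).congr fun n => rep_zero (u n) e
  · beta_reduce
    rw [projIcc_right]
    refine (Filter.Tendsto.limUnder_eq ?_).symm
    exact (hev e _).congr fun n => rep_len (u n) e
  · have hwd : IsWeakDeriv (G.len e) (w₀.fst e) (w₀.snd e) := by
      refine isWeakDeriv_of_tendsto hfst hsnd fun n φ h1 h2 h3 => ?_
      obtain ⟨f', a', h'⟩ := (u n).2
      obtain ⟨-, -, -, h4, h5⟩ := h' e
      refine Eq.trans ?_ (h5 φ h1 h2 h3)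
      refine integral_congr_ae ?_
      filter_upwards [h4] with x hx
      exact congrArg (· * deriv φ x) hx
    intro φ h1 h2 h3
    rw [← hwd φ h1 h2 h3]
    refine integral_congr_ae ?_
    filter_upwards [hz] with x hx
    rw [hx]

instance [Finite V] [Nonempty ι] : CompleteSpace G.H1 := G.isClosed_H1.completeSpace_coe

/-- The embedding of `H¹` into `L²` is compact. -/
theorem exists_subseq_tendsto_toL2 [Finite V] [Nonempty ι] {u : ℕ → G.H1} {M : ℝ}
    (hM : ∀ n, ‖u n‖ ≤ M) : ∃ (z : G.L2) (φ : ℕ → ℕ), StrictMono φ ∧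
      Filter.Tendsto (fun n => G.toL2 (u (φ n))) Filter.atTop (nhds z) := by
  obtain ⟨C, hC, h⟩ := G.exists_abs_rep_le
  let A : ∀ e, Set (BoundedContinuousFunction (Icc 0 (G.len e)) ℝ) := fun e =>
    range fun n => repBCF (u n) e
  have hM0 : 0 ≤ M := (norm_nonneg _).trans (hM 0)
  have hA : ∀ e, IsCompact (closure (A e)) := fun e => by
    refine BoundedContinuousFunction.arzela_ascoli (Icc (-(C * M)) (C * M)) isCompact_Icc _ ?_ ?_
    · rintro _ x ⟨n, rfl⟩
      have := (h (u n) e x x.2).trans (mul_le_mul_of_nonneg_left (hM n) hC.le)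
      exact abs_le.1 this
    · intro x₀
      rw [Metric.equicontinuousAt_iff]
      intro ε hε
      -- This makes δ ‖u‖² ≤ ε/2 in the modulus of continuity, uniformly in the sequence; the
      -- distance of the points takes care of the other half.
      set δ := ε / (2 * (M ^ 2 + 1)) with hδ
      have hδ0 : 0 < δ := by positivity
      refine ⟨δ * (ε / 2), by positivity, fun x hx => ?_⟩
      rintro ⟨_, n, rfl⟩
      have h1 := abs_rep_sub_rep_le (u n) e x₀.2 x.2 hδ0
      rw [Subtype.dist_eq, Real.dist_eq] at hx
      rw [Real.dist_eq]
      change |rep (u n) e x₀ - rep (u n) e x| < ε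
      have h2 : |(x₀ : ℝ) - x| / δ < ε / 2 := by
        rw [div_lt_iff₀ hδ0, abs_sub_comm]; linarith
      have h3 : δ * ‖u n‖ ^ 2 ≤ ε / 2 := by
        calc δ * ‖u n‖ ^ 2 ≤ δ * (M ^ 2 + 1) := by
              have := pow_le_pow_left₀ (norm_nonneg _) (hM n) 2
              gcongr; linarith
          _ = ε / 2 := by rw [hδ]; field_simp
      linarith
  obtain ⟨f, -, φ, hφ, hf⟩ := (isCompact_univ_pi hA).tendsto_subseq
    (x := fun n e => repBCF (u n) e) (fun n e _ => subset_closure ⟨n, rfl⟩)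
  rw [tendsto_pi_nhds] at hf
  have := fun e => exists_tendsto_toL2_apply (u := fun n => u (φ n)) (hf e)
  choose z _ hz using this
  refine ⟨WithLp.toLp 2 z, φ, hφ, ?_⟩
  exact ((PiLp.continuous_toLp 2 _).tendsto z).comp
    ((tendsto_pi_nhds (f := fun n e => G.toL2 (u (φ n)) e)).2 hz)

end MetricGraph

/-! ### Pointwise estimates for the nonlinearity -/

/-- The odd power `t ↦ |t| ^ q * t`. -/
def signedPow (q t : ℝ) : ℝ := |t| ^ q * t

theorem signedPow_neg (q t : ℝ) : signedPow q (-t) = -signedPow q t := by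
  simp [signedPow]

theorem hasDerivAt_signedPow {q : ℝ} (hq : 0 < q) (t : ℝ) :
    HasDerivAt (signedPow q) ((q + 1) * |t| ^ q) t := by
  rcases eq_or_ne t 0 with rfl | ht
  · rw [hasDerivAt_iff_tendsto_slope]
    have h1 : Filter.Tendsto (fun t : ℝ => |t| ^ q) (nhds 0) (nhds ((q + 1) * |(0 : ℝ)| ^ q)) := by
      have : Continuous fun t : ℝ => |t| ^ q :=
        continuous_abs.rpow_const fun _ => Or.inr hq.le
      simpa [Real.zero_rpow hq.ne'] using this.tendsto 0
    refine (h1.mono_left nhdsWithin_le_nhds).congr' ?_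
    filter_upwards [self_mem_nhdsWithin] with s hs
    have hs' : s ≠ 0 := hs
    rw [slope_def_field, signedPow, signedPow]
    field_simp
    simp
  · have h1 : HasDerivAt (fun t : ℝ => |t| ^ q) (q * |t| ^ (q - 1) * SignType.sign t) t := by
      have := (hasDerivAt_abs ht).rpow_const (p := q) (Or.inl (abs_ne_zero.2 ht))
      convert this using 1
      ring
    refine (h1.mul (hasDerivAt_id t)).congr_deriv ?_
    have h3 : |t| ^ q = |t| ^ (q - 1) * |t| := by
      rw [← Real.rpow_add_one (abs_ne_zero.2 ht)]; congr 1; ring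
    have h4 : (SignType.sign t : ℝ) * t = |t| := by
      rw [mul_comm]; exact self_mul_sign t
    rw [h3]
    simp only [id]
    linear_combination (q * |t| ^ (q - 1)) * h4

theorem monotone_signedPow {q : ℝ} (hq : 0 < q) : Monotone (signedPow q) :=
  monotone_of_deriv_nonneg (fun t => (hasDerivAt_signedPow hq t).differentiableAt) fun t => by
    rw [(hasDerivAt_signedPow hq t).deriv]; positivity

theorem abs_signedPow_sub_le {q M a b : ℝ} (hq : 0 < q) (ha : |a| ≤ M) (hb : |b| ≤ M) :
    |signedPow q a - signedPow q b| ≤ (q + 1) * M ^ q * |a - b| := by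
  refine Convex.norm_image_sub_le_of_norm_hasDerivWithin_le (s := Icc (-M) M)
    (f' := fun t => (q + 1) * |t| ^ q)
    (fun t _ => (hasDerivAt_signedPow hq t).hasDerivWithinAt) (fun t ht => ?_) (convex_Icc _ _)
    (abs_le.1 hb) (abs_le.1 ha)
  have := abs_le.2 ht
  rw [Real.norm_of_nonneg (by positivity)]
  gcongr

theorem lipschitzOnWith_signedPow {q M : ℝ} (hq : 0 < q) (hM : 0 ≤ M) :
    LipschitzOnWith ⟨(q + 1) * M ^ q, by positivity⟩ (signedPow q) (Icc (-M) M) :=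
  LipschitzOnWith.of_dist_le_mul fun _ ha _ hb => abs_signedPow_sub_le hq (abs_le.2 ha) (abs_le.2 hb)

theorem abs_signedPow_le {q M t : ℝ} (hq : 0 ≤ q) (ht : |t| ≤ M) : |signedPow q t| ≤ M ^ q * M := by
  rw [signedPow, abs_mul, abs_of_nonneg (by positivity : 0 ≤ |t| ^ q)]
  have := (abs_nonneg t).trans ht
  gcongr

theorem measurable_signedPow (q : ℝ) : Measurable (signedPow q) :=
  (measurable_norm.pow_const q).mul measurable_id

/-- A second order Taylor estimate for `t ↦ |t| ^ p`. -/
theorem abs_rpow_taylor_le {p M a b : ℝ} (hp : 2 < p) (ha : |a| ≤ M) (hb : |b| ≤ M) :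
    |(|b| ^ p - |a| ^ p - p * signedPow (p - 2) a * (b - a))|
      ≤ p * ((p - 1) * M ^ (p - 2)) * (b - a) ^ 2 := by
  have hd : ∀ t, HasDerivAt (fun t => |t| ^ p - p * signedPow (p - 2) a * (t - a))
      (p * signedPow (p - 2) t - p * signedPow (p - 2) a) t := fun t => by
    have h1 := hasDerivAt_abs_rpow t (p := p) (by linarith)
    have h2 := ((hasDerivAt_id t).sub_const a).const_mul (p * signedPow (p - 2) a)
    refine (h1.sub h2).congr_deriv ?_
    rw [signedPow, signedPow]; ring
  have hM : 0 ≤ M := (abs_nonneg a).trans ha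
  have hsub : uIcc a b ⊆ Icc (-M) M := uIcc_subset_Icc (abs_le.1 ha) (abs_le.1 hb)
  have := Convex.norm_image_sub_le_of_norm_hasDerivWithin_le (s := uIcc a b)
    (f := fun t => |t| ^ p - p * signedPow (p - 2) a * (t - a))
    (C := p * ((p - 1) * M ^ (p - 2)) * |b - a|) (x := a) (y := b)
    (fun t _ => (hd t).hasDerivWithinAt) (fun t ht => ?_) (convex_uIcc a b) left_mem_uIcc
    right_mem_uIcc
  · rw [Real.norm_eq_abs, Real.norm_eq_abs] at this
    rw [← sq_abs (b - a)]
    calc _ = _ := by congr 1; ring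
      _ ≤ _ := this
      _ = _ := by ring
  · have h1 := abs_signedPow_sub_le (q := p - 2) (by linarith) (abs_le.2 (hsub ht)) ha
    have h2 : |t - a| ≤ |b - a| := abs_sub_left_of_mem_uIcc ht
    rw [← mul_sub, Real.norm_eq_abs, abs_mul, abs_of_pos (by linarith : 0 < p), mul_assoc]
    refine mul_le_mul_of_nonneg_left (h1.trans ?_) (by linarith)
    rw [show p - 2 + 1 = p - 1 by ring]
    have : 0 ≤ p - 1 := by linarith
    gcongr

/-! ### The resolvent: positivity and the Harnack inequality -/

namespace MetricGraph

variable {V ι : Type*} [Fintype ι] {G : MetricGraph V ι}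

variable (G) in
theorem exists_one : ∃ o : G.H1, (∀ e, val o e =ᵐ[G.edgeMeasure e] fun _ => 1) ∧ G.derL2 o = 0 := by
  obtain ⟨o, ho⟩ := G.exists_of_rep (fun _ _ => 1) (fun _ => 1)
    (fun e => (LipschitzWith.const (1 : ℝ)).lipschitzOnWith.absolutelyContinuousOnInterval)
    (fun _ => rfl) (fun _ => rfl) (fun e => by simp)
  refine ⟨o, fun e => (ho e).1, PiLp.ext fun e => Lp.ext ?_⟩
  refine (ho e).2.1.trans ?_
  refine Filter.EventuallyEq.trans ?_ (Lp.coeFn_zero ℝ 2 (G.edgeMeasure e)).symm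
  exact Filter.Eventually.of_forall fun x => by simp

variable (G) in
/-- The constant function `1`. -/
def one : G.H1 := G.exists_one.choose

theorem val_one (e : ι) : val G.one e =ᵐ[G.edgeMeasure e] fun _ => 1 := G.exists_one.choose_spec.1 e

theorem derL2_one : G.derL2 G.one = 0 := G.exists_one.choose_spec.2

theorem inner_toL2_one (f : G.L2) :
    inner ℝ f (G.toL2 G.one) = ∑ e, ∫ x in Ioo 0 (G.len e), (f e : ℝ → ℝ) x := by
  rw [L2_inner_eq]
  refine Finset.sum_congr rfl fun e _ => integral_congr_ae ?_
  filter_upwards [val_one (G := G) e] with x hx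
  rw [toL2_apply, hx, mul_one]

theorem L2_inner_nonneg {f g : G.L2}
    (h : ∀ e, ∀ᵐ x ∂(G.edgeMeasure e), 0 ≤ (f e : ℝ → ℝ) x * (g e : ℝ → ℝ) x) :
    0 ≤ inner ℝ f g := by
  rw [L2_inner_eq]
  exact Finset.sum_nonneg fun e _ => integral_nonneg_of_ae (h e)

theorem rep_nonneg_of_mem_posCone {u : G.H1} (hu : u ∈ G.posCone) (e : ι) :
    ∀ x ∈ Icc 0 (G.len e), 0 ≤ rep u e x := by
  refine forall_Icc_of_ae_edge continuousOn_const (rep_continuousOn u e) ?_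
  filter_upwards [hu e, val_ae_eq_rep u e] with x h1 h2
  rwa [← h2]

variable [Finite V] [Nonempty ι]

variable (G) in
/-- The operator `(1 - Δ)⁻¹` with the Kirchhoff conditions, from `L²` to `H¹`. -/
def resolvent : G.L2 →L[ℝ] G.H1 := ContinuousLinearMap.adjoint (𝕜 := ℝ) (E := G.H1) (F := G.L2) G.toL2

theorem inner_resolvent (f : G.L2) (φ : G.H1) :
    inner ℝ (G.resolvent f) φ = inner ℝ f (G.toL2 φ) := by
  unfold resolvent
  erw [ContinuousLinearMap.adjoint_inner_left]

theorem resolvent_one : G.resolvent (G.toL2 G.one) = G.one := by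
  refine ext_inner_right ℝ fun φ => ?_
  rw [inner_resolvent, H1_inner_eq, derL2_one, inner_zero_left, add_zero]

/-- The resolvent is positive. -/
theorem resolvent_mem_posCone {f : G.L2} (hf : ∀ e, ∀ᵐ x ∂(G.edgeMeasure e), 0 ≤ (f e : ℝ → ℝ) x) :
    G.resolvent f ∈ G.posCone := by
  set w := G.resolvent f with hw
  -- The equation for w is tested with φ = min(w, 0): ‖φ‖² + ∫ w'φ' = ∫ f φ ≤ 0 with ∫ w'φ' ≥ 0, so
  -- φ = 0.
  have hlip : LipschitzOnWith 1 (fun t : ℝ => min t 0) univ :=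
    (LipschitzWith.id.min_const 0).lipschitzOnWith
  obtain ⟨φ, h1, -, h3⟩ := exists_lipschitzOn_comp w hlip (fun _ _ _ => mem_univ _)
  have hmono : MonotoneOn (fun t : ℝ => min t 0) univ := fun a _ b _ h => min_le_min_right 0 h
  have key := inner_resolvent f φ
  rw [← hw, H1_inner_eq] at key
  have e1 : inner ℝ (G.toL2 w) (G.toL2 φ) = ‖G.toL2 φ‖ ^ 2 := by
    rw [← real_inner_self_eq_norm_sq, L2_inner_eq, L2_inner_eq]
    refine Finset.sum_congr rfl fun e _ => integral_congr_ae ?_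
    filter_upwards [h1 e] with x hx
    rw [toL2_apply, toL2_apply, hx]
    rcases le_total (val w e x) 0 with h | h
    · rw [min_eq_left h]
    · rw [min_eq_right h]; ring
  have e2 : 0 ≤ inner ℝ (G.derL2 w) (G.derL2 φ) := L2_inner_nonneg fun e => by
    filter_upwards [h3 e, rep_hasDerivAt w e] with x hx1 hx2
    exact mul_nonneg_of_monotoneOn_comp hmono (Filter.Eventually.of_forall fun _ => mem_univ _)
      hx2 hx1
  have e3 : 0 ≤ inner ℝ f (-G.toL2 φ) := by
    rw [← map_neg]
    refine L2_inner_nonneg fun e => ?_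
    filter_upwards [h1 e, hf e, val_neg φ e] with x hx1 hx2 hx3
    rw [toL2_apply, hx3, hx1]
    exact mul_nonneg hx2 (neg_nonneg.2 (min_le_right _ _))
  rw [inner_neg_right] at e3
  have e4 : mass φ = 0 := by
    rw [mass_eq]
    have := sq_nonneg ‖G.toL2 φ‖
    linarith
  have e5 := eq_zero_of_mass_eq_zero e4
  intro e
  have e6 : val φ e =ᵐ[G.edgeMeasure e] fun _ => 0 := by
    rw [e5]; exact Lp.coeFn_zero ℝ 2 (G.edgeMeasure e)
  filter_upwards [h1 e, e6] with x hx1 hx2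
  rw [hx2] at hx1
  exact min_eq_right_iff.1 hx1.symm

omit [Fintype ι] [Finite V] [Nonempty ι] in
theorem _root_.lipschitzOnWith_inv_add_Ici {ε : ℝ} (hε : 0 < ε) :
    LipschitzOnWith (Real.toNNReal (ε ^ 2)⁻¹) (fun t : ℝ => (t + ε)⁻¹) (Ici 0) := by
  refine LipschitzOnWith.of_dist_le' fun a ha b hb => ?_
  rw [mem_Ici] at ha hb
  have ha' : 0 < a + ε := by linarith
  have hb' : 0 < b + ε := by linarith
  rw [Real.dist_eq, Real.dist_eq, inv_sub_inv ha'.ne' hb'.ne', abs_div,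
    abs_of_pos (mul_pos ha' hb'), div_eq_inv_mul,
    show b + ε - (a + ε) = -(a - b) by ring, abs_neg]
  gcongr
  nlinarith

omit [Fintype ι] [Finite V] [Nonempty ι] in
theorem _root_.lipschitzOnWith_log_add_Ici {ε : ℝ} (hε : 0 < ε) :
    LipschitzOnWith (Real.toNNReal ε⁻¹) (fun t : ℝ => Real.log (t + ε)) (Ici 0) := by
  refine LipschitzOnWith.of_dist_le' fun a ha b hb => ?_
  refine Convex.norm_image_sub_le_of_norm_hasDerivWithin_le (s := Ici (0 : ℝ))
    (f := fun t => Real.log (t + ε)) (f' := fun t => 1 / (t + ε)) (fun t ht => ?_)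
    (fun t ht => ?_) (convex_Ici _) hb ha
  · rw [mem_Ici] at ht
    exact (((hasDerivAt_id t).add_const ε).log (by simp; linarith)).hasDerivWithinAt
  · rw [mem_Ici] at ht
    rw [Real.norm_of_nonneg (by positivity), one_div]
    gcongr
    linarith

/-- The derivative of the logarithm of a positive supersolution is bounded in `L¹`. -/
theorem sum_integral_abs_deriv_log_le {f : G.L2}
    (hf : ∀ e, ∀ᵐ x ∂(G.edgeMeasure e), 0 ≤ (f e : ℝ → ℝ) x) {ε : ℝ} (hε : 0 < ε) :
    ∑ i, ∫ t in Ioo 0 (G.len i), |deriv (fun x => Real.log (rep (G.resolvent f) i x + ε)) t|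
      ≤ G.totalLength := by
  have hw0 : ∀ e, ∀ x ∈ Icc 0 (G.len e), 0 ≤ rep (G.resolvent f) e x :=
    fun e => rep_nonneg_of_mem_posCone (resolvent_mem_posCone hf) e
  have hwf := inner_resolvent f
  generalize G.resolvent f = w at hw0 hwf ⊢
  -- Testing with 1/(w + ε) gives ∫ |(log(w + ε))'|² = ∫ w/(w + ε) - ∫ f/(w + ε) ≤ ℓ, uniformly in
  -- ε.
  obtain ⟨φ, h1, -, h3⟩ := exists_lipschitzOn_comp w (lipschitzOnWith_inv_add_Ici hε) hw0
  obtain ⟨F, hF⟩ : ∃ F : ι → ℝ → ℝ, ∀ i,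
    deriv (fun x => Real.log (rep w i x + ε)) = F i := ⟨_, fun i => rfl⟩
  simp only [hF]
  have hder : ∀ i, ∀ᵐ t ∂(G.edgeMeasure i),
      -(der w i t * der φ i t) = |F i t| ^ 2 := by
    intro i
    filter_upwards [h3 i, rep_hasDerivAt w i, ae_restrict_mem measurableSet_Ioo]
      with t ht1 ht2 ht3
    have hpos : 0 < rep w i t + ε := by linarith [hw0 i t (Ioo_subset_Icc_self ht3)]
    rw [ht1.unique ((ht2.add_const ε).inv hpos.ne'), ← hF,
      ((ht2.add_const ε).log hpos.ne').deriv, sq_abs]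
    generalize rep w i t + ε = r
    ring
  have hinner : inner ℝ (G.derL2 w) (G.derL2 φ) = -∑ i, ∫ t in Ioo 0 (G.len i), |F i t| ^ 2 := by
    rw [L2_inner_eq, ← Finset.sum_neg_distrib]
    refine Finset.sum_congr rfl fun i _ => ?_
    rw [← integral_neg]
    refine integral_congr_ae ?_
    filter_upwards [hder i] with t ht
    rw [derL2_apply, derL2_apply, ← ht, neg_neg]
  have hint : ∀ i, Integrable (fun t => |F i t| ^ 2) (G.edgeMeasure i) := fun i =>
    (L2_integrable_mul (G.derL2 w) (G.derL2 φ) i).neg.congr (hder i)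
  have hval : inner ℝ (G.toL2 w) (G.toL2 φ) ≤ G.totalLength * 1 := by
    rw [L2_inner_eq]
    refine le_totalLength_mul (fun i => L2_integrable_mul _ _ i) fun i => ?_
    filter_upwards [h1 i, val_ae_eq_rep w i, ae_restrict_mem measurableSet_Ioo]
      with t ht1 ht2 ht3
    have := hw0 i t (Ioo_subset_Icc_self ht3)
    rw [toL2_apply, toL2_apply, ht1, ht2, ← div_eq_mul_inv]
    exact div_le_one_of_le₀ (by linarith) (by linarith)
  have hf0 : 0 ≤ inner ℝ f (G.toL2 φ) := L2_inner_nonneg fun i => by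
    filter_upwards [hf i, h1 i, val_ae_eq_rep w i, ae_restrict_mem measurableSet_Ioo]
      with t ht0 ht1 ht2 ht3
    have := hw0 i t (Ioo_subset_Icc_self ht3)
    rw [toL2_apply, ht1, ht2]
    positivity
  rw [← hwf, H1_inner_eq, hinner] at hf0
  -- From |F| ≤ (F² + 1)/2: half of the L² bound ℓ plus half of the length gives again ℓ.
  have h4 : ∀ i, ∫ t in Ioo 0 (G.len i), |F i t|
      ≤ 1 / 2 * (∫ t in Ioo 0 (G.len i), |F i t| ^ 2) + 1 / 2 * G.len i := by
    intro i
    have h5 := integral_add ((hint i).const_mul (1 / 2))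
      (integrable_const (μ := G.edgeMeasure i) (1 / 2 : ℝ))
    rw [integral_const_mul, integral_const, edgeMeasure_real_univ, smul_eq_mul,
      mul_comm (G.len i)] at h5
    refine le_trans ?_ h5.le
    refine integral_mono_of_nonneg (Filter.Eventually.of_forall fun _ => abs_nonneg _)
      (((hint i).const_mul _).add (integrable_const _)) (Filter.Eventually.of_forall fun t => ?_)
    have := sq_nonneg (|F i t| - 1)
    simp only
    linarith
  refine (Finset.sum_le_sum fun i _ => h4 i).trans ?_
  rw [Finset.sum_add_distrib, ← Finset.mul_sum, ← Finset.mul_sum]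
  change _ + 1 / 2 * G.totalLength ≤ _
  linarith

variable (G) in
/-- The Harnack inequality for the resolvent. -/
theorem exists_harnack : ∃ A : ℝ, 0 < A ∧ ∀ f : G.L2,
    (∀ e, ∀ᵐ x ∂(G.edgeMeasure e), 0 ≤ (f e : ℝ → ℝ) x) → ∀ e, ∀ x ∈ Icc 0 (G.len e), ∀ e',
      ∀ x' ∈ Icc 0 (G.len e'), rep (G.resolvent f) e x ≤ A * rep (G.resolvent f) e' x' := by
  obtain ⟨C, hC, hosc⟩ := G.exists_oscillation_bound
  refine ⟨Real.exp (C * G.totalLength), Real.exp_pos _, fun f hf e x hx e' x' hx' => ?_⟩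
  have hw0 : ∀ e, ∀ x ∈ Icc 0 (G.len e), 0 ≤ rep (G.resolvent f) e x :=
    fun e => rep_nonneg_of_mem_posCone (resolvent_mem_posCone hf) e
  have hL1 := fun ε (hε : 0 < ε) => sum_integral_abs_deriv_log_le hf hε
  generalize G.resolvent f = w at hw0 hL1 ⊢
  -- The oscillation of log(w + ε) is at most C ℓ. The shift ε keeps the logarithm Lipschitz where w
  -- could vanish, and it is sent to zero afterwards.
  have key : ∀ ε : ℝ, 0 < ε →
      rep w e x + ε ≤ Real.exp (C * G.totalLength) * (rep w e' x' + ε) := by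
    intro ε hε
    have hac : ∀ i, AbsolutelyContinuousOnInterval (fun x => Real.log (rep w i x + ε)) 0 (G.len i) :=
      fun i => AbsolutelyContinuousOnInterval.lipschitzOn_comp (f := rep w i)
        (g := fun t => Real.log (t + ε)) (lipschitzOnWith_log_add_Ici hε) (rep_ac w i) (by
        rw [uIcc_of_le (G.len_pos i).le]; exact fun t ht => hw0 i t ht)
    have h6 := (le_abs_self _).trans (hosc (fun i x => Real.log (rep w i x + ε))
      (fun v => Real.log (vertexVal w v + ε)) hac (fun i => by rw [rep_zero])
      (fun i => by rw [rep_len]) e x hx e' x' hx')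
    have h7 := mul_le_mul_of_nonneg_left (hL1 ε hε) hC
    have p1 : 0 < rep w e x + ε := by linarith [hw0 e x hx]
    have p2 : 0 < rep w e' x' + ε := by linarith [hw0 e' x' hx']
    rw [← Real.log_le_log_iff p1 (by positivity), Real.log_mul (Real.exp_pos _).ne' p2.ne',
      Real.log_exp]
    linarith
  refine le_of_forall_pos_le_add fun δ hδ => ?_
  set A := Real.exp (C * G.totalLength)
  have hA : 0 < A := Real.exp_pos _
  have := key (δ / A) (by positivity)
  rw [mul_add, mul_div_cancel₀ _ hA.ne'] at this
  have : 0 < δ / A := by positivity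
  linarith

variable (G) in
/-- The resolvent maps functions with large mean and small negative part to the positive cone. -/
theorem exists_resolvent_mem_posCone_of_integral_ge : ∃ κ : ℝ, 0 < κ ∧ ∀ (f : G.L2) (τ : ℝ), 0 ≤ τ →
    (∀ e, ∀ᵐ x ∂(G.edgeMeasure e), -τ ≤ (f e : ℝ → ℝ) x) →
    κ * τ ≤ ∑ e, ∫ x in Ioo 0 (G.len e), (f e : ℝ → ℝ) x → G.resolvent f ∈ G.posCone := by
  obtain ⟨A, hA, h⟩ := G.exists_harnack
  have hl := G.totalLength_pos
  refine ⟨A * G.totalLength, by positivity, fun f τ hτ hf hint => ?_⟩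
  -- The shifted function is nonnegative, so Harnack applies to w = R f'; since R1 = 1, it remains
  -- to show w ≥ τ.
  set f' : G.L2 := f + τ • G.toL2 G.one with hf'
  have hf'0 : ∀ e, (f' e : ℝ → ℝ) =ᵐ[G.edgeMeasure e] fun x => (f e : ℝ → ℝ) x + τ := fun e => by
    filter_upwards [Lp.coeFn_add (f e) (τ • G.toL2 G.one e), Lp.coeFn_smul τ (G.toL2 G.one e),
      val_one (G := G) e] with x h1 h2 h3
    refine h1.trans ?_
    rw [Pi.add_apply, h2, Pi.smul_apply, toL2_apply, h3, smul_eq_mul, mul_one]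
  have hf'n : ∀ e, ∀ᵐ x ∂(G.edgeMeasure e), 0 ≤ (f' e : ℝ → ℝ) x := fun e => by
    filter_upwards [hf'0 e, hf e] with x h1 h2
    rw [h1]; linarith
  have hres : G.resolvent f = G.resolvent f' - τ • G.one := by
    rw [hf', map_add, map_smul, resolvent_one, add_sub_cancel_right]
  set w := G.resolvent f' with hw
  -- Testing with the constant 1 shows that R preserves the integral.
  have hmean : ∑ e, ∫ x in Ioo 0 (G.len e), val w e x
      = (∑ e, ∫ x in Ioo 0 (G.len e), (f e : ℝ → ℝ) x) + G.totalLength * τ := by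
    have h1 : inner ℝ (G.toL2 w) (G.toL2 G.one) = inner ℝ f' (G.toL2 G.one) := by
      rw [← inner_resolvent f', H1_inner_eq, derL2_one, inner_zero_right, add_zero]
    rw [inner_toL2_one, hf', inner_add_left, inner_toL2_one, real_inner_smul_left,
      inner_toL2_one] at h1
    have h2 : ∑ e, ∫ x in Ioo 0 (G.len e), (G.toL2 G.one e : ℝ → ℝ) x = G.totalLength := by
      refine Finset.sum_congr rfl fun e _ => ?_
      have : ∫ x in Ioo 0 (G.len e), (G.toL2 G.one e : ℝ → ℝ) x
          = ∫ x in Ioo 0 (G.len e), (1 : ℝ) := integral_congr_ae (val_one e)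
      rw [this]
      simp [(G.len_pos e).le]
    rw [h2] at h1
    rw [mul_comm G.totalLength]
    exact h1
  have hlow : ∀ e', ∀ x' ∈ Icc 0 (G.len e'), τ ≤ rep w e' x' := by
    intro e' x' hx'
    have h1 : ∑ e, ∫ x in Ioo 0 (G.len e), val w e x
        ≤ G.totalLength * (A * rep w e' x') := by
      refine le_totalLength_mul (fun e => (val_memLp w e).integrable (by norm_num)) fun e => ?_
      filter_upwards [val_ae_eq_rep w e, ae_restrict_mem measurableSet_Ioo] with x hx1 hx2
      rw [hx1]
      exact h f' hf'n e x (Ioo_subset_Icc_self hx2) e' x' hx'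
    rw [hmean] at h1
    have h2 : (A * G.totalLength) * τ ≤ (A * G.totalLength) * rep w e' x' := by
      have : 0 ≤ G.totalLength * τ := by positivity
      linarith
    exact le_of_mul_le_mul_left h2 (by positivity)
  rw [hres]
  intro e
  filter_upwards [val_sub w (τ • G.one) e, val_smul τ G.one e, val_one (G := G) e,
    val_ae_eq_rep w e, ae_restrict_mem measurableSet_Ioo] with x h1 h2 h3 h4 h5
  rw [h1, h2, h3, h4]
  linarith [hlow e x (Ioo_subset_Icc_self h5)]

end MetricGraph

/-! ### Differentiability from Taylor bounds; calculus of locally Lipschitz maps -/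

theorem hasFDerivAt_of_norm_sub_le_sq {E : Type*} [NormedAddCommGroup E] [NormedSpace ℝ E]
    {f : E → ℝ} {L : E →L[ℝ] ℝ} {u : E} {C r : ℝ} (hr : 0 < r)
    (h : ∀ v, ‖v - u‖ ≤ r → |f v - f u - L (v - u)| ≤ C * ‖v - u‖ ^ 2) : HasFDerivAt f L u := by
  refine HasFDerivAt.of_isLittleO ?_
  have h1 : (fun v => f v - f u - L (v - u)) =O[nhds u] fun v => ‖v - u‖ ^ 2 := by
    refine Asymptotics.IsBigO.of_bound C ?_
    filter_upwards [Metric.closedBall_mem_nhds u hr] with v hv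
    rw [Metric.mem_closedBall, dist_eq_norm] at hv
    rw [Real.norm_eq_abs, norm_pow, norm_norm]
    exact h v hv
  refine h1.trans_isLittleO ?_
  have h2 : (fun x : E => ‖x‖ ^ 2) =o[nhds 0] fun x : E => x :=
    Asymptotics.isLittleO_norm_pow_id one_lt_two
  have h3 : Filter.Tendsto (fun v : E => v - u) (nhds u) (nhds 0) := by
    simpa using (continuous_sub_right u).tendsto u
  exact h2.comp_tendsto h3

theorem differentiableAt_of_abs_sub_inner_le_sq {E : Type*} [NormedAddCommGroup E]
    [InnerProductSpace ℝ E] {f : E → ℝ} {g u : E} {C r : ℝ} (hr : 0 < r)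
    (h : ∀ v, ‖v - u‖ ≤ r → |f v - f u - inner ℝ g (v - u)| ≤ C * ‖v - u‖ ^ 2) :
    DifferentiableAt ℝ f u ∧ ∀ φ, fderiv ℝ f u φ = inner ℝ g φ := by
  have h1 : HasFDerivAt f (innerSL ℝ g) u := hasFDerivAt_of_norm_sub_le_sq hr h
  exact ⟨h1.differentiableAt, fun φ => by rw [h1.fderiv]; rfl⟩

theorem LocallyLipschitzOn.prodMk {α β γ : Type*} [PseudoEMetricSpace α] [PseudoEMetricSpace β]
    [PseudoEMetricSpace γ] {s : Set α} {f : α → β} {g : α → γ} (hf : LocallyLipschitzOn s f)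
    (hg : LocallyLipschitzOn s g) : LocallyLipschitzOn s fun x => (f x, g x) := fun x hx => by
  obtain ⟨K, t, ht, h⟩ := hf hx
  obtain ⟨K', t', ht', h'⟩ := hg hx
  exact ⟨max K K', t ∩ t', Filter.inter_mem ht ht',
    (h.mono inter_subset_left).prodMk (h'.mono inter_subset_right)⟩

theorem LocallyLipschitzOn.comp {α β γ : Type*} [PseudoEMetricSpace α] [PseudoEMetricSpace β]
    [PseudoEMetricSpace γ] {s : Set α} {t : Set β} {f : α → β} {g : β → γ}
    (hg : LocallyLipschitzOn t g) (hf : LocallyLipschitzOn s f) (h : MapsTo f s t) :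
    LocallyLipschitzOn s fun x => g (f x) := fun x hx => by
  obtain ⟨K, a, ha, hKa⟩ := hf hx
  obtain ⟨K', b, hb, hKb⟩ := hg (h hx)
  have hpre : f ⁻¹' b ∈ nhdsWithin x s :=
    (hf.continuousOn x hx).tendsto_nhdsWithin h hb
  exact ⟨K' * K, a ∩ f ⁻¹' b, Filter.inter_mem ha hpre,
    hKb.comp (hKa.mono inter_subset_left) fun y hy => hy.2⟩

theorem ContDiffOn.locallyLipschitzOn_of_isOpen {E F : Type*} [NormedAddCommGroup E]
    [NormedSpace ℝ E] [NormedAddCommGroup F] [NormedSpace ℝ F] {s : Set E} {f : E → F}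
    (hs : IsOpen s) (hf : ContDiffOn ℝ 1 f s) : LocallyLipschitzOn s f := fun x hx => by
  obtain ⟨K, t, ht, h⟩ := (hf.contDiffAt (hs.mem_nhds hx)).exists_lipschitzOnWith
  exact ⟨K, t, mem_nhdsWithin_of_mem_nhds ht, h⟩

theorem LocallyLipschitzOn.smul {α E : Type*} [PseudoEMetricSpace α] [NormedAddCommGroup E]
    [NormedSpace ℝ E] {s : Set α} {f : α → ℝ} {g : α → E} (hf : LocallyLipschitzOn s f)
    (hg : LocallyLipschitzOn s g) : LocallyLipschitzOn s fun x => f x • g x :=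
  (ContDiffOn.locallyLipschitzOn_of_isOpen (s := univ) (f := fun p : ℝ × E => p.1 • p.2)
    isOpen_univ (contDiff_fst.smul contDiff_snd).contDiffOn).comp (hf.prodMk hg) (mapsTo_univ _ _)

theorem LocallyLipschitzOn.real_inner {α E : Type*} [PseudoEMetricSpace α] [NormedAddCommGroup E]
    [InnerProductSpace ℝ E] {s : Set α} {f g : α → E} (hf : LocallyLipschitzOn s f)
    (hg : LocallyLipschitzOn s g) : LocallyLipschitzOn s fun x => (inner ℝ (f x) (g x) : ℝ) :=
  (ContDiffOn.locallyLipschitzOn_of_isOpen (s := univ) (f := fun p : E × E => inner ℝ p.1 p.2)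
    isOpen_univ (contDiff_fst.inner ℝ contDiff_snd).contDiffOn).comp (hf.prodMk hg)
    (mapsTo_univ _ _)

theorem LocallyLipschitzOn.div_real {α : Type*} [PseudoEMetricSpace α] {s : Set α} {f g : α → ℝ}
    (hf : LocallyLipschitzOn s f) (hg : LocallyLipschitzOn s g) (h : ∀ x ∈ s, g x ≠ 0) :
    LocallyLipschitzOn s fun x => f x / g x :=
  (ContDiffOn.locallyLipschitzOn_of_isOpen (s := {p : ℝ × ℝ | p.2 ≠ 0})
    (f := fun p : ℝ × ℝ => p.1 / p.2) (isOpen_ne.preimage continuous_snd)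
    (contDiffOn_fst.div contDiffOn_snd fun _ hp => hp)).comp (hf.prodMk hg) h

theorem ContinuousLinearMap.locallyLipschitzOn {E F : Type*} [NormedAddCommGroup E]
    [NormedSpace ℝ E] [NormedAddCommGroup F] [NormedSpace ℝ F] (A : E →L[ℝ] F) (s : Set E) :
    LocallyLipschitzOn s A :=
  (A.lipschitz.locallyLipschitz).locallyLipschitzOn

section TangentProj

variable {E : Type*} [NormedAddCommGroup E] [InnerProductSpace ℝ E]

/-- The component of `a` orthogonal to `b`. -/
def tangentProj (a b : E) : E := a - (inner ℝ a b / inner ℝ b b) • b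

theorem inner_tangentProj_right (a b : E) : inner ℝ b (tangentProj a b) = 0 := by
  rw [tangentProj, inner_sub_right, inner_smul_right, real_inner_comm b a]
  rcases eq_or_ne b 0 with h | h
  · simp [h]
  · rw [div_mul_cancel₀ _ (inner_self_ne_zero.2 h), sub_self]

theorem inner_tangentProj_left {a b φ : E} (h : inner ℝ b φ = 0) :
    inner ℝ (tangentProj a b) φ = inner ℝ a φ := by
  rw [tangentProj, inner_sub_left, real_inner_smul_left, h, mul_zero, sub_zero]

theorem inner_self_tangentProj (a b : E) :
    inner ℝ a (tangentProj a b) = ‖tangentProj a b‖ ^ 2 := by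
  rw [← real_inner_self_eq_norm_sq, inner_tangentProj_left (inner_tangentProj_right a b)]

theorem LocallyLipschitzOn.tangentProj {α : Type*} [PseudoEMetricSpace α] {s : Set α} {f g : α → E}
    (hf : LocallyLipschitzOn s f) (hg : LocallyLipschitzOn s g) (h : ∀ x ∈ s, g x ≠ 0) :
    LocallyLipschitzOn s fun x => tangentProj (f x) (g x) :=
  hf.sub (((hf.real_inner hg).div_real (hg.real_inner hg) fun x hx =>
    inner_self_ne_zero.2 (h x hx)).smul hg)

end TangentProj

/-! ### The energy and its constrained gradient -/

namespace MetricGraph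

variable {V ι : Type*} [Fintype ι] {G : MetricGraph V ι}

open Classical in
/-- The nonlinearity `|u| ^ (p - 2) u` as an element of `L²`. -/
def nonlin (p : ℝ) (u : G.H1) : G.L2 :=
  if h : ∀ e, MemLp (fun x => signedPow (p - 2) (val u e x)) 2 (G.edgeMeasure e) then
    WithLp.toLp 2 fun e => (h e).toLp
  else 0

theorem abs_val_le {u : G.H1} {M : ℝ} (h : ∀ e, ∀ x ∈ Icc 0 (G.len e), |rep u e x| ≤ M) (e : ι) :
    ∀ᵐ x ∂(G.edgeMeasure e), |val u e x| ≤ M := by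
  filter_upwards [val_ae_eq_rep u e, ae_restrict_mem measurableSet_Ioo] with x h1 h2
  rw [h1]
  exact h e x (Ioo_subset_Icc_self h2)

/-- An H¹ function is bounded, so the integrability condition in the definition of `nonlin` always
holds and its default value does not occur. -/
theorem nonlin_ae {p : ℝ} (hp : 2 < p) (u : G.H1) (e : ι) :
    (nonlin p u e : ℝ → ℝ) =ᵐ[G.edgeMeasure e] fun x => signedPow (p - 2) (val u e x) := by
  have h : ∀ e, MemLp (fun x => signedPow (p - 2) (val u e x)) 2 (G.edgeMeasure e) := fun e => by
    obtain ⟨M, hM, hu⟩ := rep_bounded u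
    refine MemLp.of_bound ?_ (M ^ (p - 2) * M) ?_
    · exact ((measurable_signedPow _).comp_aemeasurable (val_memLp u e).1.aemeasurable).aestronglyMeasurable
    · filter_upwards [abs_val_le hu e] with x hx
      exact abs_signedPow_le (by linarith) hx
  rw [nonlin, dif_pos h]
  exact (h e).coeFn_toLp

/-- The right side contains the L² norm and not the H¹ norm: this makes the nonlinearity converge
along bounded sequences that converge only in L². -/
theorem norm_nonlin_sub_le {p M : ℝ} (hp : 2 < p) {u v : G.H1}
    (hu : ∀ e, ∀ x ∈ Icc 0 (G.len e), |rep u e x| ≤ M)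
    (hv : ∀ e, ∀ x ∈ Icc 0 (G.len e), |rep v e x| ≤ M) (hM : 0 ≤ M) :
    ‖nonlin p u - nonlin p v‖ ≤ (p - 1) * M ^ (p - 2) * ‖G.toL2 u - G.toL2 v‖ := by
  have hc : 0 ≤ (p - 1) * M ^ (p - 2) := mul_nonneg (by linarith) (by positivity)
  refine le_of_sq_le_sq ?_ (mul_nonneg hc (norm_nonneg _))
  rw [mul_pow, L2_norm_sq_eq, L2_norm_sq_eq, Finset.mul_sum]
  refine Finset.sum_le_sum fun e _ => ?_
  rw [← integral_const_mul]
  refine integral_mono_ae (L2_integrable_sq _ e) ((L2_integrable_sq _ e).const_mul _) ?_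
  filter_upwards [nonlin_ae hp u e, nonlin_ae hp v e, abs_val_le hu e, abs_val_le hv e,
    Lp.coeFn_sub (nonlin p u e) (nonlin p v e), Lp.coeFn_sub (G.toL2 u e) (G.toL2 v e)]
    with x h1 h2 h3 h4 h5 h6
  have h7 := abs_signedPow_sub_le (q := p - 2) (by linarith) h3 h4
  rw [show p - 2 + 1 = p - 1 by ring] at h7
  have e1 : ((nonlin p u - nonlin p v) e : ℝ → ℝ) x
      = signedPow (p - 2) (val u e x) - signedPow (p - 2) (val v e x) := by
    refine h5.trans ?_
    rw [Pi.sub_apply, h1, h2]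
  have e2 : ((G.toL2 u - G.toL2 v) e : ℝ → ℝ) x = val u e x - val v e x := h6
  rw [e1, e2, ← mul_pow]
  exact pow_le_pow_left₀ (abs_nonneg _) h7 2

theorem inner_nonlin_self {p : ℝ} (hp : 2 < p) (u : G.H1) :
    inner ℝ (nonlin p u) (G.toL2 u) = powInt p u := by
  rw [L2_inner_eq]
  refine Finset.sum_congr rfl fun e _ => integral_congr_ae ?_
  filter_upwards [nonlin_ae hp u e] with x hx
  rw [hx, toL2_apply, signedPow, mul_assoc, ← abs_mul_abs_self, ← pow_two, ← Real.rpow_natCast,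
    ← Real.rpow_add_of_nonneg (abs_nonneg _) (by linarith) (by norm_num)]
  congr 1
  push_cast
  ring

theorem abs_powInt_taylor_le {p M : ℝ} (hp : 2 < p) {u v : G.H1}
    (hu : ∀ e, ∀ x ∈ Icc 0 (G.len e), |rep u e x| ≤ M)
    (hv : ∀ e, ∀ x ∈ Icc 0 (G.len e), |rep v e x| ≤ M) :
    |powInt p v - powInt p u - p * inner ℝ (nonlin p u) (G.toL2 (v - u))|
      ≤ p * ((p - 1) * M ^ (p - 2)) * mass (v - u) := by
  have i1 := fun e => powInt_integrable (p := p) (by linarith) v e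
  have i2 := fun e => powInt_integrable (p := p) (by linarith) u e
  have i3 := fun e => (L2_integrable_mul (nonlin p u) (G.toL2 (v - u)) e).const_mul p
  have e1 : powInt p v - powInt p u - p * inner ℝ (nonlin p u) (G.toL2 (v - u))
      = ∑ e, ∫ x in Ioo 0 (G.len e), (|val v e x| ^ p - |val u e x| ^ p
        - p * ((nonlin p u e : ℝ → ℝ) x * (G.toL2 (v - u) e : ℝ → ℝ) x)) := by
    rw [L2_inner_eq, powInt, powInt, Finset.mul_sum, ← Finset.sum_sub_distrib,
      ← Finset.sum_sub_distrib]
    refine Finset.sum_congr rfl fun e _ => ?_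
    rw [← integral_const_mul]
    exact ((integral_sub ((i1 e).sub (i2 e)) (i3 e)).trans
      (congrArg (· - _) (integral_sub (i1 e) (i2 e)))).symm
  rw [e1, mass, Finset.mul_sum]
  refine (Finset.abs_sum_le_sum_abs _ _).trans (Finset.sum_le_sum fun e _ => ?_)
  rw [← integral_const_mul]
  refine (abs_integral_le_integral_abs).trans ?_
  refine integral_mono_ae (((i1 e).sub (i2 e)).sub (i3 e)).abs
    ((L2_integrable_sq (G.toL2 (v - u)) e).const_mul _) ?_
  filter_upwards [nonlin_ae hp u e, val_sub v u e, abs_val_le hu e, abs_val_le hv e]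
    with x h1 h2 h3 h4
  have := abs_rpow_taylor_le hp h3 h4
  rw [h1, toL2_apply, h2, sq_abs, ← mul_assoc]
  exact this

theorem kinetic_taylor (u v : G.H1) :
    kinetic v - kinetic u - 2 * inner ℝ (G.derL2 u) (G.derL2 (v - u)) = kinetic (v - u) := by
  rw [kinetic_eq, kinetic_eq, kinetic_eq, map_sub, norm_sub_sq_real, inner_sub_right,
    real_inner_self_eq_norm_sq, real_inner_comm (G.derL2 v)]
  ring

variable [Finite V] [Nonempty ι]

/-- The gradient of the energy in the `H¹` inner product. -/
def energyGrad (p : ℝ) (u : G.H1) : G.H1 := u - G.resolvent (G.toL2 u + nonlin p u)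

/-- Half the gradient of the mass in the `H¹` inner product. -/
def massGrad (u : G.H1) : G.H1 := G.resolvent (G.toL2 u)

theorem inner_massGrad (u φ : G.H1) : inner ℝ (massGrad u) φ = pairing u φ := by
  rw [massGrad, inner_resolvent, pairing_eq]

theorem inner_massGrad_self (u : G.H1) : inner ℝ (massGrad u) u = mass u := by
  rw [inner_massGrad, pairing_eq, mass_eq, real_inner_self_eq_norm_sq]

theorem massGrad_ne_zero {u : G.H1} (h : mass u ≠ 0) : massGrad u ≠ 0 := fun h0 => h <| by
  rw [← inner_massGrad_self, h0, inner_zero_left]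

theorem inner_energyGrad (p : ℝ) (u φ : G.H1) : inner ℝ (energyGrad p u) φ
    = inner ℝ (G.derL2 u) (G.derL2 φ) - inner ℝ (nonlin p u) (G.toL2 φ) := by
  rw [energyGrad, inner_sub_left, inner_resolvent, inner_add_left, H1_inner_eq]
  ring

theorem exists_energy_taylor {p : ℝ} (hp : 2 < p) (R : ℝ) : ∃ C : ℝ, ∀ u v : G.H1, ‖u‖ ≤ R →
    ‖v‖ ≤ R → |energy p v - energy p u - inner ℝ (energyGrad p u) (v - u)| ≤ C * ‖v - u‖ ^ 2 := by
  obtain ⟨A, hA, h⟩ := G.exists_abs_rep_le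
  refine ⟨1 / 2 + (p - 1) * (A * R) ^ (p - 2), fun u v hu hv => ?_⟩
  have hR : 0 ≤ R := (norm_nonneg _).trans hu
  have h1 := abs_powInt_taylor_le (M := A * R) hp
    (fun e x hx => (h u e x hx).trans (mul_le_mul_of_nonneg_left hu hA.le))
    (fun e x hx => (h v e x hx).trans (mul_le_mul_of_nonneg_left hv hA.le))
  have h2 := kinetic_taylor u v
  have h3 := kinetic_le_norm_sq (v - u)
  have h4 := mass_le_norm_sq (v - u)
  have h5 := kinetic_nonneg (v - u)
  have hc : 0 ≤ (p - 1) * (A * R) ^ (p - 2) := mul_nonneg (by linarith) (by positivity)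
  rw [inner_energyGrad, energy, energy]
  generalize inner ℝ (nonlin p u) (G.toL2 (v - u)) = a at *
  generalize inner ℝ (G.derL2 u) (G.derL2 (v - u)) = b at *
  generalize (p - 1) * (A * R) ^ (p - 2) = c at *
  generalize mass (v - u) = m at *
  generalize kinetic (v - u) = k at *
  generalize ‖v - u‖ ^ 2 = n at *
  have h6 : p * c * m ≤ p * c * n := by gcongr
  have e1 : 1 / 2 * kinetic v - 1 / p * powInt p v - (1 / 2 * kinetic u - 1 / p * powInt p u)
      - (b - a) = 1 / 2 * k - 1 / p * (powInt p v - powInt p u - p * a) := by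
    rw [← h2]
    have : p ≠ 0 := by linarith
    field_simp
    ring
  have h7 : |1 / p * (powInt p v - powInt p u - p * a)| ≤ c * n := by
    rw [abs_mul, abs_of_pos (by positivity : (0:ℝ) < 1 / p), one_div_mul_eq_div,
      div_le_iff₀ (by linarith)]
    linarith
  rw [e1]
  refine (abs_sub _ _).trans ?_
  rw [abs_of_nonneg (by positivity : 0 ≤ 1 / 2 * k)]
  linarith

theorem differentiableAt_energy {p : ℝ} (hp : 2 < p) (u : G.H1) :
    DifferentiableAt ℝ (energy p) u ∧
      ∀ φ, fderiv ℝ (energy p) u φ = inner ℝ (energyGrad p u) φ := by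
  obtain ⟨C, hC⟩ := exists_energy_taylor (G := G) hp (‖u‖ + 1)
  refine differentiableAt_of_abs_sub_inner_le_sq (E := G.H1) (C := C) zero_lt_one fun v hv => ?_
  refine hC u v (by linarith) ?_
  have := norm_le_norm_add_norm_sub' v u
  linarith

theorem continuous_energy {p : ℝ} (hp : 2 < p) : Continuous (energy p : G.H1 → ℝ) :=
  continuous_iff_continuousAt.2 fun u => (differentiableAt_energy hp u).1.continuousAt

theorem fderiv_energy {p : ℝ} (hp : 2 < p) (u φ : G.H1) :
    fderiv ℝ (energy p) u φ = inner ℝ (energyGrad p u) φ :=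
  (differentiableAt_energy hp u).2 φ

/-- The tangent space is the H¹-orthogonal complement of `massGrad u`, so the projection of the full
gradient represents the differential there. Two representatives differ by a tangent vector
orthogonal to itself, which identifies the chosen one. -/
theorem constrGrad_eq {p : ℝ} (hp : 2 < p) (u : G.H1) :
    constrGrad p u = tangentProj (energyGrad p u) (massGrad u) := by
  set v := tangentProj (energyGrad p u) (massGrad u) with hv
  have h1 : IsConstrGrad p u v := by
    constructor
    · change pairing u v = 0
      rw [← inner_massGrad, inner_tangentProj_right]
    · intro φ hφ
      change pairing u φ = 0 at hφ
      rw [← inner_massGrad] at hφ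
      rw [fderiv_energy hp, inner_tangentProj_left hφ]
  have h2 : ∃ v, IsConstrGrad p u v := ⟨v, h1⟩
  rw [constrGrad, dif_pos h2]
  have h3 := h2.choose_spec
  set z := h2.choose
  have h4 : z - v ∈ tangent u := by
    have a1 : pairing u z = 0 := h3.1
    have a2 : pairing u v = 0 := h1.1
    change pairing u (z - v) = 0
    rw [← inner_massGrad, inner_sub_right, inner_massGrad, inner_massGrad, a1, a2, sub_zero]
  have h5 : inner ℝ (z - v) (z - v) = 0 := by
    rw [inner_sub_left, h3.2 _ h4, h1.2 _ h4, sub_self]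
  exact sub_eq_zero.1 (inner_self_eq_zero.1 h5)

theorem inner_massGrad_constrGrad {p : ℝ} (hp : 2 < p) (u : G.H1) :
    inner ℝ (massGrad u) (constrGrad p u) = 0 := by
  rw [constrGrad_eq hp, inner_tangentProj_right]

theorem inner_energyGrad_constrGrad {p : ℝ} (hp : 2 < p) (u : G.H1) :
    inner ℝ (energyGrad p u) (constrGrad p u) = ‖constrGrad p u‖ ^ 2 := by
  rw [constrGrad_eq hp, inner_self_tangentProj]

theorem locallyLipschitz_nonlin {p : ℝ} (hp : 2 < p) (s : Set G.H1) :
    LocallyLipschitzOn s (nonlin p : G.H1 → G.L2) := fun u _ => by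
  obtain ⟨A, hA, h⟩ := G.exists_abs_rep_le
  have hc : 0 ≤ (p - 1) * (A * (‖u‖ + 1)) ^ (p - 2) := mul_nonneg (by linarith) (by positivity)
  refine ⟨Real.toNNReal ((p - 1) * (A * (‖u‖ + 1)) ^ (p - 2)), Metric.ball u 1,
    mem_nhdsWithin_of_mem_nhds (Metric.ball_mem_nhds u one_pos),
    LipschitzOnWith.of_dist_le' fun v hv w hw => ?_⟩
  have hb : ∀ v ∈ Metric.ball u 1, ∀ e, ∀ x ∈ Icc 0 (G.len e), |rep v e x| ≤ A * (‖u‖ + 1) := by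
    intro v hv e x hx
    refine (h v e x hx).trans (mul_le_mul_of_nonneg_left ?_ hA.le)
    rw [Metric.mem_ball, dist_eq_norm] at hv
    have := norm_le_norm_add_norm_sub' v u
    linarith
  rw [dist_eq_norm, dist_eq_norm]
  refine (norm_nonlin_sub_le hp (hb v hv) (hb w hw) (by positivity)).trans ?_
  rw [← map_sub]
  exact mul_le_mul_of_nonneg_left (norm_toL2_le _) hc

theorem locallyLipschitz_energyGrad {p : ℝ} (hp : 2 < p) (s : Set G.H1) :
    LocallyLipschitzOn s (energyGrad p : G.H1 → G.H1) := by
  have h1 : LocallyLipschitzOn s fun u : G.H1 => G.toL2 u + nonlin p u :=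
    (ContinuousLinearMap.locallyLipschitzOn G.toL2 s).add (locallyLipschitz_nonlin hp s)
  exact (LocallyLipschitz.id.locallyLipschitzOn).sub
    (((ContinuousLinearMap.locallyLipschitzOn G.resolvent univ)).comp h1 (mapsTo_univ _ _))

theorem locallyLipschitz_massGrad (s : Set G.H1) :
    LocallyLipschitzOn s (massGrad : G.H1 → G.H1) :=
  ContinuousLinearMap.locallyLipschitzOn (G.resolvent.comp G.toL2) s

theorem locallyLipschitzOn_constrGrad {p μ : ℝ} (hp : 2 < p) (hμ : 0 < μ) :
    LocallyLipschitzOn (G.massSphere μ) (constrGrad p) := by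
  have : (constrGrad p : G.H1 → G.H1) =
      fun u : G.H1 => tangentProj (energyGrad p u) (massGrad u) :=
    funext fun u => constrGrad_eq hp u
  rw [this]
  have hne : ∀ u ∈ G.massSphere μ, massGrad u ≠ 0 := fun u hu => massGrad_ne_zero <| by
    have hu' : mass u = μ := hu
    rw [hu']
    exact hμ.ne'
  exact LocallyLipschitzOn.tangentProj (E := G.H1) (f := fun u : G.H1 => energyGrad p u)
    (g := fun u : G.H1 => massGrad u) (locallyLipschitz_energyGrad hp (G.massSphere μ))
    (locallyLipschitz_massGrad (G.massSphere μ)) hne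

end MetricGraph

/-! ### Ordinary differential equations on a closed set -/

section Flow

variable {E : Type*} [NormedAddCommGroup E] [NormedSpace ℝ E]

/-- `σ` solves `σ' = W σ`, `σ 0 = u` on the time set `I`, with values in `S`. -/
def IsSolutionOn (S : Set E) (W : E → E) (I : Set ℝ) (u : E) (σ : ℝ → E) : Prop :=
  σ 0 = u ∧ ∀ t ∈ I, σ t ∈ S ∧ HasDerivWithinAt σ (W (σ t)) I t

variable {S : Set E} {W : E → E} {u : E} {σ τ : ℝ → E} {T : ℝ}

theorem IsSolutionOn.mono {I J : Set ℝ} (h : IsSolutionOn S W I u σ) (hJ : J ⊆ I) :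
    IsSolutionOn S W J u σ :=
  ⟨h.1, fun t ht => ⟨(h.2 t (hJ ht)).1, (h.2 t (hJ ht)).2.mono hJ⟩⟩

theorem IsSolutionOn.continuousOn {I : Set ℝ} (h : IsSolutionOn S W I u σ) : ContinuousOn σ I :=
  fun t ht => (h.2 t ht).2.continuousWithinAt

theorem HasDerivWithinAt.Ici_of_Icc {f : ℝ → E} {f' : E} {a b t : ℝ} (ht : t ∈ Ico a b)
    (h : HasDerivWithinAt f f' (Icc a b) t) : HasDerivWithinAt f f' (Ici t) t :=
  h.mono_of_mem_nhdsWithin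
    (Filter.mem_of_superset (Icc_mem_nhdsGE ht.2) (Icc_subset_Icc_left ht.1))

/-- Both trajectories are compact, and on their union a locally Lipschitz field is Lipschitz; then
the standard uniqueness theorem applies. -/
theorem IsSolutionOn.eqOn (hW : LocallyLipschitzOn S W) (hσ : IsSolutionOn S W (Icc 0 T) u σ)
    (hτ : IsSolutionOn S W (Icc 0 T) u τ) : EqOn σ τ (Icc 0 T) := by
  obtain ⟨K, hK⟩ := LocallyLipschitzOn.exists_lipschitzOnWith_of_compact
    ((isCompact_Icc.image_of_continuousOn hσ.continuousOn).union
      (isCompact_Icc.image_of_continuousOn hτ.continuousOn))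
    (hW.mono (union_subset (image_subset_iff.2 fun t ht => (hσ.2 t ht).1)
      (image_subset_iff.2 fun t ht => (hτ.2 t ht).1)))
  exact ODE_solution_unique_of_mem_Icc_right (v := fun _ => W)
    (s := fun _ => σ '' Icc 0 T ∪ τ '' Icc 0 T) (fun _ _ => hK) hσ.continuousOn
    (fun t ht => (hσ.2 t (Ico_subset_Icc_self ht)).2.Ici_of_Icc ht)
    (fun t ht => Or.inl (mem_image_of_mem _ (Ico_subset_Icc_self ht))) hτ.continuousOn
    (fun t ht => (hτ.2 t (Ico_subset_Icc_self ht)).2.Ici_of_Icc ht)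
    (fun t ht => Or.inr (mem_image_of_mem _ (Ico_subset_Icc_self ht))) (hσ.1.trans hτ.1.symm)

/-- Gluing: the solution chosen for the time s is evaluated at s itself. By uniqueness this diagonal
agrees with each chosen solution as far as the latter is defined. -/
theorem exists_isSolutionOn_of_forall_Icc (hW : LocallyLipschitzOn S W) {I : Set ℝ}
    (hI : ∀ t ∈ I, 0 ≤ t ∧ ∃ T, t < T ∧ I ∩ Iio T ⊆ Icc 0 T ∧
      ∃ σ, IsSolutionOn S W (Icc 0 T) u σ) (h0 : (0 : ℝ) ∈ I) :
    ∃ η, IsSolutionOn S W I u η := by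
  choose! B T ht hT τ hτ using hI
  have key : ∀ t ∈ I, EqOn (fun s => τ s s) (τ t) (I ∩ Iio (T t)) := by
    intro t hts s hs
    have h1 : s ≤ T s := (ht s hs.1).le
    have hs2 : s < T t := hs.2
    exact IsSolutionOn.eqOn hW ((hτ s hs.1).mono (Icc_subset_Icc_right h1))
      ((hτ t hts).mono (Icc_subset_Icc_right hs2.le)) (right_mem_Icc.2 (B s hs.1))
  refine ⟨fun s => τ s s, (hτ 0 h0).1, fun t htI => ?_⟩
  have h1 := (hτ t htI).2 t ⟨B t htI, (ht t htI).le⟩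
  refine ⟨h1.1, ?_⟩
  have h2 : HasDerivWithinAt (τ t) (W (τ t t)) (I ∩ Iio (T t)) t := h1.2.mono (hT t htI)
  exact (h2.congr (key t htI) rfl).mono_of_mem_nhdsWithin
    (inter_mem_nhdsWithin _ (Iio_mem_nhds (ht t htI)))

theorem IsSolutionOn.exists_extend {z : E} {δ : ℝ} (hT : 0 ≤ T) (hδ : 0 < δ)
    (hσ : IsSolutionOn S W (Icc 0 T) u σ) (hz : σ T = z)
    (hτ : IsSolutionOn S W (Icc 0 δ) z τ) :
    ∃ η, IsSolutionOn S W (Icc 0 (T + δ)) u η := by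
  classical
  set η : ℝ → E := fun t => if t ≤ T then σ t else τ (t - T) with hη
  have e1 : EqOn η σ (Icc 0 T) := fun t ht => if_pos ht.2
  have e2 : EqOn η (fun t => τ (t - T)) (Icc T (T + δ)) := fun t ht => by
    rcases ht.1.eq_or_lt with h | h
    · simp [hη, ← h, hz, hτ.1]
    · exact if_neg h.not_ge
  have d2 : ∀ t ∈ Icc T (T + δ), η t ∈ S ∧ HasDerivWithinAt η (W (η t)) (Icc T (T + δ)) t := by
    intro t ht
    have h1 := hτ.2 (t - T) ⟨by linarith [ht.1], by linarith [ht.2]⟩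
    rw [e2 ht]
    refine ⟨h1.1, HasDerivWithinAt.congr ?_ e2 (e2 ht)⟩
    have h2 : HasDerivWithinAt (fun t : ℝ => t - T) 1 (Icc T (T + δ)) t :=
      ((hasDerivAt_id t).sub_const T).hasDerivWithinAt
    have hm : MapsTo (fun t : ℝ => t - T) (Icc T (T + δ)) (Icc 0 δ) := fun s hs =>
      ⟨by linarith [hs.1], by linarith [hs.2]⟩
    have h3 := h1.2.scomp t h2 hm
    rwa [one_smul] at h3
  have d1 : ∀ t ∈ Icc 0 T, η t ∈ S ∧ HasDerivWithinAt η (W (η t)) (Icc 0 T) t := by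
    intro t ht
    rw [e1 ht]
    exact ⟨(hσ.2 t ht).1, (hσ.2 t ht).2.congr e1 (e1 ht)⟩
  have hU : Icc 0 (T + δ) = Icc 0 T ∪ Icc T (T + δ) :=
    (Icc_union_Icc_eq_Icc hT (by linarith)).symm
  refine ⟨η, by rw [e1 ⟨le_rfl, hT⟩, hσ.1], fun t ht => ?_⟩
  rcases lt_trichotomy t T with h | h | h
  · have := d1 t ⟨ht.1, h.le⟩
    exact ⟨this.1, this.2.mono_of_mem_nhdsWithin
      (Filter.mem_of_superset (inter_mem_nhdsWithin _ (Iio_mem_nhds h))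
        fun s hs => ⟨hs.1.1, le_of_lt hs.2⟩)⟩
  · have h1 := d1 t ⟨ht.1, h.le⟩
    have h2 := d2 t ⟨h.ge, ht.2⟩
    rw [hU]
    exact ⟨h1.1, h1.2.union h2.2⟩
  · have := d2 t ⟨h.le, ht.2⟩
    exact ⟨this.1, this.2.mono_of_mem_nhdsWithin
      (Filter.mem_of_superset (inter_mem_nhdsWithin _ (Ioi_mem_nhds h))
        fun s hs => ⟨le_of_lt hs.2, hs.1.2⟩)⟩

/-- Bounded speed makes the solution Lipschitz, so it converges at T, to a point of the closed set
S. There the one-sided derivative exists because the derivative itself has a limit. -/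
theorem IsSolutionOn.exists_Icc_of_Ico [CompleteSpace E] (hS : IsClosed S) {M : ℝ}
    (hW : ContinuousOn W S) (hT : 0 < T)
    (hσ : IsSolutionOn S W (Ico 0 T) u σ) (hM : ∀ t ∈ Ico 0 T, ‖W (σ t)‖ ≤ M) :
    ∃ η, IsSolutionOn S W (Icc 0 T) u η := by
  classical
  have hM0 : 0 ≤ M := (norm_nonneg _).trans (hM 0 ⟨le_rfl, hT⟩)
  have hL : LipschitzOnWith (Real.toNNReal M) σ (Ico 0 T) :=
    (convex_Ico 0 T).lipschitzOnWith_of_nnnorm_hasDerivWithin_le (fun t ht => (hσ.2 t ht).2)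
      fun t ht => by
        rw [← NNReal.coe_le_coe, coe_nnnorm, Real.coe_toNNReal _ hM0]
        exact hM t ht
  have hne : (nhdsWithin T (Ico 0 T)).NeBot :=
    mem_closure_iff_nhdsWithin_neBot.1 (by rw [closure_Ico hT.ne]; exact ⟨hT.le, le_rfl⟩)
  have hnhds : nhdsWithin T (Ico 0 T) = nhdsWithin T (Iio T) := nhdsWithin_Ico_eq_nhdsLT hT
  have hc : Cauchy (Filter.map σ (nhdsWithin T (Ico 0 T))) :=
    ((cauchy_nhds.mono nhdsWithin_le_nhds).map_of_le hL.uniformContinuousOn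
      (Filter.le_principal_iff.2 self_mem_nhdsWithin) : _)
  obtain ⟨z, hz⟩ := CompleteSpace.complete hc
  have hzS : z ∈ S := hS.mem_of_tendsto (b := nhdsWithin T (Ico 0 T)) hz
    (by filter_upwards [self_mem_nhdsWithin] with t ht using (hσ.2 t ht).1)
  set η := Function.update σ T z with hη
  have e1 : ∀ t, t ≠ T → η t = σ t := fun t ht => Function.update_of_ne ht _ _
  have eT : η T = z := Function.update_self _ _ _
  have e2 : EqOn η σ (Ico 0 T) := fun t ht => e1 t ht.2.ne
  have hd : ∀ t ∈ Ico 0 T, HasDerivWithinAt η (W (η t)) (Ico 0 T) t := fun t ht => by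
    rw [e2 ht]
    exact (hσ.2 t ht).2.congr e2 (e2 ht)
  have hdA : ∀ t ∈ Ioo 0 T, HasDerivAt η (W (η t)) t := fun t ht =>
    (hd t (Ioo_subset_Ico_self ht)).hasDerivAt (Ico_mem_nhds ht.1 ht.2)
  have htend : Filter.Tendsto η (nhdsWithin T (Iio T)) (nhds z) := by
    rw [← hnhds]
    refine Filter.Tendsto.congr' ?_ hz
    filter_upwards [self_mem_nhdsWithin] with t ht using (e2 ht).symm
  have hIoo : Ioo 0 T ∈ nhdsWithin T (Iio T) := Ioo_mem_nhdsLT hT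
  have hend : HasDerivWithinAt η (W z) (Iic T) T := by
    refine hasDerivWithinAt_Iic_of_tendsto_deriv (s := Ioo 0 T)
      (fun t ht => (hdA t ht).differentiableAt.differentiableWithinAt) ?_ hIoo ?_
    · rw [ContinuousWithinAt, eT]
      exact htend.mono_left (nhdsWithin_mono _ Ioo_subset_Iio_self)
    · have h1 : Filter.Tendsto (fun t => W (η t)) (nhdsWithin T (Iio T)) (nhds (W z)) := by
        refine (hW z hzS).tendsto.comp (tendsto_nhdsWithin_iff.2 ⟨htend, ?_⟩)
        filter_upwards [hIoo] with t ht
        rw [e2 (Ioo_subset_Ico_self ht)]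
        exact (hσ.2 t (Ioo_subset_Ico_self ht)).1
      refine h1.congr' ?_
      filter_upwards [hIoo] with t ht using (hdA t ht).deriv.symm
  refine ⟨η, by rw [e1 0 hT.ne, hσ.1], fun t ht => ?_⟩
  rcases ht.2.eq_or_lt with h | h
  · subst h
    rw [eT]
    exact ⟨hzS, hend.mono Icc_subset_Iic_self⟩
  · have h1 : t ∈ Ico 0 T := ⟨ht.1, h⟩
    refine ⟨by rw [e2 h1]; exact (hσ.2 t h1).1, (hd t h1).mono_of_mem_nhdsWithin
      (Filter.mem_of_superset (inter_mem_nhdsWithin _ (Iio_mem_nhds h))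
        fun s hs => ⟨hs.1.1, hs.2⟩)⟩

/-- A flow with local solutions whose speed stays bounded along every solution is global. -/
theorem exists_isSolutionOn_Ici [CompleteSpace E] (hS : IsClosed S) (hW : LocallyLipschitzOn S W)
    (hloc : ∀ z ∈ S, ∃ δ > 0, ∃ σ, IsSolutionOn S W (Icc 0 δ) z σ) (hu : u ∈ S) {M : ℝ}
    (hM : ∀ T σ, IsSolutionOn S W (Icc 0 T) u σ → ∀ t ∈ Icc 0 T, ‖W (σ t)‖ ≤ M) :
    ∃ η, IsSolutionOn S W (Ici 0) u η := by
  set A : Set ℝ := {T | 0 < T ∧ ∃ σ, IsSolutionOn S W (Icc 0 T) u σ} with hA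
  have hne : A.Nonempty := by
    obtain ⟨δ, hδ, h⟩ := hloc u hu
    exact ⟨δ, hδ, h⟩
  -- A finite maximal time is impossible: the solution could be closed at the supremum and restarted
  -- from its end point.
  by_cases hb : BddAbove A
  · exfalso
    set s := sSup A with hs
    have hs0 : 0 < s := by
      obtain ⟨T, hT⟩ := hne
      exact hT.1.trans_le (le_csSup hb hT)
    obtain ⟨σ, hσ⟩ := exists_isSolutionOn_of_forall_Icc hW (u := u) (I := Ico 0 s)
      (fun t ht => by
        obtain ⟨T, hT, htT⟩ := exists_lt_of_lt_csSup hne ht.2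
        exact ⟨ht.1, T, htT, fun x hx => ⟨hx.1.1, le_of_lt hx.2⟩, hT.2⟩) ⟨le_rfl, hs0⟩
    obtain ⟨η, hη⟩ := hσ.exists_Icc_of_Ico hS (M := M) hW.continuousOn hs0 fun t ht =>
      hM t σ (hσ.mono fun x hx => ⟨hx.1, hx.2.trans_lt ht.2⟩) t ⟨ht.1, le_rfl⟩
    obtain ⟨δ, hδ, τ, hτ⟩ := hloc (η s) (hη.2 s ⟨hs0.le, le_rfl⟩).1
    obtain ⟨ζ, hζ⟩ := hη.exists_extend hs0.le hδ rfl hτ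
    have := le_csSup hb (show s + δ ∈ A from ⟨by linarith, ζ, hζ⟩)
    linarith
  · refine exists_isSolutionOn_of_forall_Icc hW (fun t ht => ?_) self_mem_Ici
    obtain ⟨T, hT, htT⟩ := not_bddAbove_iff.1 hb t
    exact ⟨ht, T, htT, fun x hx => ⟨hx.1, le_of_lt hx.2⟩, hT.2⟩

end Flow

/-! ### Local solutions on the mass constraint -/

section Sphere

theorem exists_forall_Icc_mem_of_continuousWithinAt {X : Type*} [TopologicalSpace X]
    {σ : ℝ → X} {U : Set X} {ε : ℝ} (hε : 0 < ε)
    (h : ContinuousWithinAt σ (Icc 0 ε) 0) (hU : U ∈ nhds (σ 0)) :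
    ∃ δ > 0, δ ≤ ε ∧ ∀ t ∈ Icc 0 δ, σ t ∈ U := by
  have h1 : σ ⁻¹' U ∈ nhdsWithin 0 (Ici (0 : ℝ)) := by
    rw [← nhdsWithin_Icc_eq_nhdsGE hε]
    exact h hU
  obtain ⟨δ, hδ, h2⟩ := (mem_nhdsGE_iff_exists_Icc_subset).1 h1
  exact ⟨min δ ε, lt_min hδ hε, min_le_right _ _,
    fun t ht => h2 ⟨ht.1, ht.2.trans (min_le_left _ _)⟩⟩

variable {E F : Type*} [NormedAddCommGroup E] [NormedSpace ℝ E] [CompleteSpace E]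
  [NormedAddCommGroup F] [InnerProductSpace ℝ F]

theorem exists_local_solution_of_lipschitz {W : E → E} {z : E} {U : Set E} {K : NNReal}
    (hU : U ∈ nhds z) (hW : LipschitzOnWith K W U) :
    ∃ δ > 0, ∃ σ : ℝ → E, σ 0 = z ∧ ∀ t ∈ Icc 0 δ, σ t ∈ U ∧
      HasDerivWithinAt σ (W (σ t)) (Icc 0 δ) t := by
  obtain ⟨a', ha', hsub⟩ := Metric.nhds_basis_closedBall.mem_iff.1 hU
  lift a' to NNReal using ha'.le with a
  have ha : (0 : ℝ) < a := ha'
  -- A bound for the field on the ball of radius a, made positive by the 1; up to the time a/L a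
  -- solution stays in that ball.
  set L : NNReal := K * a + ‖W z‖₊ + 1 with hL
  have hL0 : (0 : ℝ) < L := by rw [hL]; push_cast; positivity
  have hε : (0 : ℝ) < a / L := by positivity
  have hb : ∀ x ∈ Metric.closedBall z (a : ℝ), ‖W x‖ ≤ L := fun x hx => by
    have h1 := (hW.mono hsub).dist_le_mul x hx z (Metric.mem_closedBall_self a.2)
    rw [dist_eq_norm] at h1
    have h2 : (K : ℝ) * dist x z ≤ K * a := mul_le_mul_of_nonneg_left hx K.2
    have h3 := norm_le_norm_add_norm_sub' (W x) (W z)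
    rw [hL]
    push_cast
    linarith
  have hP : IsPicardLindelof (fun _ => W) (tmin := 0) (tmax := a / L) ⟨0, le_rfl, hε.le⟩ z a 0 L K :=
    IsPicardLindelof.of_time_independent hb (hW.mono hsub) (by
      simp only [sub_zero, sub_self, NNReal.coe_zero]
      rw [max_eq_left hε.le, mul_div_cancel₀ _ hL0.ne'])
  obtain ⟨σ, h0, hσ⟩ := hP.exists_eq_forall_mem_Icc_hasDerivWithinAt₀
  have h0' : σ 0 = z := h0
  obtain ⟨δ, hδ, hδε, hm⟩ := exists_forall_Icc_mem_of_continuousWithinAt hε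
    (hσ 0 ⟨le_rfl, hε.le⟩).continuousWithinAt (U := U) (by rwa [h0'])
  exact ⟨δ, hδ, σ, h0', fun t ht => ⟨hm t ht,
    (hσ t ⟨ht.1, ht.2.trans hδε⟩).mono (Icc_subset_Icc_right hδε)⟩⟩

/-- Local solvability on the level sets of `x ↦ ‖A x‖` for a tangent vector field. -/
theorem exists_local_solution_on_sphere (A : E →L[ℝ] F) {r : ℝ} (hr : 0 < r) {W : E → E}
    (hW : LocallyLipschitzOn {x | ‖A x‖ = r} W)
    (ht : ∀ x, ‖A x‖ = r → inner ℝ (A x) (A (W x)) = 0) {z : E} (hz : ‖A z‖ = r) :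
    ∃ δ > 0, ∃ σ, IsSolutionOn {x | ‖A x‖ = r} W (Icc 0 δ) z σ := by
  set s : Set E := {x | ‖A x‖ ≠ 0} with hs
  have hso : IsOpen s := isOpen_ne.preimage A.continuous.norm
  -- The field lives only on the level set. Composed with this radial retraction it becomes locally
  -- Lipschitz on an open set, where Picard-Lindelöf applies.
  set R : E → E := fun x => (r / ‖A x‖) • x with hR
  have hAR : ∀ x ∈ s, ‖A (R x)‖ = r := fun x hx => by
    have hx' : ‖A x‖ ≠ 0 := hx
    rw [hR, map_smul, norm_smul, norm_div, norm_norm, Real.norm_of_nonneg hr.le,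
      div_mul_cancel₀ _ hx']
  have hRL : LocallyLipschitzOn s R :=
    LocallyLipschitzOn.smul
      (((LocallyLipschitz.const r).locallyLipschitzOn).div_real
        (((lipschitzWith_one_norm (E := F)).locallyLipschitz.comp
          A.lipschitz.locallyLipschitz).locallyLipschitzOn) fun x hx => hx)
      LocallyLipschitz.id.locallyLipschitzOn
  have hzs : z ∈ s := by
    change ‖A z‖ ≠ 0
    rw [hz]
    exact hr.ne'
  obtain ⟨K, t, htn, hK⟩ := (hW.comp hRL hAR) hzs
  rw [hso.nhdsWithin_eq hzs] at htn
  obtain ⟨δ, hδ, σ, h0, hσ⟩ := exists_local_solution_of_lipschitz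
    (Filter.inter_mem htn (hso.mem_nhds hzs)) (hK.mono inter_subset_left)
  -- A(σ) is a multiple of A(R σ), to which the extended field is orthogonal. So ‖A σ‖ is constant,
  -- R fixes σ, and σ solves the original equation.
  have hd : ∀ τ ∈ Icc 0 δ, HasDerivWithinAt (fun τ => ‖A (σ τ)‖ ^ 2) 0 (Icc 0 δ) τ := by
    intro τ hτ
    have h1 : HasDerivWithinAt (fun τ => A (σ τ)) (A (W (R (σ τ)))) (Icc 0 δ) τ :=
      A.hasFDerivAt.comp_hasDerivWithinAt τ (hσ τ hτ).2
    have hs' : ‖A (σ τ)‖ ≠ 0 := (hσ τ hτ).1.2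
    have h2 : inner ℝ (A (σ τ)) (A (W (R (σ τ)))) = 0 := by
      have h3 := ht _ (hAR _ (hσ τ hτ).1.2)
      nth_rewrite 1 [hR] at h3
      rw [map_smul, real_inner_smul_left] at h3
      exact (mul_eq_zero.1 h3).resolve_left (div_ne_zero hr.ne' hs')
    have h4 := h1.norm_sq
    rwa [h2, mul_zero] at h4
  have hc : ∀ τ ∈ Icc 0 δ, ‖A (σ τ)‖ = r := fun τ hτ => by
    have h5 := constant_of_has_deriv_right_zero (fun τ hτ => (hd τ hτ).continuousWithinAt)
      (fun τ hτ => (hd τ (Ico_subset_Icc_self hτ)).Ici_of_Icc hτ) τ hτ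
    rw [h0, hz] at h5
    exact (pow_left_inj₀ (norm_nonneg _) hr.le two_ne_zero).1 h5
  refine ⟨δ, hδ, σ, h0, fun τ hτ => ⟨hc τ hτ, ?_⟩⟩
  have h6 : R (σ τ) = σ τ := by
    simp only [hR]
    rw [hc τ hτ, div_self hr.ne', one_smul]
  have h7 := (hσ τ hτ).2
  rwa [h6] at h7

end Sphere

/-! ### Monotone quantities and distance to a convex set -/

section Descent

variable {E : Type*} [NormedAddCommGroup E] [InnerProductSpace ℝ E]

/-- The energy is non-increasing along a solution of a descent equation. -/
theorem IsSolutionOn.antitoneOn {S : Set E} {W : E → E} {u : E} {σ : ℝ → E} {T : ℝ}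
    (h : IsSolutionOn S W (Icc 0 T) u σ) {f : E → ℝ} {g : E → E}
    (hf : ∀ x, DifferentiableAt ℝ f x ∧ ∀ φ, fderiv ℝ f x φ = inner ℝ (g x) φ)
    (hW : ∀ x ∈ S, inner ℝ (g x) (W x) ≤ 0) : AntitoneOn (fun t => f (σ t)) (Icc 0 T) := by
  have h1 : ∀ t ∈ Icc 0 T,
      HasDerivWithinAt (fun t => f (σ t)) (inner ℝ (g (σ t)) (W (σ t))) (Icc 0 T) t := by
    intro t ht
    rw [← (hf (σ t)).2]
    exact (hf (σ t)).1.hasFDerivAt.comp_hasDerivWithinAt t (h.2 t ht).2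
  refine antitoneOn_of_hasDerivWithinAt_nonpos (convex_Icc 0 T)
    (fun t ht => (h1 t ht).continuousWithinAt)
    (fun t ht => (h1 t (interior_subset ht)).mono interior_subset)
    (fun t ht => hW _ (h.2 t (interior_subset ht)).1)

theorem ContinuousOn.forall_Icc_lt {f : ℝ → ℝ} {T ρ : ℝ} (hf : ContinuousOn f (Icc 0 T))
    (h0 : f 0 < ρ) (hne : ∀ t ∈ Icc 0 T, f t ≠ ρ) : ∀ t ∈ Icc 0 T, f t < ρ := by
  intro t ht
  by_contra h
  obtain ⟨s, hs, h1⟩ := intermediate_value_Icc ht.1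
    (hf.mono (Icc_subset_Icc_right ht.2)) ⟨h0.le, not_lt.1 h⟩
  exact hne s ⟨hs.1, hs.2.trans ht.2⟩ h1

/-- The point at parameter `a` on the segment from `w` to `b`. -/
def segmentPoint (w b : E) (a : ℝ) : E := (1 - a) • w + a • b

/-- With w in C, the point (1-a) w + a b is in C and its distance to the moved point is (1-a) ‖x -
w‖. -/
theorem infDist_add_smul_sub_le {C : Set E}
    (hC : ∀ w ∈ C, ∀ b ∈ C, ∀ a : ℝ, 0 ≤ a → a ≤ 1 → segmentPoint w b a ∈ C)
    {x b : E} (hb : b ∈ C) {a : ℝ}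
    (h0 : 0 ≤ a) (h1 : a ≤ 1) : Metric.infDist (x + a • (b - x)) C ≤ Metric.infDist x C := by
  refine (Metric.le_infDist ⟨b, hb⟩).2 fun w hw => ?_
  refine (Metric.infDist_le_dist_of_mem (hC w hw b hb a h0 h1)).trans ?_
  rw [dist_eq_norm, dist_eq_norm, segmentPoint]
  have : x + a • (b - x) - ((1 - a) • w + a • b) = (1 - a) • (x - w) := by module
  rw [this, norm_smul, Real.norm_of_nonneg (sub_nonneg.2 h1)]
  exact mul_le_of_le_one_left (norm_nonneg _) (by linarith)

/-- If the equation drags the points near a convex set `C` towards points of `C`, the distance of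
a solution to `C` does not leave a sublevel set. -/
theorem IsSolutionOn.infDist_le {S : Set E} {W : E → E} {u : E} {σ : ℝ → E} {T : ℝ}
    (h : IsSolutionOn S W (Icc 0 T) u σ) {C : Set E}
    (hC : ∀ w ∈ C, ∀ b ∈ C, ∀ a : ℝ, 0 ≤ a → a ≤ 1 → segmentPoint w b a ∈ C)
    {ν ν' : ℝ} (hν : ν < ν')
    (hW : ∀ t ∈ Icc 0 T, Metric.infDist (σ t) C < ν' →
      ∃ θ : ℝ, 0 ≤ θ ∧ ∃ b ∈ C, W (σ t) = θ • (b - σ t))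
    (h0 : Metric.infDist u C ≤ ν) : ∀ t ∈ Icc 0 T, Metric.infDist (σ t) C ≤ ν := by
  have hcont : ContinuousOn (fun t => Metric.infDist (σ t) C) (Icc 0 T) :=
    (Metric.continuous_infDist_pt C).comp_continuousOn h.continuousOn
  -- Continuous induction on t. The slack ε t absorbs the error o(s - t) of one Euler step.
  have key : ∀ ε > 0, ν + ε * T < ν' →
      ∀ t ∈ Icc 0 T, Metric.infDist (σ t) C ≤ ν + ε * t := by
    intro ε hε hεT
    refine IsClosed.Icc_subset_of_forall_exists_gt
      (s := {t | Metric.infDist (σ t) C ≤ ν + ε * t}) ?_ ?_ ?_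
    · have := (hcont.sub (by fun_prop : ContinuousOn (fun t : ℝ => ν + ε * t) (Icc 0 T))
        ).preimage_isClosed_of_isClosed isClosed_Icc (isClosed_Iic (a := (0 : ℝ)))
      convert this using 1
      ext t
      change Metric.infDist (σ t) C ≤ ν + ε * t ∧ t ∈ Icc 0 T ↔
        t ∈ Icc 0 T ∧ Metric.infDist (σ t) C - (ν + ε * t) ≤ 0
      rw [sub_nonpos]
      exact and_comm
    · simpa [h.1] using h0
    · rintro t ⟨ht1, ht⟩ y hy
      have ht1 : Metric.infDist (σ t) C ≤ ν + ε * t := ht1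
      have htc := Ico_subset_Icc_self ht
      obtain ⟨θ, hθ, b, hb, hWt⟩ := hW t htc (by nlinarith [ht.2])
      have hd := (h.2 t htc).2.Ici_of_Icc ht
      rw [hasDerivWithinAt_iff_isLittleO] at hd
      have e1 := (hd.def hε).filter_mono (nhdsWithin_mono t Ioi_subset_Ici_self)
      -- The bound 1/(θ + 1) on the step makes (s - t) θ ≤ 1, so the Euler step ends on the segment
      -- from σ t to b.
      have e2 : ∀ᶠ s in nhdsWithin t (Ioi t), s ∈ Ioo t (min (min y T) (t + 1 / (θ + 1))) :=
        Ioo_mem_nhdsGT (lt_min (lt_min hy ht.2) (by linarith [one_div_pos.2 (by linarith : 0 < θ + 1)]))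
      obtain ⟨s, hs1, hs2⟩ := (e1.and e2).exists
      have hst : 0 < s - t := sub_pos.2 hs2.1
      have hsy := hs2.2.trans_le ((min_le_left _ _).trans (min_le_left _ _))
      have hs3 : s - t < 1 / (θ + 1) := by linarith [hs2.2.trans_le (min_le_right _ _)]
      rw [lt_div_iff₀ (by linarith)] at hs3
      refine ⟨s, ?_, hs2.1, hsy.le⟩
      change Metric.infDist (σ s) C ≤ ν + ε * s
      have h3 := infDist_add_smul_sub_le hC (x := σ t) hb
        (mul_nonneg hst.le hθ) (by nlinarith)
      have h4 : Metric.infDist (σ s) C ≤ Metric.infDist (σ t + ((s - t) * θ) • (b - σ t)) C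
          + dist (σ s) (σ t + ((s - t) * θ) • (b - σ t)) := Metric.infDist_le_infDist_add_dist
      rw [dist_eq_norm] at h4
      rw [hWt, smul_smul, sub_sub, Real.norm_of_nonneg hst.le] at hs1
      linarith
  intro t ht
  refine le_of_forall_pos_le_add fun ε hε => ?_
  have hT1 : 0 < T + 1 := by linarith [ht.1, ht.2]
  -- The total slack stays below ε, and below the gap ν' - ν, so that the dragging hypothesis
  -- remains available.
  set a := min ε ((ν' - ν) / 2) / (T + 1) with ha
  have ha0 : 0 < a := by
    have : 0 < min ε ((ν' - ν) / 2) := lt_min hε (by linarith)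
    positivity
  have ha1 : a * (T + 1) = min ε ((ν' - ν) / 2) := div_mul_cancel₀ _ hT1.ne'
  have h1 := key a ha0 (by nlinarith [min_le_right ε ((ν' - ν) / 2)]) t ht
  nlinarith [min_le_left ε ((ν' - ν) / 2), ht.2]

end Descent

/-! ### The constrained gradient near the cones and the threshold mass -/

theorem tangentProj_sub_add_eq {E : Type*} [NormedAddCommGroup E] [InnerProductSpace ℝ E]
    {m : E} (hm : m ≠ 0) (u z : E) : tangentProj (u - (m + z)) m
      = u - (z + ((inner ℝ u m - inner ℝ z m) / inner ℝ m m) • m) := by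
  have h0 : inner ℝ m m ≠ 0 := inner_self_ne_zero.2 hm
  have : (inner ℝ u m - inner ℝ z m) / inner ℝ m m
      = 1 + inner ℝ (u - (m + z)) m / inner ℝ m m := by
    rw [inner_sub_left, inner_add_left]
    field_simp
    ring
  rw [tangentProj, this]
  module

/-- Used with m = Ru and z = R g(u), where g(u) = |u|^(p-2) u: the left side is the constrained
gradient, and the hypothesis is the sign condition on its multiplier. -/
theorem exists_tangentProj_sub_eq {E : Type*} [NormedAddCommGroup E] [InnerProductSpace ℝ E]
    {u m z : E} (hm : m ≠ 0) (h : inner ℝ z m ≤ inner ℝ u m) :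
    ∃ b : ℝ, 0 ≤ b ∧ tangentProj (u - (m + z)) m = u - (z + b • m) :=
  ⟨_, div_nonneg (sub_nonneg.2 h) real_inner_self_nonneg, tangentProj_sub_add_eq hm u z⟩

theorem tangentProj_neg {E : Type*} [NormedAddCommGroup E] [InnerProductSpace ℝ E] (a b : E) :
    tangentProj (-a) (-b) = -tangentProj a b := by
  rw [tangentProj, tangentProj, inner_neg_neg, inner_neg_neg]
  module

/-- A lower bound affine in t, so that a lower bound for the mean of u gives one for the mean of
|u|^(p-2) u. -/
theorem signedPow_lower_bound {q s τ t : ℝ} (hq : 0 < q) (hs : 0 ≤ s) (ht : -τ ≤ t) (hτ : 0 ≤ τ) :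
    s ^ q * (t - s) - signedPow q τ ≤ signedPow q t := by
  have hτ' : 0 ≤ signedPow q τ := mul_nonneg (by positivity) hτ
  have hsq : 0 ≤ s ^ q := by positivity
  rcases le_total s t with h | h
  · have h1 : s ^ q ≤ |t| ^ q := by
      rw [abs_of_nonneg (hs.trans h)]
      exact Real.rpow_le_rpow hs h hq.le
    have : s ^ q * t ≤ signedPow q t := mul_le_mul_of_nonneg_right h1 (hs.trans h)
    nlinarith
  · have h1 : -signedPow q τ ≤ signedPow q t := by
      rw [← signedPow_neg]
      exact monotone_signedPow hq ht
    nlinarith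

namespace MetricGraph

variable {V ι : Type*} [Fintype ι] {G : MetricGraph V ι}

theorem integrable_val (u : G.H1) (e : ι) : Integrable (val u e) (G.edgeMeasure e) :=
  (val_memLp u e).integrable one_le_two

theorem add_mem_posCone {u v : G.H1} (hu : u ∈ G.posCone) (hv : v ∈ G.posCone) :
    u + v ∈ G.posCone := fun e => by
  filter_upwards [hu e, hv e, val_add u v e] with x h1 h2 h3
  rw [h3]
  exact add_nonneg h1 h2

theorem smul_mem_posCone {u : G.H1} {c : ℝ} (hc : 0 ≤ c) (hu : u ∈ G.posCone) :
    c • u ∈ G.posCone := fun e => by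
  filter_upwards [hu e, val_smul c u e] with x h1 h2
  rw [h2]
  exact mul_nonneg hc h1

theorem segmentPoint_eq (w b : G.H1) (a : ℝ) :
    segmentPoint (E := G.H1) w b a = (1 - a) • w + a • b := rfl

theorem segmentPoint_mem_posCone : ∀ w ∈ G.posCone, ∀ b ∈ G.posCone, ∀ a : ℝ, 0 ≤ a → a ≤ 1 →
    segmentPoint (E := G.H1) w b a ∈ G.posCone := fun w hw b hb a h0 h1 => by
  rw [segmentPoint_eq]
  exact add_mem_posCone (smul_mem_posCone (sub_nonneg.2 h1) hw) (smul_mem_posCone h0 hb)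

theorem zero_mem_posCone : (0 : G.H1) ∈ G.posCone := fun e => by
  filter_upwards [Lp.coeFn_zero ℝ 2 (G.edgeMeasure e)] with x hx
  exact hx.symm.le

theorem neg_mem_negCone {u : G.H1} : -u ∈ G.negCone ↔ u ∈ G.posCone := by
  refine forall_congr' fun e => ?_
  refine ⟨fun h => ?_, fun h => ?_⟩ <;> filter_upwards [h, val_neg u e] with x h1 h2
  · rw [h2] at h1; linarith
  · rw [h2]; linarith

theorem negCone_eq : G.negCone = -G.posCone := by
  ext u
  rw [Set.mem_neg, ← neg_mem_negCone, neg_neg]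

theorem segmentPoint_mem_negCone : ∀ w ∈ G.negCone, ∀ b ∈ G.negCone, ∀ a : ℝ, 0 ≤ a → a ≤ 1 →
    segmentPoint (E := G.H1) w b a ∈ G.negCone := fun w hw b hb a h0 h1 => by
  rw [negCone_eq, Set.mem_neg] at *
  have h := segmentPoint_mem_posCone _ hw _ hb a h0 h1
  rw [segmentPoint_eq, smul_neg, smul_neg, ← neg_add] at h
  exact h

theorem infDist_neg_posCone (u : G.H1) :
    Metric.infDist (-u) G.posCone = Metric.infDist u G.negCone := by
  have h := Metric.infDist_image (isometry_neg (G := G.H1)) (x := u) (t := G.negCone)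
  rwa [image_neg_eq_neg, negCone_eq, neg_neg, ← negCone_eq] at h

theorem mass_neg (u : G.H1) : mass (-u) = mass u := by
  rw [mass_eq, mass_eq, map_neg, norm_neg]

theorem kinetic_neg (u : G.H1) : kinetic (-u) = kinetic u := by
  rw [kinetic_eq, kinetic_eq, map_neg, norm_neg]

theorem nonlin_neg {p : ℝ} (hp : 2 < p) (u : G.H1) : nonlin p (-u) = -nonlin p u := by
  ext e : 1
  refine Lp.ext ?_
  filter_upwards [nonlin_ae hp (-u) e, nonlin_ae hp u e, val_neg u e,
    Lp.coeFn_neg (nonlin p u e)] with x h1 h2 h3 h4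
  refine h1.trans (Eq.trans ?_ h4.symm)
  rw [Pi.neg_apply, h2, h3, signedPow_neg]

theorem powInt_neg {p : ℝ} (hp : 2 < p) (u : G.H1) : powInt p (-u) = powInt p u := by
  rw [← inner_nonlin_self hp, ← inner_nonlin_self hp, nonlin_neg hp, map_neg, inner_neg_neg]

theorem energy_neg {p : ℝ} (hp : 2 < p) (u : G.H1) : energy p (-u) = energy p u := by
  rw [energy, energy, kinetic_neg, powInt_neg hp]

theorem existsUnique_isMuTilde [Nonempty ι] {p K : ℝ} (hp : 6 < p) (hK : 0 < K) :
    ∃ μt : ℝ, G.IsMuTilde p K μt ∧ ∀ m : ℝ, G.IsMuTilde p K m → m = μt := by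
  have hl := G.totalLength_pos
  set a := p * K * (2 / ((p - 2) * K)) ^ ((p - 2) / (p - 6)) with ha
  set b := p * G.totalLength ^ ((2 - p) / 2) with hb
  have hp2 : 0 < p - 2 := by linarith
  have hp0 : 0 < p := by linarith
  have ha0 : 0 < a := by positivity
  have hb0 : 0 < b := by positivity
  set f : ℝ → ℝ := fun m => a * m ^ ((p - 2) / 4) + b * m ^ ((p - 2) / 2) with hf
  have hmono : StrictMonoOn f (Ici 0) := fun x hx y hy hxy =>
    add_lt_add (mul_lt_mul_of_pos_left (Real.rpow_lt_rpow hx hxy (by linarith)) ha0)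
      (mul_lt_mul_of_pos_left (Real.rpow_lt_rpow hx hxy (by linarith)) hb0)
  have hcont : Continuous f :=
    (continuous_const.mul (Real.continuous_rpow_const (by linarith))).add
      (continuous_const.mul (Real.continuous_rpow_const (by linarith)))
  have hf0 : f 0 = 0 := by
    simp only [hf]
    rw [Real.zero_rpow (by linarith), Real.zero_rpow (by linarith)]
    ring
  obtain ⟨N, hN0, hN⟩ : ∃ N : ℝ, 0 ≤ N ∧ 1 ≤ f N := by
    -- At this point the first of the two terms alone equals 1.
    refine ⟨(1 / a) ^ (4 / (p - 2)), by positivity, ?_⟩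
    simp only [hf]
    rw [← Real.rpow_mul (by positivity), div_mul_div_cancel₀' (by norm_num : (4:ℝ) ≠ 0),
      div_self hp2.ne', Real.rpow_one, mul_one_div_cancel ha0.ne']
    have : 0 ≤ b * ((1 / a) ^ (4 / (p - 2))) ^ ((p - 2) / 2) := by positivity
    linarith
  obtain ⟨m, hm, hfm⟩ := intermediate_value_Icc hN0 hcont.continuousOn
    ⟨hf0.le.trans zero_le_one, hN⟩
  have hm0 : 0 < m := by
    refine hm.1.lt_of_ne fun h => ?_
    rw [← h, hf0] at hfm
    exact zero_ne_one hfm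
  exact ⟨m, ⟨hm0, hfm⟩, fun m' h' => hmono.injOn h'.1.le hm0.le (h'.2.trans hfm.symm)⟩

variable [Finite V] [Nonempty ι]

theorem constrGrad_neg {p : ℝ} (hp : 2 < p) (u : G.H1) : constrGrad p (-u) = -constrGrad p u := by
  have h1 : energyGrad p (-u) = -energyGrad p u := by
    rw [energyGrad, energyGrad, nonlin_neg hp, map_neg, ← neg_add, map_neg, neg_sub,
      sub_neg_eq_add, neg_add_eq_sub]
  have h2 : massGrad (-u) = -massGrad u := by
    rw [massGrad, massGrad, map_neg, map_neg]
  rw [constrGrad_eq hp, constrGrad_eq hp, h1, h2, tangentProj_neg (E := G.H1)]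

/-- The resolvent is Markovian, so it decreases this duality pairing. -/
theorem inner_nonlin_massGrad_le {p : ℝ} (hp : 2 < p) (u : G.H1) :
    inner ℝ (nonlin p u) (G.toL2 (massGrad u)) ≤ powInt p u := by
  set w := massGrad u with hw
  obtain ⟨M, hM, hwM⟩ := rep_bounded w
  have hs : ∀ e, ∀ x ∈ Icc 0 (G.len e), rep w e x ∈ Icc (-M) M := fun e x hx => abs_le.1 (hwM e x hx)
  -- With g(t) = |t|^(p-2) t, testing the equation of w = Ru with g(w) gives ∫ u g(w) ≥ ∫ w g(w),
  -- because ∫ w' (g(w))' ≥ 0.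
  obtain ⟨φ, h1, -, h3⟩ := exists_lipschitzOn_comp w
    (lipschitzOnWith_signedPow (q := p - 2) (by linarith) hM.le) hs
  have hφ : G.toL2 φ = nonlin p w := by
    ext e : 1
    refine Lp.ext ?_
    filter_upwards [h1 e, nonlin_ae hp w e] with x hx1 hx2
    rw [toL2_apply, hx1, hx2]
  have e1 := inner_massGrad u φ
  rw [← hw, pairing_eq, H1_inner_eq, hφ] at e1
  have e2 : 0 ≤ inner ℝ (G.derL2 w) (G.derL2 φ) := L2_inner_nonneg fun e => by
    filter_upwards [h3 e, rep_hasDerivAt w e, eventually_rep_mem hs e] with x hx1 hx2 hx3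
    exact mul_nonneg_of_monotoneOn_comp ((monotone_signedPow (by linarith)).monotoneOn _) hx3
      hx2 hx1
  -- Monotonicity of g: ∫ g(u) w ≤ ∫ g(u) u - ∫ g(w) u + ∫ g(w) w, where the last two terms together
  -- are at most 0.
  have e3 : 0 ≤ inner ℝ (nonlin p u - nonlin p w) (G.toL2 u - G.toL2 w) := L2_inner_nonneg fun e => by
    filter_upwards [nonlin_ae hp u e, nonlin_ae hp w e, Lp.coeFn_sub (nonlin p u e) (nonlin p w e),
      Lp.coeFn_sub (G.toL2 u e) (G.toL2 w e)] with x hx1 hx2 hx3 hx4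
    have y1 : ((nonlin p u - nonlin p w) e : ℝ → ℝ) x
        = signedPow (p - 2) (val u e x) - signedPow (p - 2) (val w e x) := by
      refine hx3.trans ?_
      rw [Pi.sub_apply, hx1, hx2]
    have y2 : ((G.toL2 u - G.toL2 w) e : ℝ → ℝ) x = val u e x - val w e x := hx4
    rw [y1, y2]
    have hmono := monotone_signedPow (q := p - 2) (by linarith)
    rcases le_total (val u e x) (val w e x) with h | h
    · exact mul_nonneg_of_nonpos_of_nonpos (sub_nonpos.2 (hmono h)) (sub_nonpos.2 h)
    · exact mul_nonneg (sub_nonneg.2 (hmono h)) (sub_nonneg.2 h)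
  rw [inner_sub_left, inner_sub_right, inner_sub_right, inner_nonlin_self hp,
    real_inner_comm (G.toL2 u) (nonlin p w), real_inner_comm (G.toL2 w) (nonlin p w)] at e3
  linarith

/-- Up to the identity, the constrained gradient maps into the positive cone. -/
theorem exists_constrGrad_eq_sub {p : ℝ} (hp : 2 < p) {u : G.H1} (hu : mass u ≠ 0)
    (hpow : powInt p u ≤ mass u) (h1 : massGrad u ∈ G.posCone)
    (h2 : G.resolvent (nonlin p u) ∈ G.posCone) :
    ∃ b ∈ G.posCone, constrGrad p u = u - b := by
  have h3 : inner ℝ (G.resolvent (nonlin p u)) (massGrad u) ≤ inner ℝ u (massGrad u) := by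
    rw [inner_resolvent, real_inner_comm (massGrad u) u, inner_massGrad_self]
    exact (inner_nonlin_massGrad_le hp u).trans hpow
  obtain ⟨b, hb, h4⟩ := exists_tangentProj_sub_eq (E := G.H1) (massGrad_ne_zero hu) h3
  refine ⟨_, add_mem_posCone h2 (smul_mem_posCone hb h1), ?_⟩
  rw [constrGrad_eq hp, energyGrad, map_add]
  exact h4

variable (G) in
-- Closeness to the cone in H¹ bounds the negative part uniformly, by the sup embedding. The mass μ
-- and the sup bound M force a mean of order μ/M. So the mean criterion for the resolvent applies
-- both to u and to |u|^(p-2) u.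
theorem exists_resolvent_mem_posCone_of_near {p μ R : ℝ} (hp : 2 < p) (hμ : 0 < μ) :
    ∃ ν : ℝ, 0 < ν ∧ ∀ u : G.H1, mass u = μ → kinetic u ≤ R → Metric.infDist u G.posCone < ν →
      massGrad u ∈ G.posCone ∧ G.resolvent (nonlin p u) ∈ G.posCone := by
  obtain ⟨A, hA, hrep⟩ := G.exists_abs_rep_le
  obtain ⟨κ, hκ, hres⟩ := G.exists_resolvent_mem_posCone_of_integral_ge
  have hl := G.totalLength_pos
  set ℓ := G.totalLength with hℓ
  set M := A * Real.sqrt (μ + |R|) with hMdef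
  have hM : 0 < M := by
    have : 0 < μ + |R| := by positivity
    positivity
  -- Chosen so that s ℓ = μ/(4M). The integral of u will be at least μ/(2M), so that of u - s is at
  -- least μ/(4M).
  set s := μ / (4 * M * ℓ) with hs
  have hs0 : 0 < s := by positivity
  set c := s ^ (p - 2) * (μ / (4 * M)) with hc
  have hc0 : 0 < c := by positivity
  -- The second entry serves the criterion for u, the third the one for the nonlinearity; τ ≤ 1
  -- gives τ^(p-1) ≤ τ.
  set τ := min 1 (min (μ / M / (κ + 4 * ℓ)) (c / (κ + ℓ))) with hτ
  have hτ0 : 0 < τ := by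
    refine lt_min one_pos (lt_min ?_ ?_) <;> positivity
  have hτ1 : τ ≤ 1 := min_le_left _ _
  have hτ2 : τ * (κ + 4 * ℓ) ≤ μ / M :=
    (le_div_iff₀ (by positivity)).1 ((min_le_right _ _).trans (min_le_left _ _))
  have hτ3 : τ * (κ + ℓ) ≤ c :=
    (le_div_iff₀ (by positivity)).1 ((min_le_right _ _).trans (min_le_right _ _))
  refine ⟨τ / A, by positivity, fun u hu hk hd => ?_⟩
  obtain ⟨v, hv, huv⟩ := (Metric.infDist_lt_iff ⟨0, zero_mem_posCone⟩).1 hd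
  have hlow : ∀ e, ∀ᵐ x ∂(G.edgeMeasure e), -τ ≤ val u e x := fun e => by
    rw [dist_eq_norm, lt_div_iff₀' hA] at huv
    filter_upwards [hv e, val_sub u v e, val_ae_eq_rep (u - v) e,
      ae_restrict_mem measurableSet_Ioo] with x h1 h2 h3 h4
    have h5 := (abs_le.1 (hrep (u - v) e x (Ioo_subset_Icc_self h4))).1
    rw [← h3, h2] at h5
    linarith
  have hup : ∀ e, ∀ᵐ x ∂(G.edgeMeasure e), |val u e x| ≤ M := fun e => by
    filter_upwards [val_ae_eq_rep u e, ae_restrict_mem measurableSet_Ioo] with x h3 h4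
    rw [h3]
    refine (hrep u e x (Ioo_subset_Icc_self h4)).trans (mul_le_mul_of_nonneg_left ?_ hA.le)
    refine Real.le_sqrt_of_sq_le ?_
    rw [norm_sq_eq, hu]
    linarith [le_abs_self R]
  have hiu := fun e => integrable_val u e
  have hint : μ / M - 2 * τ * ℓ ≤ ∑ e, ∫ x in Ioo 0 (G.len e), val u e x := by
    -- Pointwise u² ≤ M |u|, and |u| ≤ u + 2τ because u ≥ -τ.
    have h1 : mass u ≤ ∑ e, ∫ x in Ioo 0 (G.len e), (M * val u e x + 2 * M * τ) := by
      refine Finset.sum_le_sum fun e _ => ?_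
      refine integral_mono_ae (L2_integrable_sq (G.toL2 u) e)
        (((hiu e).const_mul M).add (integrable_const _)) ?_
      filter_upwards [hlow e, hup e] with x h1 h2
      rcases le_total 0 (val u e x) with h | h
      · rw [abs_of_nonneg h] at h2 ⊢
        nlinarith
      · rw [abs_of_nonpos h] at h2 ⊢
        nlinarith
    have h2 : ∑ e, ∫ x in Ioo 0 (G.len e), (M * val u e x + 2 * M * τ)
        = M * (∑ e, ∫ x in Ioo 0 (G.len e), val u e x) + 2 * M * τ * ℓ := by
      rw [Finset.mul_sum, hℓ, totalLength, Finset.mul_sum, ← Finset.sum_add_distrib]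
      refine Finset.sum_congr rfl fun e _ => ?_
      refine (integral_add ((hiu e).const_mul M) (integrable_const _)).trans ?_
      rw [integral_const_mul, integral_const, smul_eq_mul]
      rw [edgeMeasure_real_univ, mul_comm (G.len e)]
      rfl
    rw [h2, hu] at h1
    rw [sub_le_iff_le_add, div_le_iff₀ hM]
    linarith
  refine ⟨hres _ τ hτ0.le hlow ?_, ?_⟩
  · have e1 : ∑ e, ∫ x in Ioo 0 (G.len e), (G.toL2 u e : ℝ → ℝ) x
        = ∑ e, ∫ x in Ioo 0 (G.len e), val u e x := rfl
    rw [e1]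
    nlinarith
  have hq : 0 < p - 2 := by linarith
  have hτ'0 : 0 ≤ signedPow (p - 2) τ := mul_nonneg (by positivity) hτ0.le
  have hτ' : signedPow (p - 2) τ ≤ τ := by
    refine mul_le_of_le_one_left hτ0.le ?_
    rw [abs_of_pos hτ0]
    exact Real.rpow_le_one hτ0.le hτ1 hq.le
  refine hres _ (signedPow (p - 2) τ) hτ'0 (fun e => ?_) ?_
  · filter_upwards [nonlin_ae hp u e, hlow e] with x h1 h2
    rw [h1, ← signedPow_neg]
    exact monotone_signedPow hq h2
  have h5 : ∑ e, ∫ x in Ioo 0 (G.len e), (s ^ (p - 2) * (val u e x - s) - signedPow (p - 2) τ)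
      ≤ ∑ e, ∫ x in Ioo 0 (G.len e), (nonlin p u e : ℝ → ℝ) x := by
    refine Finset.sum_le_sum fun e _ => ?_
    refine integral_mono_ae ((((hiu e).sub (integrable_const _)).const_mul _).sub
      (integrable_const _)) ((Lp.memLp (nonlin p u e)).integrable one_le_two) ?_
    filter_upwards [nonlin_ae hp u e, hlow e] with x h1 h2
    rw [h1]
    exact signedPow_lower_bound hq hs0.le h2 hτ0.le
  have h6 : ∑ e, ∫ x in Ioo 0 (G.len e), (s ^ (p - 2) * (val u e x - s) - signedPow (p - 2) τ)
      = s ^ (p - 2) * (∑ e, (∫ x in Ioo 0 (G.len e), val u e x) - s * ℓ)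
        - signedPow (p - 2) τ * ℓ := by
    rw [hℓ, totalLength, Finset.mul_sum, Finset.mul_sum, ← Finset.sum_sub_distrib, Finset.mul_sum,
      ← Finset.sum_sub_distrib]
    refine Finset.sum_congr rfl fun e _ => ?_
    refine (integral_sub (((hiu e).sub (integrable_const _)).const_mul _)
      (integrable_const _)).trans ?_
    rw [integral_const_mul]
    refine congrArg₂ _ (congrArg _ ((integral_sub (hiu e) (integrable_const _)).trans ?_)) ?_
    · rw [integral_const, smul_eq_mul, edgeMeasure_real_univ, mul_comm (G.len e)]
      rfl
    · rw [integral_const, smul_eq_mul, edgeMeasure_real_univ, mul_comm (G.len e)]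
  rw [h6] at h5
  refine le_trans ?_ h5
  have hsℓ : s * ℓ = μ / (4 * M) := by
    rw [hs]; field_simp
  have h7 : μ / (4 * M) ≤ ∑ e, (∫ x in Ioo 0 (G.len e), val u e x) - s * ℓ := by
    rw [hsℓ]
    have : μ / M = 4 * (μ / (4 * M)) := by field_simp
    nlinarith
  have h8 : c ≤ s ^ (p - 2) * (∑ e, (∫ x in Ioo 0 (G.len e), val u e x) - s * ℓ) :=
    mul_le_mul_of_nonneg_left h7 (by positivity)
  nlinarith

omit [Finite V] in
-- Since ρ* ≤ b, the Gagliardo-Nirenberg bound is at most μ times the left side of the equation for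
-- μ̃ evaluated at μ. That left side is increasing and equals 1 at μ̃.
theorem powInt_le_mass_of_kinetic_lt {p K μ μt : ℝ} (hp : 6 < p) (hK : G.IsGNConst p K)
    (hμt : G.IsMuTilde p K μt) (hμ : 0 < μ) (hle : μ ≤ μt) {u : G.H1} (hu : mass u = μ)
    (hk : kinetic u < rhoStar p K μ) : powInt p u ≤ mass u := by
  have hl := G.totalLength_pos
  have hK0 := hK.1
  refine (hK.2 u).trans ?_
  rw [hu]
  set a := 2 / ((p - 2) * K) with ha
  have ha0 : 0 < a := by
    have : 0 < p - 2 := by linarith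
    positivity
  have h1 : kinetic u ^ ((p - 2) / 4) ≤ a ^ ((p - 2) / (p - 6)) := by
    have h2 : kinetic u ≤ a ^ (4 / (p - 6)) := hk.le.trans (min_le_left _ _)
    refine (Real.rpow_le_rpow (kinetic_nonneg u) h2 (by linarith)).trans_eq ?_
    rw [← Real.rpow_mul ha0.le]
    congr 1
    have : p - 6 ≠ 0 := by linarith
    field_simp
  have e1 : μ ^ ((p + 2) / 4) = μ * μ ^ ((p - 2) / 4) := by
    rw [← Real.rpow_one_add' hμ.le (by linarith)]
    congr 1
    ring
  have e2 : μ ^ (p / 2) = μ * μ ^ ((p - 2) / 2) := by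
    rw [← Real.rpow_one_add' hμ.le (by linarith)]
    congr 1
    ring
  have h3 : μ ^ ((p - 2) / 4) ≤ μt ^ ((p - 2) / 4) := Real.rpow_le_rpow hμ.le hle (by linarith)
  have h4 : μ ^ ((p - 2) / 2) ≤ μt ^ ((p - 2) / 2) := Real.rpow_le_rpow hμ.le hle (by linarith)
  have hp0 : 0 < p := by linarith
  have hk0 := kinetic_nonneg u
  have hμt0 := hμt.1
  rw [e1, e2]
  calc p * K * (μ * μ ^ ((p - 2) / 4)) * kinetic u ^ ((p - 2) / 4)
        + p * G.totalLength ^ ((2 - p) / 2) * (μ * μ ^ ((p - 2) / 2))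
      ≤ p * K * (μ * μt ^ ((p - 2) / 4)) * a ^ ((p - 2) / (p - 6))
        + p * G.totalLength ^ ((2 - p) / 2) * (μ * μt ^ ((p - 2) / 2)) := by gcongr
    _ = μ * (p * K * a ^ ((p - 2) / (p - 6)) * μt ^ ((p - 2) / 4)
        + p * G.totalLength ^ ((2 - p) / 2) * μt ^ ((p - 2) / 2)) := by ring
    _ = μ := by rw [hμt.2, mul_one]

omit [Finite V] [Nonempty ι] in
-- The level M₂ is precisely the lower bound that Gagliardo-Nirenberg gives for the energy where the
-- kinetic term is ρ*; it acts as a barrier.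
theorem M2_le_energy {p K μ : ℝ} (hp : 6 < p) (hK : G.IsGNConst p K) {u : G.H1} (hu : mass u = μ)
    (hk : kinetic u = rhoStar p K μ) : G.M2 p K μ ≤ energy p u := by
  have h := hK.2 u
  rw [hu, hk] at h
  rw [M2, energy, hk, one_div_mul_eq_div p]
  have h2 : powInt p u / p ≤ K * μ ^ ((p + 2) / 4) * rhoStar p K μ ^ ((p - 2) / 4)
      + G.totalLength ^ ((2 - p) / 2) * μ ^ (p / 2) := by
    rw [div_le_iff₀ (by linarith)]
    linarith
  linarith

end MetricGraph

/-! ### The energy takes every real value on the mass constraint -/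

theorem setIntegral_Ioo_of_comp_mul {L θ s : ℝ} (hθ : 0 < θ) (hs : 0 ≤ s) (hsL : s ≤ θ * L)
    {F H : ℝ → ℝ} (h1 : ∀ x ∈ Ioo 0 (s / θ), F x = H (θ * x)) (h2 : ∀ x ∈ Ioo (s / θ) L, F x = 0) :
    ∫ x in Ioo 0 L, F x = θ⁻¹ * ∫ y in (0 : ℝ)..s, H y := by
  have hsub : Ioo 0 (s / θ) ⊆ Ioo 0 L := Ioo_subset_Ioo_right ((div_le_iff₀' hθ).2 hsL)
  have hs' : 0 ≤ s / θ := by positivity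
  have e1 : ∫ x in Ioo 0 L, F x = ∫ x in Ioo 0 (s / θ), F x := by
    refine (setIntegral_eq_of_subset_of_ae_sdiff_eq_zero measurableSet_Ioo.nullMeasurableSet
      hsub ?_)
    have : ∀ᵐ x : ℝ, x ≠ s / θ := by
      simp [ae_iff]
    filter_upwards [this] with x hx hx'
    refine h2 x ⟨lt_of_le_of_ne (not_lt.1 fun h => hx'.2 ⟨hx'.1.1, h⟩) hx.symm, hx'.1.2⟩
  rw [e1, setIntegral_congr_fun measurableSet_Ioo h1, setIntegral_Ioo_eq_intervalIntegral hs',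
    intervalIntegral.integral_comp_mul_left H hθ.ne', mul_zero, mul_div_cancel₀ _ hθ.ne', smul_eq_mul]

theorem lipschitzWith_sin_min {θ s : ℝ} (hθ : 0 < θ) :
    LipschitzWith (Real.toNNReal θ) fun x : ℝ => Real.sin (min (θ * x) s) := by
  have h1 : LipschitzWith (Real.toNNReal θ) fun x : ℝ => θ * x :=
    LipschitzWith.of_dist_le_mul fun x y => by
      rw [Real.dist_eq, Real.dist_eq, ← mul_sub, abs_mul, abs_of_pos hθ, Real.coe_toNNReal _ hθ.le]
  have h2 : LipschitzWith 1 Real.sin := by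
    refine lipschitzWith_of_nnnorm_deriv_le Real.differentiable_sin fun x => ?_
    rw [Real.deriv_sin, ← NNReal.coe_le_coe]
    exact Real.abs_cos_le_one x
  have h3 := h2.comp (h1.min_const s)
  rwa [one_mul] at h3

/-- Intermediate values along the segment from v to w, normalized radially. The segment meets the
kernel of A only if v = -w, and then evenness gives f v = f w = c. -/
theorem exists_sphere_eq_of_le {E F : Type*} [NormedAddCommGroup E] [NormedSpace ℝ E]
    [NormedAddCommGroup F] [NormedSpace ℝ F] (A : E →L[ℝ] F) (hA : Function.Injective A) {r c : ℝ}
    (hr : 0 < r) {f : E → ℝ} (hf : Continuous f) (hneg : ∀ x, f (-x) = f x) {v w : E}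
    (hv : ‖A v‖ = r) (hw : ‖A w‖ = r) (h1 : f v ≤ c) (h2 : c ≤ f w) : ∃ z, ‖A z‖ = r ∧ f z = c := by
  set γ : ℝ → E := fun t => v + t • (w - v) with hγ
  have hγc : Continuous γ := by fun_prop
  by_cases h : ∀ t ∈ Icc (0 : ℝ) 1, ‖A (γ t)‖ ≠ 0
  · set Γ : ℝ → E := fun t => (r / ‖A (γ t)‖) • γ t with hΓ
    have hΓA : ∀ t ∈ Icc (0 : ℝ) 1, ‖A (Γ t)‖ = r := fun t ht => by
      rw [hΓ, map_smul, norm_smul, norm_div, norm_norm, Real.norm_of_nonneg hr.le,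
        div_mul_cancel₀ _ (h t ht)]
    have hΓc : ContinuousOn Γ (Icc 0 1) :=
      (continuousOn_const.div (A.continuous.comp hγc).norm.continuousOn h).smul hγc.continuousOn
    have e0 : Γ 0 = v := by simp [hΓ, hγ, hv, hr.ne']
    have e1 : Γ 1 = w := by simp [hΓ, hγ, hw, hr.ne']
    obtain ⟨t, ht, htc⟩ := intermediate_value_Icc zero_le_one (hf.comp_continuousOn hΓc)
      (show c ∈ Icc (f (Γ 0)) (f (Γ 1)) by rw [e0, e1]; exact ⟨h1, h2⟩)
    exact ⟨Γ t, hΓA t ht, htc⟩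
  · push Not at h
    obtain ⟨t, ht, h0⟩ := h
    have h3 : A ((1 - t) • v) = A (-(t • w)) := by
      rw [← sub_eq_zero, ← map_sub, ← norm_eq_zero, ← h0]
      congr 2
      rw [hγ]
      module
    have h4 := congrArg norm h3
    rw [map_neg, norm_neg, map_smul, map_smul, norm_smul, norm_smul, hv, hw,
      Real.norm_of_nonneg ht.1, Real.norm_of_nonneg (sub_nonneg.2 ht.2)] at h4
    have ht2 : t = 1 / 2 := by
      have := mul_right_cancel₀ hr.ne' h4
      linarith
    have h5 : v = -w := by
      have h6 := hA h3
      rw [ht2, ← smul_neg] at h6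
      rw [show (1 - 1 / 2 : ℝ) = 1 / 2 by norm_num] at h6
      exact smul_right_injective E (by norm_num : (1 / 2 : ℝ) ≠ 0) h6
    refine ⟨v, hv, le_antisymm h1 ?_⟩
    rwa [h5, hneg]

namespace MetricGraph

variable {V ι : Type*} [Fintype ι] {G : MetricGraph V ι}

theorem toL2_injective : Function.Injective G.toL2 := fun u v h => by
  refine sub_eq_zero.1 (eq_zero_of_mass_eq_zero ?_)
  rw [mass_eq, map_sub, h, sub_self, norm_zero]
  norm_num

theorem mass_smul (c : ℝ) (u : G.H1) : mass (c • u) = c ^ 2 * mass u := by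
  rw [mass, mass, Finset.mul_sum]
  refine Finset.sum_congr rfl fun e _ => ?_
  rw [← integral_const_mul]
  refine integral_congr_ae ?_
  filter_upwards [val_smul c u e] with x hx
  rw [hx, abs_mul, mul_pow, sq_abs]

theorem kinetic_smul (c : ℝ) (u : G.H1) : kinetic (c • u) = c ^ 2 * kinetic u := by
  rw [kinetic, kinetic, Finset.mul_sum]
  refine Finset.sum_congr rfl fun e _ => ?_
  rw [← integral_const_mul]
  refine integral_congr_ae ?_
  have h : der (c • u) e =ᵐ[G.edgeMeasure e] fun x => c * der u e x :=
    Lp.coeFn_smul c (u.1.snd e)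
  filter_upwards [h] with x hx
  rw [hx, abs_mul, mul_pow, sq_abs]

theorem powInt_smul (p c : ℝ) (u : G.H1) : powInt p (c • u) = |c| ^ p * powInt p u := by
  rw [powInt, powInt, Finset.mul_sum]
  refine Finset.sum_congr rfl fun e _ => ?_
  rw [← integral_const_mul]
  refine integral_congr_ae ?_
  filter_upwards [val_smul c u e] with x hx
  rw [hx, abs_mul, Real.mul_rpow (abs_nonneg _) (abs_nonneg _)]

/-- Rescaling a function onto the mass constraint. -/
theorem exists_mem_massSphere {p μ : ℝ} (hμ : 0 < μ) {u : G.H1} (hu : 0 < mass u) :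
    ∃ w ∈ G.massSphere μ, energy p w =
      1 / 2 * (μ / mass u * kinetic u) - 1 / p * ((μ / mass u) ^ (p / 2) * powInt p u) := by
  have h0 : 0 < μ / mass u := by positivity
  refine ⟨Real.sqrt (μ / mass u) • u, ?_, ?_⟩
  · change mass _ = μ
    rw [mass_smul, Real.sq_sqrt h0.le, div_mul_cancel₀ _ hu.ne']
  · rw [energy, kinetic_smul, powInt_smul, Real.sq_sqrt h0.le, abs_of_nonneg (Real.sqrt_nonneg _),
      Real.sqrt_eq_rpow, ← Real.rpow_mul h0.le, one_div_mul_eq_div 2 p]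

variable (G) in
/-- Sine waves supported on an initial piece of an edge. -/
theorem exists_sine_wave (i : ι) {k n : ℕ} (hk : 0 < k) (hkn : k ≤ n) {θ : ℝ}
    (hθ : θ = n * Real.pi / G.len i) :
    ∃ u : G.H1, mass u = θ⁻¹ * (k * Real.pi / 2) ∧ kinetic u = θ * (k * Real.pi / 2) ∧
      ∀ p : ℝ, 0 < p → powInt p u = θ⁻¹ * ∫ y in (0 : ℝ)..k * Real.pi, |Real.sin y| ^ p := by
  classical
  have hL := G.len_pos i
  have hn : 0 < (n : ℝ) := by exact_mod_cast hk.trans_le hkn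
  have hθ0 : 0 < θ := by
    have := Real.pi_pos
    rw [hθ]; positivity
  set s : ℝ := k * Real.pi with hs
  have hs0 : 0 ≤ s := by have := Real.pi_pos; positivity
  have hθL : θ * G.len i = n * Real.pi := by rw [hθ]; field_simp
  have hsL : s ≤ θ * G.len i := by
    rw [hθL, hs]
    have : (k : ℝ) ≤ n := by exact_mod_cast hkn
    exact mul_le_mul_of_nonneg_right this Real.pi_pos.le
  have hsin : Real.sin s = 0 := Real.sin_nat_mul_pi k
  set f : ℝ → ℝ := fun x => Real.sin (min (θ * x) s) with hf
  have hfl : LipschitzWith (Real.toNNReal θ) f := lipschitzWith_sin_min hθ0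
  have f1 : ∀ x ∈ Ioo 0 (s / θ), f x = Real.sin (θ * x) := fun x hx => by
    rw [hf]
    simp only
    rw [min_eq_left ((lt_div_iff₀' hθ0).1 hx.2).le]
  have f2 : ∀ x ∈ Ioi (s / θ), f x = 0 := fun x hx => by
    rw [hf]
    simp only
    rw [min_eq_right ((div_lt_iff₀' hθ0).1 hx).le, hsin]
  have d1 : ∀ x ∈ Ioo 0 (s / θ), deriv f x = θ * Real.cos (θ * x) := fun x hx => by
    have h1 : f =ᶠ[nhds x] fun x => Real.sin (θ * x) :=
      Filter.eventually_of_mem (isOpen_Ioo.mem_nhds hx) f1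
    rw [h1.deriv_eq]
    have h2 : HasDerivAt (fun x : ℝ => Real.sin (θ * x)) (Real.cos (θ * x) * (θ * 1)) x :=
      ((hasDerivAt_id x).const_mul θ).sin
    rw [h2.deriv]
    ring
  have d2 : ∀ x ∈ Ioi (s / θ), deriv f x = 0 := fun x hx => by
    have h1 : f =ᶠ[nhds x] fun _ => 0 := Filter.eventually_of_mem (isOpen_Ioi.mem_nhds hx) f2
    rw [h1.deriv_eq, deriv_const]
  set φ : ι → ℝ → ℝ := fun e => if e = i then f else fun _ => 0 with hφ
  have hφi : φ i = f := if_pos rfl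
  have hφe : ∀ e, e ≠ i → φ e = fun _ => 0 := fun e he => if_neg he
  have hφl : ∀ e, LipschitzWith (Real.toNNReal θ) (φ e) := fun e => by
    by_cases he : e = i
    · rw [he, hφi]; exact hfl
    · rw [hφe e he]; exact LipschitzWith.const' 0
  obtain ⟨u, hu⟩ := G.exists_of_rep φ (fun _ => 0)
    (fun e => ((hφl e).lipschitzOnWith).absolutelyContinuousOnInterval)
    (fun e => by
      by_cases he : e = i
      · rw [he, hφi, hf]
        simp [min_eq_left hs0]
      · rw [hφe e he])
    (fun e => by
      by_cases he : e = i
      · rw [he, hφi, hf]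
        simp only
        rw [min_eq_right hsL, hsin]
      · rw [hφe e he])
    (fun e => MemLp.of_bound (measurable_deriv _).aestronglyMeasurable _
      (Filter.Eventually.of_forall fun x => norm_deriv_le_of_lipschitz (hφl e)))
  have key : ∀ (F : ℝ → ℝ), F 0 = 0 → (∀ e, ∫ x in Ioo 0 (G.len e), F (val u e x)
      = if e = i then ∫ x in Ioo 0 (G.len i), F (f x) else 0) ∧
      ∀ e, ∫ x in Ioo 0 (G.len e), F (der u e x)
      = if e = i then ∫ x in Ioo 0 (G.len i), F (deriv f x) else 0 := by
    intro F hF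
    constructor <;> intro e <;> split_ifs with he
    · subst he
      refine integral_congr_ae ?_
      filter_upwards [(hu e).1] with x hx
      rw [hx, hφi]
    · refine integral_eq_zero_of_ae ?_
      filter_upwards [(hu e).1] with x hx
      rw [hx, hφe e he, hF]; rfl
    · subst he
      refine integral_congr_ae ?_
      filter_upwards [(hu e).2.1] with x hx
      rw [hx, hφi]
    · refine integral_eq_zero_of_ae ?_
      filter_upwards [(hu e).2.1] with x hx
      rw [hx, hφe e he, deriv_const, hF]; rfl
  refine ⟨u, ?_, ?_, fun p hp => ?_⟩
  · rw [mass, Finset.sum_congr rfl fun e _ => (key (fun t => |t| ^ 2) (by simp)).1 e,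
      Finset.sum_ite_eq' Finset.univ i, if_pos (Finset.mem_univ _),
      setIntegral_Ioo_of_comp_mul (H := fun y => Real.sin y ^ 2) hθ0 hs0 hsL
        (fun x hx => by rw [f1 x hx, sq_abs]) (fun x hx => by rw [f2 x hx.1]; simp),
      integral_sin_sq, hsin]
    simp
  · rw [kinetic, Finset.sum_congr rfl fun e _ => (key (fun t => |t| ^ 2) (by simp)).2 e,
      Finset.sum_ite_eq' Finset.univ i, if_pos (Finset.mem_univ _),
      setIntegral_Ioo_of_comp_mul (H := fun y => θ ^ 2 * Real.cos y ^ 2) hθ0 hs0 hsL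
        (fun x hx => by rw [d1 x hx, sq_abs]; ring) (fun x hx => by rw [d2 x hx.1]; simp),
      intervalIntegral.integral_const_mul, integral_cos_sq, hsin]
    simp
    field_simp
  · rw [powInt, Finset.sum_congr rfl fun e _ => (key (fun t => |t| ^ p)
        (by simp [Real.zero_rpow hp.ne'])).1 e,
      Finset.sum_ite_eq' Finset.univ i, if_pos (Finset.mem_univ _),
      setIntegral_Ioo_of_comp_mul (H := fun y => |Real.sin y| ^ p) hθ0 hs0 hsL
        (fun x hx => by rw [f1 x hx])
        (fun x hx => by rw [f2 x hx.1, abs_zero, Real.zero_rpow hp.ne'])]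

variable [Nonempty ι]

variable (G) in
-- A sine wave with n half-periods filling a whole edge: after normalization the kinetic term grows
-- like n² while the power term stays bounded.
theorem exists_le_energy {p μ : ℝ} (hp : 6 < p) (hμ : 0 < μ) (c : ℝ) :
    ∃ w ∈ G.massSphere μ, c ≤ energy p w := by
  obtain ⟨i⟩ := ‹Nonempty ι›
  have hL := G.len_pos i
  have hπ := Real.pi_pos
  set L := G.len i with hLdef
  set D := 1 / p * ((μ / (L / 2)) ^ (p / 2) * L) with hD
  obtain ⟨n, hn⟩ := exists_nat_gt (max 1 ((c + D) / (1 / 2 * μ * (Real.pi / L) ^ 2)))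
  have hn1 : (1 : ℝ) < n := (le_max_left _ _).trans_lt hn
  have hn2 := (le_max_right _ _).trans_lt hn
  rw [div_lt_iff₀ (by positivity)] at hn2
  have hn0 : 0 < n := by exact_mod_cast zero_lt_one.trans hn1
  obtain ⟨u, h1, h2, h3⟩ := G.exists_sine_wave i hn0 le_rfl rfl
  rw [← hLdef] at h1 h2 h3
  set θ := n * Real.pi / L with hθ
  have hθ0 : 0 < θ := by positivity
  have hm : mass u = L / 2 := by
    rw [h1, hθ]; field_simp
  have hk : kinetic u = θ ^ 2 * (L / 2) := by
    rw [h2, hθ]; field_simp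
  have hpow : powInt p u ≤ L := by
    rw [h3 p (by linarith)]
    have : ∫ y in (0 : ℝ)..n * Real.pi, |Real.sin y| ^ p ≤ ∫ y in (0 : ℝ)..n * Real.pi, (1 : ℝ) := by
      refine intervalIntegral.integral_mono_on (by positivity) ?_ (by simp) fun y _ =>
        Real.rpow_le_one (abs_nonneg _) (Real.abs_sin_le_one y) (by linarith)
      exact ((Real.continuous_sin.abs).rpow_const fun _ => Or.inr (by linarith)).intervalIntegrable
        _ _
    rw [intervalIntegral.integral_const, smul_eq_mul, mul_one, sub_zero] at this
    refine (mul_le_mul_of_nonneg_left this (by positivity)).trans_eq ?_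
    rw [hθ]; field_simp
  obtain ⟨w, hw, hE⟩ := exists_mem_massSphere (p := p) hμ (u := u) (by rw [hm]; positivity)
  refine ⟨w, hw, ?_⟩
  rw [hE, hm, hk]
  have hp0 : 0 < p := by linarith
  have e1 : 1 / p * ((μ / (L / 2)) ^ (p / 2) * powInt p u) ≤ D := by
    rw [hD]; gcongr
  have e2 : 1 / 2 * (μ / (L / 2) * (θ ^ 2 * (L / 2))) = n ^ 2 * (1 / 2 * μ * (Real.pi / L) ^ 2) := by
    rw [hθ]; field_simp
  rw [e2]
  have e3 : (n : ℝ) * (1 / 2 * μ * (Real.pi / L) ^ 2) ≤ n ^ 2 * (1 / 2 * μ * (Real.pi / L) ^ 2) :=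
    mul_le_mul_of_nonneg_right (by nlinarith) (by positivity)
  linarith

variable (G) in
-- A single half-wave squeezed at frequency θ has normalized energy θ² (μ/2 - B θ^(p/2 - 3)), which
-- tends to -∞ because p > 6.
theorem exists_energy_le {p μ : ℝ} (hp : 6 < p) (hμ : 0 < μ) (c : ℝ) :
    ∃ w ∈ G.massSphere μ, energy p w ≤ c := by
  obtain ⟨i⟩ := ‹Nonempty ι›
  have hL := G.len_pos i
  have hπ := Real.pi_pos
  have hp0 : 0 < p := by linarith
  set S : ℝ := ∫ y in (0 : ℝ)..Real.pi, |Real.sin y| ^ p with hS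
  have hS0 : 0 < S := by
    refine intervalIntegral.intervalIntegral_pos_of_pos_on ?_ (fun y hy => ?_) hπ
    · exact ((Real.continuous_sin.abs).rpow_const fun _ => Or.inr hp0.le).intervalIntegrable _ _
    · have := Real.sin_pos_of_mem_Ioo hy
      positivity
  set B := 1 / p * ((2 * μ / Real.pi) ^ (p / 2) * S) with hB
  have hB0 : 0 < B := by positivity
  have hlim : Filter.Tendsto (fun θ : ℝ => θ ^ 2 * (1 / 2 * μ - B * θ ^ (p / 2 - 3)))
      Filter.atTop Filter.atBot := by
    refine Filter.Tendsto.atTop_mul_atBot₀ (Filter.tendsto_pow_atTop two_ne_zero) ?_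
    refine Filter.tendsto_atBot_add_const_left _ _ ?_
    exact Filter.tendsto_neg_atTop_atBot.comp
      ((tendsto_rpow_atTop (by linarith)).const_mul_atTop hB0)
  have hθ : Filter.Tendsto (fun n : ℕ => (n : ℝ) * Real.pi / G.len i) Filter.atTop Filter.atTop :=
    (tendsto_natCast_atTop_atTop.atTop_mul_const hπ).atTop_div_const hL
  obtain ⟨n, hn, hn1⟩ := (((hlim.comp hθ).eventually_le_atBot c).and
    (Filter.eventually_ge_atTop 1)).exists
  obtain ⟨u, h1, h2, h3⟩ := G.exists_sine_wave i one_pos hn1 rfl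
  simp only [Function.comp] at hn
  have hn0 : (0 : ℝ) < n := by exact_mod_cast hn1
  set θ := (n : ℝ) * Real.pi / G.len i with hθd
  have hθ0 : 0 < θ := by positivity
  have h3' := h3 p hp0
  rw [Nat.cast_one, one_mul] at h1 h2 h3'
  obtain ⟨w, hw, hE⟩ := exists_mem_massSphere (p := p) hμ (u := u) (by rw [h1]; positivity)
  refine ⟨w, hw, ?_⟩
  rw [hE, h1, h2, h3', ← hS]
  refine le_trans (le_of_eq ?_) hn
  have e1 : μ / (θ⁻¹ * (Real.pi / 2)) = 2 * μ / Real.pi * θ := by field_simp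
  have e2 : θ ^ (p / 2) = θ ^ 3 * θ ^ (p / 2 - 3) := by
    rw [← Real.rpow_natCast, ← Real.rpow_add hθ0]
    congr 1
    push_cast
    ring
  rw [e1, Real.mul_rpow (by positivity) hθ0.le, e2, hB]
  field_simp

variable (G) in
-- Ensures that both sets in `cutoffH` are nonempty. The distance to an empty set is 0 for
-- `Metric.infDist`, and the quotient would lose its meaning.
theorem exists_energy_eq [Finite V] {p μ : ℝ} (hp : 6 < p) (hμ : 0 < μ) (c : ℝ) :
    ∃ w ∈ G.massSphere μ, energy p w = c := by
  obtain ⟨v, hv, h1⟩ := G.exists_energy_le hp hμ c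
  obtain ⟨w, hw, h2⟩ := G.exists_le_energy hp hμ c
  have hr : 0 < Real.sqrt μ := Real.sqrt_pos.2 hμ
  have hS : ∀ u : G.H1, ‖G.toL2 u‖ = Real.sqrt μ ↔ mass u = μ := fun u => by
    rw [mass_eq, eq_comm, Real.sqrt_eq_iff_mul_self_eq hμ.le (norm_nonneg _), pow_two, eq_comm]
  obtain ⟨z, hz, h3⟩ := exists_sphere_eq_of_le (E := G.H1) G.toL2 toL2_injective hr
    (continuous_energy (by linarith)) (energy_neg (by linarith)) ((hS v).2 hv) ((hS w).2 hw) h1 h2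
  exact ⟨z, (hS z).1 hz, h3⟩

end MetricGraph

/-! ### Palais-Smale compactness and regularity of the flow field -/

section Abstract

variable {E : Type*} [NormedAddCommGroup E] [InnerProductSpace ℝ E]

/-- Compactness of Palais-Smale sequences when the gradient is a compact perturbation of the
identity. -/
theorem exists_tendsto_of_tangentProj_tendsto_zero {x m z : ℕ → E} {m₀ z₀ : E} {μ : ℝ}
    (hm : Filter.Tendsto m Filter.atTop (nhds m₀)) (hz : Filter.Tendsto z Filter.atTop (nhds z₀))
    (hm0 : m₀ ≠ 0) (hμ : ∀ n, inner ℝ (x n) (m n) = μ) (hne : ∀ n, m n ≠ 0)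
    (h : Filter.Tendsto (fun n => tangentProj (x n - (m n + z n)) (m n)) Filter.atTop (nhds 0)) :
    ∃ x₀, Filter.Tendsto x Filter.atTop (nhds x₀) := by
  have h1 := ((tendsto_const_nhds (x := μ)).sub (hz.inner hm)).div (hm.inner hm)
    (inner_self_ne_zero.2 hm0)
  -- x is recovered as projected gradient + z + multiplier · m, and all three terms converge.
  have h2 := h.add (hz.add (h1.smul hm))
  refine ⟨_, h2.congr fun n => ?_⟩
  rw [tangentProj_sub_add_eq (hne n), hμ n]
  simp only [Pi.div_apply]
  abel

theorem norm_neg_smul_le {k a : ℝ} {w : E} (hk0 : 0 ≤ k) (hk1 : k ≤ 1) (ha : 0 < a)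
    (h : k = 0 ∨ a ≤ ‖w‖) : ‖-((k * (‖w‖ ^ 2)⁻¹) • w)‖ ≤ a⁻¹ := by
  rcases h with h | h
  · rw [h, zero_mul, zero_smul, neg_zero, norm_zero]
    positivity
  · have hw : 0 < ‖w‖ := ha.trans_le h
    rw [norm_neg, norm_smul, norm_mul, norm_inv, norm_pow, norm_norm, Real.norm_of_nonneg hk0]
    calc k * (‖w‖ ^ 2)⁻¹ * ‖w‖ = k * ‖w‖⁻¹ := by field_simp
      _ ≤ 1 * a⁻¹ := by gcongr
      _ = a⁻¹ := one_mul _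

/-- The normalized gradient field cut off near the critical points is locally Lipschitz. -/
theorem LocallyLipschitzOn.neg_smul_inv_sq {S : Set E} {N : E → E} {k : E → ℝ}
    (hN : LocallyLipschitzOn S N) (hk : LocallyLipschitzOn S k)
    (h0 : ∀ x ∈ S, N x = 0 → ∀ᶠ z in nhdsWithin x S, k z = 0) :
    LocallyLipschitzOn S fun x => -((k x * (‖N x‖ ^ 2)⁻¹) • N x) := by
  intro x hx
  by_cases hNx : N x = 0
  · refine ⟨0, {z | k z = 0}, h0 x hx hNx, fun a ha b hb => ?_⟩
    have ha' : k a = 0 := ha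
    have hb' : k b = 0 := hb
    simp [ha', hb']
  · set S' : Set E := S ∩ {z | N z ≠ 0} with hS'
    have hmem : S' ∈ nhdsWithin x S :=
      Filter.inter_mem self_mem_nhdsWithin ((hN.continuousOn x hx).eventually_ne hNx)
    have hNS := hN.mono (s := S') inter_subset_left
    have hk' := (hk.mono (s := S') inter_subset_left).div_real (hNS.real_inner hNS)
      fun z hz => inner_self_ne_zero.2 hz.2
    obtain ⟨K, t, ht, hK⟩ := (hk'.smul hNS).neg (show x ∈ S' from ⟨hx, hNx⟩)
    refine ⟨K, t, nhdsWithin_le_of_mem hmem ht, ?_⟩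
    simp only [real_inner_self_eq_norm_sq, div_eq_mul_inv] at hK
    exact hK

theorem exists_tendsto_of_dist_le {X Y : Type*} [PseudoMetricSpace X] [PseudoMetricSpace Y]
    [CompleteSpace Y] {f : ℕ → X} {g : ℕ → Y} {x : X} {C : ℝ}
    (hf : Filter.Tendsto f Filter.atTop (nhds x))
    (h : ∀ m n, dist (g m) (g n) ≤ C * dist (f m) (f n)) :
    ∃ y, Filter.Tendsto g Filter.atTop (nhds y) := by
  refine cauchySeq_tendsto_of_complete (Metric.cauchySeq_iff.2 fun ε hε => ?_)
  have hC : 0 < |C| + 1 := by positivity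
  obtain ⟨N, hN⟩ := Metric.cauchySeq_iff.1 hf.cauchySeq (ε / (|C| + 1)) (by positivity)
  refine ⟨N, fun m hm n hn => (h m n).trans_lt ?_⟩
  have h1 := hN m hm n hn
  rw [lt_div_iff₀ hC] at h1
  nlinarith [le_abs_self C, dist_nonneg (x := f m) (y := f n)]

omit [InnerProductSpace ℝ E] in
theorem locallyLipschitzOn_infDist_div {U₁ U₂ S : Set E} (h1 : IsClosed U₁) (h2 : IsClosed U₂)
    (hn1 : U₁.Nonempty) (hn2 : U₂.Nonempty) (hd : Disjoint U₁ U₂) :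
    LocallyLipschitzOn S fun u =>
      Metric.infDist u U₁ / (Metric.infDist u U₂ + Metric.infDist u U₁) := by
  have l1 : LocallyLipschitzOn S fun u => Metric.infDist u U₁ :=
    (Metric.lipschitz_infDist_pt U₁).locallyLipschitz.locallyLipschitzOn
  have l2 : LocallyLipschitzOn S fun u => Metric.infDist u U₂ :=
    (Metric.lipschitz_infDist_pt U₂).locallyLipschitz.locallyLipschitzOn
  refine l1.div_real (l2.add l1) fun u _ h => ?_
  have h3 := Metric.infDist_nonneg (x := u) (s := U₁)
  have h4 := Metric.infDist_nonneg (x := u) (s := U₂)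
  have h5 : u ∈ U₁ := (h1.mem_iff_infDist_zero hn1).2 (by linarith)
  have h6 : u ∈ U₂ := (h2.mem_iff_infDist_zero hn2).2 (by linarith)
  exact disjoint_left.1 hd h5 h6

end Abstract

namespace MetricGraph

variable {V ι : Type*} [Fintype ι] {G : MetricGraph V ι}

theorem isClosed_massSphere (μ : ℝ) : IsClosed (G.massSphere μ) := by
  have h : Continuous (mass : G.H1 → ℝ) := by
    have : (mass : G.H1 → ℝ) = fun u => ‖G.toL2 u‖ ^ 2 := funext mass_eq
    rw [this]
    exact G.toL2.continuous.norm.pow 2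
  exact isClosed_eq h continuous_const

theorem cutoffH_mem_Icc (p μ c ε₁ : ℝ) (u : G.H1) : G.cutoffH p μ c ε₁ u ∈ Icc (0 : ℝ) 1 := by
  have h1 := Metric.infDist_nonneg (x := u) (s := {w | w ∈ G.massSphere μ ∧ 3 * ε₁ ≤ |energy p w - c|})
  have h2 := Metric.infDist_nonneg (x := u) (s := {w | w ∈ G.massSphere μ ∧ |energy p w - c| ≤ 2 * ε₁})
  exact ⟨div_nonneg h1 (add_nonneg h2 h1), div_le_one_of_le₀ (by linarith) (add_nonneg h2 h1)⟩

theorem cutoffH_eq_zero {p μ c ε₁ : ℝ} {u : G.H1} (hu : u ∈ G.massSphere μ)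
    (h : 3 * ε₁ ≤ |energy p u - c|) : G.cutoffH p μ c ε₁ u = 0 := by
  rw [cutoffH, Metric.infDist_zero_of_mem (show u ∈ {w | w ∈ G.massSphere μ ∧
    3 * ε₁ ≤ |energy p w - c|} from ⟨hu, h⟩), zero_div]

variable [Finite V] [Nonempty ι]

theorem locallyLipschitzOn_cutoffH {p μ ε₁ : ℝ} (hp : 6 < p) (hμ : 0 < μ) (hε₁ : 0 < ε₁) (c : ℝ) :
    LocallyLipschitzOn (G.massSphere μ) (G.cutoffH p μ c ε₁) := by
  have hE := continuous_energy (G := G) (p := p) (by linarith)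
  have hE' : Continuous fun w : G.H1 => |energy p w - c| := (hE.sub continuous_const).abs
  obtain ⟨v, hv, hv'⟩ := G.exists_energy_eq hp hμ (c + 3 * ε₁)
  obtain ⟨w, hw, hw'⟩ := G.exists_energy_eq hp hμ c
  refine locallyLipschitzOn_infDist_div
    ((isClosed_massSphere μ).inter (isClosed_le continuous_const hE'))
    ((isClosed_massSphere μ).inter (isClosed_le hE' continuous_const))
    ⟨v, hv, ?_⟩ ⟨w, hw, ?_⟩ ?_
  · change 3 * ε₁ ≤ |energy p v - c|
    rw [hv', add_sub_cancel_left]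
    exact le_abs_self _
  · change |energy p w - c| ≤ 2 * ε₁
    rw [hw', sub_self, abs_zero]
    positivity
  · rw [disjoint_left]
    rintro a ⟨-, h1⟩ ⟨-, h2⟩
    have h1 : 3 * ε₁ ≤ |energy p a - c| := h1
    have h2 : |energy p a - c| ≤ 2 * ε₁ := h2
    linarith

theorem mem_critSet_of_constrGrad_eq_zero {p μ α β : ℝ} (hp : 2 < p) {u : G.H1}
    (hu : u ∈ G.massSphere μ) (h : constrGrad p u = 0) (h1 : α ≤ energy p u)
    (h2 : energy p u ≤ β) : u ∈ G.critSet p μ α β := by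
  refine ⟨hu, fun φ hφ => ?_, h1, h2⟩
  have hφ' : pairing u φ = 0 := hφ
  rw [← inner_massGrad] at hφ'
  rw [fderiv_energy hp, ← inner_tangentProj_left hφ', ← constrGrad_eq hp, h, inner_zero_left]

/-- The constrained gradient is bounded away from zero far from the critical points, on bounded
sets. -/
theorem exists_le_norm_constrGrad {p μ : ℝ} (hp : 2 < p) (hμ : 0 < μ) (R α β : ℝ) {δ : ℝ}
    (hδ : 0 < δ) : ∃ a : ℝ, 0 < a ∧ ∀ u ∈ G.massSphere μ, ‖u‖ ≤ R → α ≤ energy p u →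
      energy p u ≤ β → u ∉ Metric.thickening δ (G.critSet p μ α β) → a ≤ ‖constrGrad p u‖ := by
  by_contra! hcon
  choose u hS hR hα hβ hT hN using fun n : ℕ => hcon (1 / ((n : ℝ) + 1)) (by positivity)
  obtain ⟨z, φ, hφ, hz⟩ := exists_subseq_tendsto_toL2 hR
  obtain ⟨A, hA, hrep⟩ := G.exists_abs_rep_le
  have hR0 : 0 ≤ R := (norm_nonneg _).trans (hR 0)
  have hb : ∀ n, ∀ e, ∀ x ∈ Icc 0 (G.len e), |rep (u n) e x| ≤ A * R := fun n e x hx =>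
    (hrep _ e x hx).trans (mul_le_mul_of_nonneg_left (hR n) hA.le)
  obtain ⟨g, hg⟩ : ∃ g, Filter.Tendsto (fun n => nonlin p (u (φ n))) Filter.atTop (nhds g) :=
    exists_tendsto_of_dist_le (C := (p - 1) * (A * R) ^ (p - 2)) hz fun m n => by
      rw [dist_eq_norm, dist_eq_norm]
      exact norm_nonlin_sub_le hp (hb _) (hb _) (by positivity)
  have hm : Filter.Tendsto (fun n => massGrad (u (φ n))) Filter.atTop (nhds (G.resolvent z)) :=
    (G.resolvent.continuous.tendsto z).comp hz
  have hg' : Filter.Tendsto (fun n => G.resolvent (nonlin p (u (φ n)))) Filter.atTop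
      (nhds (G.resolvent g)) := (G.resolvent.continuous.tendsto g).comp hg
  have hin : ∀ n, inner ℝ (u (φ n)) (massGrad (u (φ n))) = μ := fun n => by
    rw [real_inner_comm, inner_massGrad_self]
    exact hS _
  have hne : ∀ n, massGrad (u (φ n)) ≠ 0 := fun n h => by
    have := hin n
    rw [h, inner_zero_right] at this
    exact hμ.ne this
  -- Otherwise μ = ⟨u, Ru⟩ ≤ R ‖Ru‖ would tend to 0 along the sequence (the factor R being the
  -- radius).
  have hm0 : G.resolvent z ≠ 0 := by
    intro h
    rw [h] at hm
    have h1 : Filter.Tendsto (fun n => R * ‖massGrad (u (φ n))‖) Filter.atTop (nhds (R * ‖(0 : G.H1)‖)) :=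
      hm.norm.const_mul R
    rw [norm_zero, mul_zero] at h1
    refine absurd (ge_of_tendsto' h1 fun n => ?_) (not_le.2 hμ)
    rw [← hin n]
    exact (real_inner_le_norm _ _).trans (mul_le_mul_of_nonneg_right (hR _) (norm_nonneg _))
  have hN0 : Filter.Tendsto (fun n => constrGrad p (u (φ n))) Filter.atTop (nhds 0) := by
    rw [tendsto_zero_iff_norm_tendsto_zero]
    refine squeeze_zero (fun _ => norm_nonneg _) (fun n => (hN (φ n)).le) ?_
    exact tendsto_one_div_add_atTop_nhds_zero_nat.comp hφ.tendsto_atTop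
  obtain ⟨x, hx⟩ : ∃ x, Filter.Tendsto (fun n => u (φ n)) Filter.atTop (nhds x) := by
    refine exists_tendsto_of_tangentProj_tendsto_zero (E := G.H1) hm hg' hm0 hin hne ?_
    refine hN0.congr fun n => ?_
    rw [constrGrad_eq hp, energyGrad, map_add]
    rfl
  have hE := (continuous_energy (G := G) hp).continuousAt.tendsto.comp hx
  have hxS : x ∈ G.massSphere μ :=
    (isClosed_massSphere μ).mem_of_tendsto hx (Filter.Eventually.of_forall fun n => hS _)
  have hx0 : constrGrad p x = 0 := by
    have h1 := (locallyLipschitzOn_constrGrad (G := G) hp hμ).continuousOn x hxS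
    exact tendsto_nhds_unique (h1.tendsto.comp (tendsto_nhdsWithin_iff.2
      ⟨hx, Filter.Eventually.of_forall fun n => hS _⟩)) hN0
  have hxC : x ∈ G.critSet p μ α β := mem_critSet_of_constrGrad_eq_zero hp hxS hx0
    (ge_of_tendsto' hE fun n => hα _) (le_of_tendsto' hE fun n => hβ _)
  obtain ⟨n, hn⟩ := (hx.eventually (Metric.ball_mem_nhds x hδ)).exists
  exact hT (φ n) (Metric.mem_thickening_iff.2 ⟨x, hxC, hn⟩)

theorem locallyLipschitzOn_flowField {p μ c ε ε₁ δ : ℝ} {y : G.H1 → ℝ} (hp : 6 < p) (hμ : 0 < μ)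
    (hε₁ : 0 < ε₁) (hε : 3 * ε₁ ≤ ε) (hδ : 0 < δ) (hy : G.IsCutoffY p μ c ε δ y) :
    LocallyLipschitzOn (G.massSphere μ) (G.flowField p μ c ε₁ y) := by
  have hk : LocallyLipschitzOn (G.massSphere μ) fun u => G.cutoffH p μ c ε₁ u * y u :=
    (locallyLipschitzOn_cutoffH hp hμ hε₁ c).smul hy.1
  refine LocallyLipschitzOn.neg_smul_inv_sq (E := G.H1)
    (locallyLipschitzOn_constrGrad (by linarith) hμ) hk fun u hu h0 => ?_
  -- A zero of the gradient with energy in the window is in the critical set, near which y vanishes.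
  -- Outside the window |E - c| > ε ≥ 3ε₁, so h vanishes nearby.
  by_cases h : |energy p u - c| ≤ ε
  · rw [abs_le] at h
    have hc : u ∈ G.critSet p μ (c - ε) (c + ε) :=
      mem_critSet_of_constrGrad_eq_zero (by linarith) hu h0 (by linarith) (by linarith)
    have hn : Metric.thickening (δ / 3) (G.critSet p μ (c - ε) (c + ε)) ∈ nhds u :=
      Metric.isOpen_thickening.mem_nhds (Metric.self_subset_thickening (by positivity) _ hc)
    filter_upwards [self_mem_nhdsWithin, mem_nhdsWithin_of_mem_nhds hn] with z hz1 hz2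
    rw [(hy.2 z hz1).2.2 hz2, mul_zero]
  · have hE : Continuous fun w : G.H1 => |energy p w - c| :=
      ((continuous_energy (by linarith)).sub continuous_const).abs
    have hn : {w : G.H1 | 3 * ε₁ < |energy p w - c|} ∈ nhds u :=
      (isOpen_lt continuous_const hE).mem_nhds (by
        change 3 * ε₁ < _
        linarith [not_le.1 h])
    filter_upwards [self_mem_nhdsWithin, mem_nhdsWithin_of_mem_nhds hn] with z hz1 hz2
    have hz2 : 3 * ε₁ < |energy p z - c| := hz2
    rw [cutoffH_eq_zero hz1 hz2.le, zero_mul]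

/-- Where h y is not zero, the energy is in the window and the point is outside the
δ/3-neighbourhood of the critical set. There the gradient is at least some a > 0, so the speed is at
most 1/a. -/
theorem exists_norm_flowField_le {p μ c ε ε₁ δ : ℝ} {y : G.H1 → ℝ} (hp : 6 < p) (hμ : 0 < μ)
    (hε : 3 * ε₁ ≤ ε) (hδ : 0 < δ) (hy : G.IsCutoffY p μ c ε δ y) (R : ℝ) :
    ∃ M : ℝ, ∀ u ∈ G.massSphere μ, ‖u‖ ≤ R → ‖G.flowField p μ c ε₁ y u‖ ≤ M := by
  obtain ⟨a, ha, h⟩ := exists_le_norm_constrGrad (G := G) (p := p) (by linarith) hμ R (c - ε)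
    (c + ε) (δ := δ / 3) (by positivity)
  refine ⟨a⁻¹, fun u hu hR => ?_⟩
  obtain ⟨⟨y0, y1⟩, -, hy0⟩ := hy.2 u hu
  obtain ⟨h0, h1⟩ := cutoffH_mem_Icc p μ c ε₁ u
  refine norm_neg_smul_le (E := G.H1) (mul_nonneg h0 y0) (mul_le_one₀ h1 y0 y1) ha ?_
  by_cases hE : 3 * ε₁ ≤ |energy p u - c|
  · rw [cutoffH_eq_zero hu hE, zero_mul]
    exact Or.inl rfl
  by_cases hT : u ∈ Metric.thickening (δ / 3) (G.critSet p μ (c - ε) (c + ε))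
  · rw [hy0 hT, mul_zero]
    exact Or.inl rfl
  have hE' := abs_le.1 ((not_le.1 hE).le.trans hε)
  exact Or.inr (h u hu hR (by linarith) (by linarith) hT)

end MetricGraph

/-! ### Invariance of the two sets under the flow -/

theorem inner_neg_smul_eq {E : Type*} [NormedAddCommGroup E] [InnerProductSpace ℝ E] (a b : E)
    (k : ℝ) : inner ℝ a (-(k • b)) = -(k * inner ℝ a b) := by
  rw [inner_neg_right, real_inner_smul_right]

theorem neg_smul_eq_smul_sub {E : Type*} [NormedAddCommGroup E] [InnerProductSpace ℝ E]
    {w x b : E} {k : ℝ} (h : w = x - b) : -(k • w) = k • (b - x) := by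
  rw [h, ← smul_neg, neg_sub]

namespace MetricGraph

variable {V ι : Type*} [Fintype ι] {G : MetricGraph V ι}

theorem massSphere_eq {μ : ℝ} (hμ : 0 < μ) :
    G.massSphere μ = {u | ‖G.toL2 u‖ = Real.sqrt μ} := by
  ext u
  change mass u = μ ↔ ‖G.toL2 u‖ = Real.sqrt μ
  rw [mass_eq, eq_comm (b := Real.sqrt μ), Real.sqrt_eq_iff_mul_self_eq hμ.le (norm_nonneg _),
    pow_two, eq_comm]

theorem continuous_kinetic : Continuous (kinetic : G.H1 → ℝ) := by
  have : (kinetic : G.H1 → ℝ) = fun u => ‖G.derL2 u‖ ^ 2 := funext kinetic_eq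
  rw [this]
  exact G.derL2.continuous.norm.pow 2

theorem flowField_eq_smul {p μ c ε₁ : ℝ} {y : G.H1 → ℝ} {x b : G.H1}
    (h : constrGrad p x = x - b) : G.flowField p μ c ε₁ y x
      = (G.cutoffH p μ c ε₁ x * y x * (‖constrGrad p x‖ ^ 2)⁻¹) • (b - x) :=
  neg_smul_eq_smul_sub (E := G.H1) h

/-- The coefficient of the flow field is nonnegative. -/
theorem flowCoeff_nonneg {p μ c ε ε₁ δ : ℝ} {y : G.H1 → ℝ} (hy : G.IsCutoffY p μ c ε δ y)
    {u : G.H1} (hu : u ∈ G.massSphere μ) :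
    0 ≤ G.cutoffH p μ c ε₁ u * y u * (‖constrGrad p u‖ ^ 2)⁻¹ :=
  mul_nonneg (mul_nonneg (cutoffH_mem_Icc p μ c ε₁ u).1 (hy.2 u hu).1.1) (by positivity)

variable [Finite V] [Nonempty ι]

theorem inner_toL2_flowField {p μ c ε₁ : ℝ} {y : G.H1 → ℝ} (hp : 2 < p) (u : G.H1) :
    inner ℝ (G.toL2 u) (G.toL2 (G.flowField p μ c ε₁ y u)) = 0 := by
  rw [← pairing_eq, ← inner_massGrad]
  refine (inner_neg_smul_eq (E := G.H1) _ _ _).trans ?_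
  rw [inner_massGrad_constrGrad hp, mul_zero, neg_zero]

theorem inner_energyGrad_flowField_nonpos {p μ c ε ε₁ δ : ℝ} {y : G.H1 → ℝ} (hp : 2 < p)
    (hy : G.IsCutoffY p μ c ε δ y) {u : G.H1} (hu : u ∈ G.massSphere μ) :
    inner ℝ (energyGrad p u) (G.flowField p μ c ε₁ y u) ≤ 0 := by
  refine (inner_neg_smul_eq (E := G.H1) _ _ _).trans_le ?_
  rw [inner_energyGrad_constrGrad hp, neg_nonpos]
  exact mul_nonneg (flowCoeff_nonneg hy hu) (by positivity)

theorem exists_local_flow {p μ c ε ε₁ δ : ℝ} {y : G.H1 → ℝ} (hp : 6 < p) (hμ : 0 < μ)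
    (hε₁ : 0 < ε₁) (hε : 3 * ε₁ ≤ ε) (hδ : 0 < δ) (hy : G.IsCutoffY p μ c ε δ y) {z : G.H1}
    (hz : z ∈ G.massSphere μ) : ∃ τ > 0, ∃ σ : ℝ → G.H1,
      IsSolutionOn (E := G.H1) (G.massSphere μ) (G.flowField p μ c ε₁ y) (Icc 0 τ) z σ := by
  have hW := locallyLipschitzOn_flowField hp hμ hε₁ hε hδ hy
  rw [massSphere_eq hμ] at hW hz ⊢
  exact exists_local_solution_on_sphere (E := G.H1) G.toL2 (Real.sqrt_pos.2 hμ) hW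
    (fun x _ => inner_toL2_flowField (by linarith) x) hz

/-- The energy stays below M₂, whereas it is at least M₂ where the kinetic term equals ρ*. So the
kinetic term, being continuous in time, never reaches ρ*. -/
theorem BM2_invariant {p K μ c ε ε₁ δ T : ℝ} {y : G.H1 → ℝ} (hp : 6 < p) (hK : G.IsGNConst p K)
    (hy : G.IsCutoffY p μ c ε δ y) {u : G.H1} (hu : u ∈ G.BM2 p K μ) {σ : ℝ → G.H1}
    (hσ : IsSolutionOn (E := G.H1) (G.massSphere μ) (G.flowField p μ c ε₁ y) (Icc 0 T) u σ) :
    ∀ t ∈ Icc 0 T, σ t ∈ G.BM2 p K μ := by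
  have hanti := IsSolutionOn.antitoneOn (E := G.H1) hσ (f := energy p) (g := energyGrad p)
    (differentiableAt_energy (by linarith))
    fun x hx => inner_energyGrad_flowField_nonpos (by linarith) hy hx
  have hE : ∀ t ∈ Icc 0 T, energy p (σ t) < G.M2 p K μ := fun t ht => by
    have h1 := hanti ⟨le_rfl, ht.1.trans ht.2⟩ ht ht.1
    simp only [hσ.1] at h1
    exact h1.trans_lt hu.2.2
  have hk := ContinuousOn.forall_Icc_lt (f := fun t => kinetic (σ t)) (T := T)
    (continuous_kinetic.comp_continuousOn (IsSolutionOn.continuousOn (E := G.H1) hσ))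
    (by simpa only [hσ.1] using hu.2.1)
    fun t ht h => absurd (hE t ht) (not_lt.2 (M2_le_energy hp hK (hσ.2 t ht).1 h))
  exact fun t ht => ⟨(hσ.2 t ht).1, hk t ht, hE t ht⟩

/-- Each of the two cone neighbourhoods is invariant by itself. For the negative cone only the
oddness of the gradient is used: the cut-offs need not be even, since all that matters is that the
coefficient is nonnegative. -/
theorem dStar_invariant {p μ c ε ε₁ δ T ν ν' R : ℝ} {y : G.H1 → ℝ} (hp : 6 < p) (hμ : 0 < μ)
    (hy : G.IsCutoffY p μ c ε δ y) {u : G.H1} {σ : ℝ → G.H1} (hν : ν < ν')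
    (hν' : ∀ u : G.H1, mass u = μ → kinetic u ≤ R → Metric.infDist u G.posCone < ν' →
      massGrad u ∈ G.posCone ∧ G.resolvent (nonlin p u) ∈ G.posCone)
    (hσ : IsSolutionOn (E := G.H1) (G.massSphere μ) (G.flowField p μ c ε₁ y) (Icc 0 T) u σ)
    (hB : ∀ t ∈ Icc 0 T, kinetic (σ t) ≤ R ∧ powInt p (σ t) ≤ mass (σ t)) (hu : u ∈ G.dStar ν) :
    ∀ t ∈ Icc 0 T, σ t ∈ G.dStar ν := by
  have hpos : ∀ x : G.H1, mass x = μ → kinetic x ≤ R → powInt p x ≤ mass x →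
      Metric.infDist x G.posCone < ν' → ∃ b ∈ G.posCone, constrGrad p x = x - b :=
    fun x hx hk hpw hd => exists_constrGrad_eq_sub (by linarith) (by rw [hx]; exact hμ.ne') hpw
      (hν' x hx hk hd).1 (hν' x hx hk hd).2
  rcases hu with hu | hu
  · have hdrag : ∀ t ∈ Icc 0 T, Metric.infDist (σ t) G.posCone < ν' → ∃ θ : ℝ, 0 ≤ θ ∧
        ∃ b ∈ G.posCone, G.flowField p μ c ε₁ y (σ t) = θ • (b - σ t) := fun t ht hd => by
      have hS := (hσ.2 t ht).1
      obtain ⟨b, hb, h⟩ := hpos (σ t) hS (hB t ht).1 (hB t ht).2 hd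
      exact ⟨_, flowCoeff_nonneg hy hS, b, hb, flowField_eq_smul h⟩
    exact fun t ht => Or.inl (IsSolutionOn.infDist_le (E := G.H1) (C := G.posCone) hσ
      (segmentPoint_mem_posCone (G := G)) hν hdrag hu t ht)
  · have hdrag : ∀ t ∈ Icc 0 T, Metric.infDist (σ t) G.negCone < ν' → ∃ θ : ℝ, 0 ≤ θ ∧
        ∃ b ∈ G.negCone, G.flowField p μ c ε₁ y (σ t) = θ • (b - σ t) := fun t ht hd => by
      have hS := (hσ.2 t ht).1
      rw [← infDist_neg_posCone] at hd
      obtain ⟨b, hb, h⟩ := hpos (-σ t) (by rw [mass_neg]; exact hS)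
        (by rw [kinetic_neg]; exact (hB t ht).1)
        (by rw [powInt_neg (by linarith), mass_neg]; exact (hB t ht).2) hd
      have h' : constrGrad p (σ t) = σ t - -b := by
        rw [constrGrad_neg (by linarith)] at h
        rw [sub_neg_eq_add, ← neg_inj, h]
        abel
      exact ⟨_, flowCoeff_nonneg hy hS, -b, neg_mem_negCone.2 hb, flowField_eq_smul h'⟩
    exact fun t ht => Or.inr (IsSolutionOn.infDist_le (E := G.H1) (C := G.negCone) hσ
      (segmentPoint_mem_negCone (G := G)) hν hdrag hu t ht)

end MetricGraph
end

/-! ### The proposition -/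

theorem proposition4p2 {V ι : Type*} [Finite V] [Fintype ι] [Nonempty ι] (G : MetricGraph V ι)
    (p : ℝ) (hp : 6 < p) :
    (∃ K : ℝ, G.IsGNConst p K) ∧
    ∀ K : ℝ, G.IsGNConst p K →
      ∃ μt : ℝ, G.IsMuTilde p K μt ∧ (∀ m : ℝ, G.IsMuTilde p K m → m = μt) ∧
        ∀ μ : ℝ, 0 < μ → μ ≤ μt →
          ∃ νStar : ℝ, 0 < νStar ∧ ∀ ν : ℝ, 0 < ν → ν < νStar →
            ∀ (c ε ε₁ δ : ℝ) (y : G.H1 → ℝ),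
              0 < ε₁ → 3 * ε₁ ≤ ε → 0 < δ → G.IsCutoffY p μ c ε δ y →
              ∀ u ∈ G.dStar ν ∩ G.BM2 p K μ,
                ∃ η : ℝ → G.H1,
                  G.IsFlowLine p μ c ε₁ y (Set.Ici 0) u η ∧
                  (∀ (T : ℝ) (σ : ℝ → G.H1), 0 < T →
                    G.IsFlowLine p μ c ε₁ y (Set.Ico 0 T) u σ →
                    ∀ t ∈ Set.Ico 0 T, σ t = η t) ∧
                  ∀ t : ℝ, 0 < t → η t ∈ G.dStar ν ∩ G.BM2 p K μ := by
  refine ⟨G.exists_isGNConst hp, fun K hK => ?_⟩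
  obtain ⟨μt, hμt, huniq⟩ := MetricGraph.existsUnique_isMuTilde (G := G) hp hK.1
  refine ⟨μt, hμt, huniq, fun μ hμ hle => ?_⟩
  -- The threshold ν* is fixed here, before c, the ε's, δ and y are introduced.
  obtain ⟨ν', hν'0, hν'⟩ := G.exists_resolvent_mem_posCone_of_near (p := p)
    (R := MetricGraph.rhoStar p K μ) (by linarith) hμ
  refine ⟨ν', hν'0, fun ν _ hν c ε ε₁ δ y hε₁ hε hδ hy u hu => ?_⟩
  have hW := MetricGraph.locallyLipschitzOn_flowField hp hμ hε₁ hε hδ hy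
  -- In `BM2` one has ‖u‖² = μ + ∫|u'|² < μ + ρ*, which gives the radius.
  obtain ⟨M, hM⟩ := MetricGraph.exists_norm_flowField_le hp hμ hε hδ hy
    (Real.sqrt (μ + MetricGraph.rhoStar p K μ))
  have hB := fun (T : ℝ) (σ : ℝ → G.H1)
    (hσ : IsSolutionOn (E := G.H1) (G.massSphere μ) (G.flowField p μ c ε₁ y) (Icc 0 T) u σ) =>
      MetricGraph.BM2_invariant hp hK hy hu.2 hσ
  obtain ⟨η, hη⟩ := exists_isSolutionOn_Ici (E := G.H1) (MetricGraph.isClosed_massSphere μ) hW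
    (fun z hz => MetricGraph.exists_local_flow hp hμ hε₁ hε hδ hy hz) hu.2.1 (M := M)
    (fun T σ hσ t ht => by
      have h := hB T σ hσ t ht
      refine hM _ h.1 (Real.le_sqrt_of_sq_le ?_)
      have h1 : MetricGraph.mass (σ t) = μ := h.1
      rw [MetricGraph.norm_sq_eq, h1]
      linarith [h.2.1])
  have hη' : ∀ T : ℝ,
      IsSolutionOn (E := G.H1) (G.massSphere μ) (G.flowField p μ c ε₁ y) (Icc 0 T) u η := fun T =>
    IsSolutionOn.mono (E := G.H1) hη Icc_subset_Ici_self
  refine ⟨η, hη, fun T σ _ hσ t ht => ?_, fun t ht => ?_⟩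
  · have hσ' : IsSolutionOn (E := G.H1) (G.massSphere μ) (G.flowField p μ c ε₁ y) (Ico 0 T) u σ :=
      hσ
    exact IsSolutionOn.eqOn (E := G.H1) hW
      (IsSolutionOn.mono (E := G.H1) hσ' fun s hs => ⟨hs.1, hs.2.trans_lt ht.2⟩) (hη' t)
      ⟨ht.1, le_rfl⟩
  · have h1 := hB t η (hη' t)
    refine ⟨MetricGraph.dStar_invariant hp hμ hy hν hν' (hη' t) (fun s hs => ?_) hu.1 t
      ⟨ht.le, le_rfl⟩, h1 t ⟨ht.le, le_rfl⟩⟩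
    obtain ⟨h2, h3, -⟩ := h1 s hs
    exact ⟨h3.le, MetricGraph.powInt_le_mass_of_kinetic_lt hp hK hμt hμ hle h2 h3⟩
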